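/- Let $W$ be a compact oriented smooth surface with boundary, each of whose connected components meets $\partial W$, and let $h:W\to W$ be an orientation preserving diffeomorphism that is the identity on a collar of $\partial W$. Identify this collar with a finite disjoint union of copies of $S^1\times[0,\varepsilon)\ni(\theta,t)$, where $S^1=\mathbb R/2\pi\mathbb Z$, $\partial W=\{t=0\}$ and $\theta$ runs along $\partial W$ in the direction of the boundary orientation. Let $W(h)$ be the mapping torus, obtained from $W\times[0,2\pi]$ by identifying $(x,0)$ with $(h(x),2\pi)$, and let $$M=W(h)\cup(\partial W\times D^2)$$ be the smooth 3-manifold in which the coordinates $((t,\theta),\tau)$ on collar$\,\times S^1$ are identified with $(\theta,(1+t)e^{i\tau})$ on $\partial W\times D^2_{1+\varepsilon}$. Write $(r,\phi)$ for polar coordinates on the disk and $D$ for the open unit disk. $M$ is oriented by $W\times S^1$ on $W(h)$, that is, by $d\theta\wedge dr\wedge d\phi$ near the binding $K=\partial W\times\{0\}$. The pages of this open book are $$F_\alpha=(W\times\{\alpha\})\cup(\partial W\times\{re^{i\alpha}:0<r<1\}),\qquad 0\le\alpha<2\pi .$$ On each component of $\partial W\times D$ let $\lambda_2=\gamma_1(r)\,d\theta+\gamma_2(r)\,d\phi$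 be a *local model near the binding*. This means that $\gamma_1,\gamma_2:[0,\infty)\to\mathbb R$ are smooth and, with $\mu=\gamma_1\gamma_2'-\gamma_1'\gamma_2$: 1. $\gamma_1$, $\gamma_2$ and $\gamma_2/r^2$ are smooth as functions on $D$; 2. $\mu(r)>0$ for $0<r<1$; 3. $\gamma_1(0)>0$, and $\gamma_1'(r)<0$ for $0<r<1$; 4. $\lim_{r\to0}\mu(r)/r=\gamma_1(0)\gamma_2''(0)>0$; 5. $\kappa=\gamma_1''(0)/\gamma_2''(0)\notin\mathbb Z$ and $\kappa\le-\tfrac12$; 6. $A(r)=\mu(r)^{-2}\left(\gamma_2''(r)\gamma_1'(r)-\gamma_1''(r)\gamma_2'(r)\right)=O(r)$ as $r\to0^+$. Then there is a smooth family of 1-forms $(\lambda_\delta)_{0\le\delta<1}$ on $M$ (jointly smooth in $\delta$ and the point) such that: * $\lambda_0$ is a confoliation form, i.e. it vanishes nowhere and $\lambda_0\wedge d\lambda_0\ge0$, and $\ker\lambda_0$ agrees with the tangent spaces of the pages away from the binding, i.e. outside $\partial W\times\{r<\rho\}$ for some $0<\rho<1$. * For $0<\delta<1$ the form $\lambda_\delta$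 is a contact form and $\ker\lambda_\delta$ is supported by the open book: there is a contact form $\lambda'$ with $\ker\lambda'=\ker\lambda_\delta$ such that $d\lambda'$ is an area form on every page, every component of $K$ is a closed orbit of the Reeb vector field of $\lambda'$, and $\lambda'$ orients $K$ as the boundary of the pages oriented by $d\lambda'$. Moreover the Reeb vector field $X_{\lambda_\delta}$ of $\lambda_\delta$ itself is transverse to all pages, and every component of $K$ is a periodic orbit of $X_{\lambda_\delta}$. * There is a neighbourhood $\partial W\times\{r<\rho'\}$ of $K$, with $0<\rho'<1$, on which $\lambda_\delta=\lambda_2$ for all $0\le\delta<1$. In particular, for all $0\le\delta<1$, every component of $K$ is a nondegenerate elliptic periodic Reeb orbit of $\lambda_\delta$ (which is a contact form near $K$): the linearized return map over the minimal period, restricted to $\ker\lambda_\delta$, does not have the eigenvalue $1$, and its eigenvalues lie on the unit circle. -/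

import Mathlib

open Set Filter Topology
open scoped Manifold ContDiff

noncomputable section

/-! ### Differential forms on a 3-manifold -/

section Forms

variable {M : Type*} [TopologicalSpace M] [ChartedSpace (EuclideanSpace ℝ (Fin 3)) M]

/-- A (not necessarily smooth) 1-form on the 3-manifold `M`. -/
abbrev OneForm (M : Type*) [TopologicalSpace M] [ChartedSpace (EuclideanSpace ℝ (Fin 3)) M] :=
  ∀ p : M, TangentSpace (𝓡 3) p →L[ℝ] ℝ

/-- The coordinate expression of `lam` in the preferred chart at `p₀`: the pullback of `lam` by
the inverse of that chart (meaningful on the target of the chart). -/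
def localForm (lam : OneForm M) (p₀ : M) (y : EuclideanSpace ℝ (Fin 3)) :
    EuclideanSpace ℝ (Fin 3) →L[ℝ] ℝ :=
  (lam ((extChartAt (𝓡 3) p₀).symm y)).comp
    (mfderiv 𝓘(ℝ, EuclideanSpace ℝ (Fin 3)) (𝓡 3) (extChartAt (𝓡 3) p₀).symm y)

/-- A smooth 1-form. -/
def IsSmoothForm (lam : OneForm M) : Prop :=
  ∀ p₀ : M, ContDiffOn ℝ ∞ (localForm lam p₀) (extChartAt (𝓡 3) p₀).target

/-- A smooth family of 1-forms, with parameters in `s`: jointly smooth in the parameter and the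
point. -/
def IsSmoothFamily (lam : ℝ → OneForm M) (s : Set ℝ) : Prop :=
  ∀ p₀ : M, ContDiffOn ℝ ∞
    (fun y : ℝ × EuclideanSpace ℝ (Fin 3) => localForm (lam y.1) p₀ y.2)
    (s ×ˢ (extChartAt (𝓡 3) p₀).target)

/-- The exterior derivative `dλ` at `p`, as a bilinear function of two tangent vectors, computed in
the preferred chart at `p` (the derivative of that chart at `p` is the identity of `T_pM`). -/
def dForm (lam : OneForm M) (p : M) (u v : TangentSpace (𝓡 3) p) : ℝ :=
  extDeriv (fun y => ContinuousAlternatingMap.ofSubsingleton ℝ (EuclideanSpace ℝ (Fin 3)) ℝ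
    (0 : Fin 1) (localForm lam p y)) (extChartAt (𝓡 3) p p)
    (![u, v] : Fin 2 → EuclideanSpace ℝ (Fin 3))

/-- The 3-form `λ ∧ dλ` at `p`. -/
def wedgeForm (lam : OneForm M) (p : M) (u v w : TangentSpace (𝓡 3) p) : ℝ :=
  lam p u * dForm lam p v w - lam p v * dForm lam p u w + lam p w * dForm lam p u v

/-- `λ ∧ dλ` vanishes nowhere on `U`. -/
def IsContactOn (lam : OneForm M) (U : Set M) : Prop :=
  ∀ p ∈ U, ∀ u v w : TangentSpace (𝓡 3) p,
    LinearIndependent ℝ ![u, v, w] → wedgeForm lam p u v w ≠ 0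

/-- A contact form on `M`. -/
def IsContactForm (lam : OneForm M) : Prop :=
  IsSmoothForm lam ∧ IsContactOn lam univ

/-- `X` is, on `U`, the Reeb vector field of `lam`. -/
def IsReebOn (lam : OneForm M) (X : ∀ p : M, TangentSpace (𝓡 3) p) (U : Set M) : Prop :=
  ∀ p ∈ U, lam p (X p) = 1 ∧ ∀ v : TangentSpace (𝓡 3) p, dForm lam p (X p) v = 0

/-- `C` is (the image of) a periodic orbit of the vector field `X`. -/
def IsPeriodicOrbit (X : ∀ p : M, TangentSpace (𝓡 3) p) (C : Set M) : Prop :=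
  ∃ (c : ℝ → M) (T : ℝ), 0 < T ∧ IsMIntegralCurve c X ∧ Function.Periodic c T ∧ range c = C

/-- `C` is (the image of) a nondegenerate elliptic periodic Reeb orbit of `lam`. Here `lam` is only
required to be a contact form on a neighbourhood `U` of `C`; `T` is the minimal period, `Φ` is the
Reeb flow on a neighbourhood `V` of the point `p ∈ C` for times in `[0, T]`, and `DΦ_T(p)` is the
linearized return map. Nondegenerate: the restriction of `DΦ_T(p)` to `ker lam` does not have the
eigenvalue `1`. Elliptic: all eigenvalues of `DΦ_T(p)` lie on the unit circle (besides those of the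
restriction to `ker lam` there is only the eigenvalue `1` in the Reeb direction). -/
def IsNondegenerateEllipticOrbit (lam : OneForm M) (C : Set M) : Prop :=
  ∃ (U V : Set M) (X : ∀ p : M, TangentSpace (𝓡 3) p) (Φ : ℝ → M → M) (p : M) (T : ℝ),
    IsOpen U ∧ C ⊆ U ∧ IsContactOn lam U ∧ IsReebOn lam X U ∧
    IsOpen V ∧ p ∈ V ∧ 0 < T ∧
    (∀ x ∈ V, Φ 0 x = x ∧ IsMIntegralCurveOn (fun t => Φ t x) X (Icc 0 T) ∧
      ∀ t ∈ Icc 0 T, Φ t x ∈ U) ∧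
    Φ T p = p ∧ (∀ t ∈ Ioo 0 T, Φ t p ≠ p) ∧ (fun t => Φ t p) '' Icc 0 T = C ∧
    MDifferentiableAt (𝓡 3) (𝓡 3) (Φ T) p ∧
    ∃ L : EuclideanSpace ℝ (Fin 3) →L[ℝ] EuclideanSpace ℝ (Fin 3),
      L = mfderiv (𝓡 3) (𝓡 3) (Φ T) p ∧
      (∀ v : EuclideanSpace ℝ (Fin 3), lam p v = 0 → L v = v → v = 0) ∧
      ∀ μ : ℂ, ((L : EuclideanSpace ℝ (Fin 3) →ₗ[ℝ] EuclideanSpace ℝ (Fin 3)).charpoly.map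
        (algebraMap ℝ ℂ)).IsRoot μ → ‖μ‖ = 1

end Forms

/-! ### Local models near the binding -/

/-- `μ = γ₁ γ₂' - γ₁' γ₂`. -/
def localMu (γ₁ γ₂ : ℝ → ℝ) (r : ℝ) : ℝ :=
  γ₁ r * derivWithin γ₂ (Ici 0) r - derivWithin γ₁ (Ici 0) r * γ₂ r

/-- `A = (γ₂'' γ₁' - γ₁'' γ₂') / μ²`. -/
def localA (γ₁ γ₂ : ℝ → ℝ) (r : ℝ) : ℝ :=
  (iteratedDerivWithin 2 γ₂ (Ici 0) r * derivWithin γ₁ (Ici 0) r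
    - iteratedDerivWithin 2 γ₁ (Ici 0) r * derivWithin γ₂ (Ici 0) r) / localMu γ₁ γ₂ r ^ 2

/-- The 1-form `γ₁(r) dθ + γ₂(r) dφ` on `S¹ × D` is a local model near the binding. Functions on
`[0, ∞)` are represented by functions on `ℝ` whose values at negative arguments play no role;
`D` is the open unit disk of `ℂ`. -/
structure IsLocalModel (γ₁ γ₂ : ℝ → ℝ) : Prop where
  smooth₁ : ContDiffOn ℝ ∞ γ₁ (Ici 0)
  smooth₂ : ContDiffOn ℝ ∞ γ₂ (Ici 0)
  disk₁ : ContDiffOn ℝ ∞ (fun z : ℂ => γ₁ ‖z‖) (Metric.ball 0 1)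
  disk₂ : ContDiffOn ℝ ∞ (fun z : ℂ => γ₂ ‖z‖) (Metric.ball 0 1)
  quotient : ∃ g : ℂ → ℝ, ContDiffOn ℝ ∞ g (Metric.ball 0 1) ∧
    ∀ z ∈ Metric.ball (0 : ℂ) 1, γ₂ ‖z‖ = ‖z‖ ^ 2 * g z
  mu_pos : ∀ r ∈ Ioo (0 : ℝ) 1, 0 < localMu γ₁ γ₂ r
  zero_pos : 0 < γ₁ 0
  deriv_neg : ∀ r ∈ Ioo (0 : ℝ) 1, derivWithin γ₁ (Ici 0) r < 0
  mu_tendsto : Tendsto (fun r => localMu γ₁ γ₂ r / r) (𝓝[>] 0)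
    (𝓝 (γ₁ 0 * iteratedDerivWithin 2 γ₂ (Ici 0) 0))
  second_pos : 0 < γ₁ 0 * iteratedDerivWithin 2 γ₂ (Ici 0) 0
  kappa_not_int : ∀ n : ℤ,
    iteratedDerivWithin 2 γ₁ (Ici 0) 0 / iteratedDerivWithin 2 γ₂ (Ici 0) 0 ≠ n
  kappa_le : iteratedDerivWithin 2 γ₁ (Ici 0) 0 / iteratedDerivWithin 2 γ₂ (Ici 0) 0 ≤ -(1 / 2)
  order_A : localA γ₁ γ₂ =O[𝓝[>] 0] (fun r => r)

/-- The 1-form `γ₁(r) dθ + γ₂(r) dφ` in the coordinates `(θ, z) ∈ ℝ × ℂ`, where `z = r e^{iφ}`, so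
that `dφ(w) = Im (z̄ w) / r²`. -/
def localModelForm (γ₁ γ₂ : ℝ → ℝ) (x v : ℝ × ℂ) : ℝ :=
  γ₁ ‖x.2‖ * v.1 + γ₂ ‖x.2‖ / ‖x.2‖ ^ 2 * ((starRingEnd ℂ) x.2 * v.2).im

/-! ### Abstract open books -/

/-- An abstract open book on the compact surface with boundary `W`, with boundary components indexed
by `B`: an orientation of `W`, given by an area form `area`; an orientation preserving
diffeomorphism `monodromy` of `W`; and an identification of a collar of `∂W` with
`⨆_B S¹ × [0, width)` on which the monodromy is the identity. The coordinate `θ ∈ S¹ = ℝ/2πℤ` is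
written as a real number; `(θ, t)` is positively oriented, that is, `θ` runs along `∂W` in the
direction of the boundary orientation. -/
structure AbstractOpenBook (W : Type*) [TopologicalSpace W]
    [ChartedSpace (EuclideanHalfSpace 2) W] (B : Type*) where
  area : ∀ x : W, TangentSpace (𝓡∂ 2) x [⋀^Fin 2]→L[ℝ] ℝ
  area_smooth : ∀ x₀ : W, ContDiffOn ℝ ∞
    (fun y : EuclideanSpace ℝ (Fin 2) =>
      ((area ((extChartAt (𝓡∂ 2) x₀).symm y)).compContinuousLinearMap
        (mfderivWithin 𝓘(ℝ, EuclideanSpace ℝ (Fin 2)) (𝓡∂ 2) (extChartAt (𝓡∂ 2) x₀).symm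
          (range (𝓡∂ 2)) y) : EuclideanSpace ℝ (Fin 2) [⋀^Fin 2]→L[ℝ] ℝ))
    (extChartAt (𝓡∂ 2) x₀).target
  area_ne_zero : ∀ x, area x ≠ 0
  monodromy : W ≃ₘ^∞⟮𝓡∂ 2, 𝓡∂ 2⟯ W
  monodromy_oriented : ∀ (x : W) (a b : TangentSpace (𝓡∂ 2) x), 0 < area x ![a, b] →
    0 < area (monodromy x) ![mfderiv (𝓡∂ 2) (𝓡∂ 2) monodromy x a,
      mfderiv (𝓡∂ 2) (𝓡∂ 2) monodromy x b]
  width : ℝ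
  width_pos : 0 < width
  collar : B → ℝ × ℝ → W
  collar_smooth : ∀ i, ContMDiffOn 𝓘(ℝ, ℝ × ℝ) (𝓡∂ 2) ∞ (collar i) (univ ×ˢ Ico 0 width)
  collar_oriented : ∀ i, ∀ x ∈ (univ ×ˢ Ico 0 width : Set (ℝ × ℝ)), 0 < area (collar i x)
    ![mfderivWithin 𝓘(ℝ, ℝ × ℝ) (𝓡∂ 2) (collar i) (univ ×ˢ Ico 0 width) x ((1, 0) : ℝ × ℝ),
      mfderivWithin 𝓘(ℝ, ℝ × ℝ) (𝓡∂ 2) (collar i) (univ ×ˢ Ico 0 width) x ((0, 1) : ℝ × ℝ)]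
  collar_periodic : ∀ i θ, ∀ t ∈ Ico 0 width,
    collar i (θ + 2 * Real.pi, t) = collar i (θ, t)
  collar_injective : ∀ i j θ θ', ∀ t ∈ Ico 0 width, ∀ t' ∈ Ico 0 width,
    collar i (θ, t) = collar j (θ', t') →
      i = j ∧ t = t' ∧ ∃ k : ℤ, θ' = θ + k * (2 * Real.pi)
  collar_boundary : {x | ∃ i θ, collar i (θ, 0) = x} = (𝓡∂ 2).boundary W
  collar_open : ∀ i, IsOpen (collar i '' (univ ×ˢ Ico 0 width))
  monodromy_collar : ∀ i θ, ∀ t ∈ Ico 0 width, monodromy (collar i (θ, t)) = collar i (θ, t)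
  component_meets_boundary : ∀ x : W, (connectedComponent x ∩ (𝓡∂ 2).boundary W).Nonempty

/-- An identification of the 3-manifold `M` with `W(h) ∪ (∂W × D²)`, where `W(h)` is the mapping
torus, that is the quotient of `W × ℝ` by `(x, τ) ∼ (h x, τ + 2π)`. The map `fiber : W × ℝ → M` is
the immersion inducing the embedding of `W(h)`. For each boundary component `i`, `nbhd i (θ, z)` is
the embedding of `S¹ × D²` (with `θ` again written as a real number), defined on the slightly larger
disk of radius `1 + width`, where it overlaps with the collar of `W(h)` through
`(θ, (1 + t) e^{iτ}) ↔ ((θ, t), τ)`. As a set, `M` is the disjoint union of `W(h)` and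
`∂W × {|z| < 1}`; its topology and its smooth structure are the ones for which the two maps are
local diffeomorphisms (up to the boundary of `W(h)`). -/
structure OpenBookManifold {W : Type*} [TopologicalSpace W]
    [ChartedSpace (EuclideanHalfSpace 2) W] {B : Type*} (O : AbstractOpenBook W B)
    (M : Type*) [TopologicalSpace M] [ChartedSpace (EuclideanSpace ℝ (Fin 3)) M] where
  fiber : W × ℝ → M
  fiber_smooth : ContMDiff ((𝓡∂ 2).prod 𝓘(ℝ, ℝ)) (𝓡 3) ∞ fiber
  fiber_immersion : ∀ x, Function.Injective (mfderiv ((𝓡∂ 2).prod 𝓘(ℝ, ℝ)) (𝓡 3) fiber x)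
  fiber_monodromy : ∀ x τ, fiber (O.monodromy x, τ + 2 * Real.pi) = fiber (x, τ)
  fiber_injective : InjOn fiber (univ ×ˢ Ico 0 (2 * Real.pi))
  nbhd : B → ℝ × ℂ → M
  nbhd_smooth : ∀ i, ContMDiffOn 𝓘(ℝ, ℝ × ℂ) (𝓡 3) ∞ (nbhd i)
    (univ ×ˢ Metric.ball 0 (1 + O.width))
  nbhd_immersion : ∀ i, ∀ x ∈ (univ ×ˢ Metric.ball 0 (1 + O.width) : Set (ℝ × ℂ)),
    Function.Injective (mfderiv 𝓘(ℝ, ℝ × ℂ) (𝓡 3) (nbhd i) x)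
  nbhd_periodic : ∀ i θ, ∀ z ∈ Metric.ball (0 : ℂ) (1 + O.width),
    nbhd i (θ + 2 * Real.pi, z) = nbhd i (θ, z)
  nbhd_injective : ∀ i j θ θ', ∀ z ∈ Metric.ball (0 : ℂ) 1, ∀ z' ∈ Metric.ball (0 : ℂ) 1,
    nbhd i (θ, z) = nbhd j (θ', z') →
      i = j ∧ z = z' ∧ ∃ k : ℤ, θ' = θ + k * (2 * Real.pi)
  glue : ∀ (i : B) (θ τ : ℝ), ∀ t ∈ Ico 0 O.width,
    nbhd i (θ, ((1 + t : ℝ) : ℂ) * Complex.exp (τ * Complex.I)) = fiber (O.collar i (θ, t), τ)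
  nbhd_ne_fiber : ∀ i θ, ∀ z ∈ Metric.ball (0 : ℂ) 1, ∀ x, nbhd i (θ, z) ≠ fiber x
  cover : ∀ p : M, (∃ x, fiber x = p) ∨ ∃ i θ, ∃ z ∈ Metric.ball (0 : ℂ) 1, nbhd i (θ, z) = p

namespace OpenBookManifold

variable {W : Type*} [TopologicalSpace W] [ChartedSpace (EuclideanHalfSpace 2) W] {B : Type*}
  {O : AbstractOpenBook W B} {M : Type*} [TopologicalSpace M]
  [ChartedSpace (EuclideanSpace ℝ (Fin 3)) M]

/-- The component `S¹ × {0}` of the binding. -/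
def bindingComponent (P : OpenBookManifold O M) (i : B) : Set M :=
  {p | ∃ θ : ℝ, P.nbhd i (θ, 0) = p}

/-- The tubular neighbourhood `∂W × {|z| < ρ}` of the binding. -/
def tube (P : OpenBookManifold O M) (ρ : ℝ) : Set M :=
  {p | ∃ i θ, ∃ z : ℂ, ‖z‖ < ρ ∧ P.nbhd i (θ, z) = p}

/-- `P.PageFrame p u v`: the point `p` lies on a page
`F_α = (W × {α}) ∪ (∂W × {r e^{iα} | 0 < r < 1})`, and `(u, v)` is a basis of the tangent space of
that page at `p`. In `W × {α}` all bases coming from positively oriented bases of `W` are allowed;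
in `∂W × D²` the basis is `(∂/∂θ, r ∂/∂r)`. -/
inductive PageFrame (P : OpenBookManifold O M) :
    ∀ p : M, TangentSpace (𝓡 3) p → TangentSpace (𝓡 3) p → Prop
  | fiber (x : W) (α : ℝ) (a b : TangentSpace (𝓡∂ 2) x) (hab : 0 < O.area x ![a, b]) :
      PageFrame P (P.fiber (x, α))
        (mfderiv ((𝓡∂ 2).prod 𝓘(ℝ, ℝ)) (𝓡 3) P.fiber (x, α)
          ((a, 0) : EuclideanSpace ℝ (Fin 2) × ℝ))
        (mfderiv ((𝓡∂ 2).prod 𝓘(ℝ, ℝ)) (𝓡 3) P.fiber (x, α)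
          ((b, 0) : EuclideanSpace ℝ (Fin 2) × ℝ))
  | disk (i : B) (θ : ℝ) (z : ℂ) (hz : 0 < ‖z‖) (hz1 : ‖z‖ < 1) :
      PageFrame P (P.nbhd i (θ, z))
        (mfderiv 𝓘(ℝ, ℝ × ℂ) (𝓡 3) (P.nbhd i) (θ, z) ((1, 0) : ℝ × ℂ))
        (mfderiv 𝓘(ℝ, ℝ × ℂ) (𝓡 3) (P.nbhd i) (θ, z) ((0, z) : ℝ × ℂ))

/-- Positively oriented bases of `T_pM`, for the orientation of `M` that is the product of the
orientation of `W` and `dτ` on `W(h)`, and is given by `dθ ∧ dx ∧ dy` on `∂W × D²`. -/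
inductive PositiveFrame (P : OpenBookManifold O M) :
    ∀ p : M, TangentSpace (𝓡 3) p → TangentSpace (𝓡 3) p → TangentSpace (𝓡 3) p → Prop
  | fiber (x : W) (α : ℝ) (a b : TangentSpace (𝓡∂ 2) x) (hab : 0 < O.area x ![a, b]) :
      PositiveFrame P (P.fiber (x, α))
        (mfderiv ((𝓡∂ 2).prod 𝓘(ℝ, ℝ)) (𝓡 3) P.fiber (x, α)
          ((a, 0) : EuclideanSpace ℝ (Fin 2) × ℝ))
        (mfderiv ((𝓡∂ 2).prod 𝓘(ℝ, ℝ)) (𝓡 3) P.fiber (x, α)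
          ((b, 0) : EuclideanSpace ℝ (Fin 2) × ℝ))
        (mfderiv ((𝓡∂ 2).prod 𝓘(ℝ, ℝ)) (𝓡 3) P.fiber (x, α)
          ((0, 1) : EuclideanSpace ℝ (Fin 2) × ℝ))
  | disk (i : B) (θ : ℝ) (z : ℂ) (hz : ‖z‖ < 1) :
      PositiveFrame P (P.nbhd i (θ, z))
        (mfderiv 𝓘(ℝ, ℝ × ℂ) (𝓡 3) (P.nbhd i) (θ, z) ((1, 0) : ℝ × ℂ))
        (mfderiv 𝓘(ℝ, ℝ × ℂ) (𝓡 3) (P.nbhd i) (θ, z) ((0, 1) : ℝ × ℂ))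
        (mfderiv 𝓘(ℝ, ℝ × ℂ) (𝓡 3) (P.nbhd i) (θ, z) ((0, Complex.I) : ℝ × ℂ))

/-- A confoliation 1-form: smooth, nowhere vanishing, and `λ ∧ dλ ≥ 0`. -/
def IsConfoliationForm (P : OpenBookManifold O M) (lam : OneForm M) : Prop :=
  IsSmoothForm lam ∧ (∀ p, lam p ≠ 0) ∧
    ∀ p u v w, P.PositiveFrame p u v w → 0 ≤ wedgeForm lam p u v w

/-- A vector field is transverse to the pages. -/
def TransverseToPages (P : OpenBookManifold O M) (X : ∀ p : M, TangentSpace (𝓡 3) p) : Prop :=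
  ∀ p u v, P.PageFrame p u v → X p ∉ Submodule.span ℝ {u, v}

/-- `lam` is a Giroux contact form for the open book: `d lam` is an area form on each page, the
binding consists of closed Reeb orbits, and `lam` orients the binding as the boundary of the pages
oriented by `d lam`. In the last clause `-r ∂/∂r` is the direction in the page pointing outwards,
to the binding, so the sign of `d lam(-r ∂/∂r, ∂/∂θ)` says whether `∂/∂θ` gives the boundary
orientation. -/
def IsGirouxForm (P : OpenBookManifold O M) (lam : OneForm M) : Prop :=
  IsContactForm lam ∧
  (∀ p u v, P.PageFrame p u v → dForm lam p u v ≠ 0) ∧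
  (∃ X, IsReebOn lam X univ ∧ ∀ i, IsPeriodicOrbit X (P.bindingComponent i)) ∧
  ∀ i θ θ' z, 0 < ‖z‖ → ‖z‖ < 1 →
    0 < lam (P.nbhd i (θ, 0)) (mfderiv 𝓘(ℝ, ℝ × ℂ) (𝓡 3) (P.nbhd i) (θ, 0) ((1, 0) : ℝ × ℂ)) *
      dForm lam (P.nbhd i (θ', z))
        (mfderiv 𝓘(ℝ, ℝ × ℂ) (𝓡 3) (P.nbhd i) (θ', z) ((0, -z) : ℝ × ℂ))
        (mfderiv 𝓘(ℝ, ℝ × ℂ) (𝓡 3) (P.nbhd i) (θ', z) ((1, 0) : ℝ × ℂ))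

/-- The open book supports the contact structure `ker lam`. -/
def Supports (P : OpenBookManifold O M) (lam : OneForm M) : Prop :=
  ∃ lam' : OneForm M, P.IsGirouxForm lam' ∧ ∀ p v, lam' p v = 0 ↔ lam p v = 0

end OpenBookManifold

end

/-! Near the binding everything is radial. A form `Γ dθ + Q Im(z̄ dz)`, that is `Γ dθ + Q r² dφ`,
has `dλ(∂θ, r∂r) = -rΓ'` on the pages, and `λ ∧ dλ` has density `(Γ (Qr²)' - Γ' Qr²) / r`.
Positivity on the pages and the contact condition thus reduce to monotonicity of `Γ` and `Qr²`. On a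
small disk `γ₁ > 0` decreases, while `γ₂` increases away from the centre and stays below `1`. With a
decreasing cutoff `χ`, equal to `1` for `r ≤ a` and `0` for `r ≥ c`, put `Γ = χγ₁` and `Qr² = χγ₂ +
(1 - χ)`. This joins the local model to the closed form `dφ`, which defines the pages on the rest of
`M`; the result is the confoliation form `λ₀` (`exists_baseForm`, `ModelBall.wedge_interpolation`).

The deformation is affine, `λ₀ + sβ` with `s = δε`. In a tube around the binding `β = (1 - χ)γ₁ dθ`,
so that `χγ₁` is replaced by `(χ + s(1 - χ))γ₁`, strictly decreasing for `0 < s ≤ 1`. Outside the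
tube `dβ` is positive on the pages. There `λ₀` is closed with kernel the pages, hence `(λ₀ + sβ) ∧
d(λ₀ + sβ) = s (λ₀ ∧ dβ + s β ∧ dβ)`, and by compactness this is nonzero for all small `s > 0`
(`PagePos.eventually_contact`).

The global input is a form whose differential is positive on all pages. It is built directly on `M`,
without integrating area forms and without comparing a primitive with its pullback by the monodromy.
Near `∂W` a decreasing multiple of `dθ` works. Positivity is then carried along a segment in a chart
of a page (`TubeAdapted.move`): add a form supported in a box whose differential is negative only
where the old one is already positive, and a large multiple of the old form. As every component of
`W` meets `∂W`, a clopen argument reaches every point of a page (`exists_tubeAdapted_fiber`). Sums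
of such forms keep the sign, so compactness finishes (`exists_tubeAdapted_pagePos`).

For `s > 0` the differential of `λ₀ + sβ` is positive on every page, so this form is its own Giroux
form. The Reeb vector annihilates the differential, so it cannot be tangent to a page
(`not_mem_span_of_reeb`). For `r < a` the form is the local model for every `s`. Its Reeb flow is an
explicit rotation of each circle `|z| = r` combined with a translation in `θ`; over the period
`2πγ₁(0)` of the binding the linearized rotation is by `-2πκ`, which is not a full turn because `κ`
is not an integer (`ReebModel.hasFDerivAt_reebFlow`).

Two tools link coordinates with `M`: `dForm_mfderiv` computes `dλ` in any smooth parametrization,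
and `exists_form_of_pullForm` glues forms given in parametrizations. -/

noncomputable section

set_option linter.unusedSectionVars false

/-! ### Pullbacks of 1-forms and the naturality of the exterior derivative -/

section Pullback

variable {M : Type*} [TopologicalSpace M] [ChartedSpace (EuclideanSpace ℝ (Fin 3)) M]
  {X : Type*} [NormedAddCommGroup X] [NormedSpace ℝ X]
  {Y : Type*} [NormedAddCommGroup Y] [NormedSpace ℝ Y]

/-- The pullback of a 1-form by a map from a normed space. -/
def pullForm (lam : OneForm M) (Ψ : X → M) (x : X) : X →L[ℝ] ℝ :=
  (lam (Ψ x)).comp (mfderiv 𝓘(ℝ, X) (𝓡 3) Ψ x)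

/-- The exterior derivative of a 1-form on a normed space. -/
def dAt (ζ : X → X →L[ℝ] ℝ) (x u v : X) : ℝ := fderiv ℝ ζ x u v - fderiv ℝ ζ x v u

theorem pullForm_apply (lam : OneForm M) (Ψ : X → M) (x v : X) :
    pullForm lam Ψ x v = lam (Ψ x) (mfderiv 𝓘(ℝ, X) (𝓡 3) Ψ x v) := rfl

theorem localForm_eq_pullForm (lam : OneForm M) (p : M) :
    localForm lam p = pullForm lam (extChartAt (𝓡 3) p).symm := rfl

/-- Identifying linear forms with alternating maps in one variable is a linear isometry and commutes
with the derivative; alternating over two slots leaves two terms. -/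
theorem dForm_eq_dAt (lam : OneForm M) (p : M) (u v : TangentSpace (𝓡 3) p) :
    dForm lam p u v = dAt (localForm lam p) (extChartAt (𝓡 3) p p) u v := by
  have h2 : fderiv ℝ (fun y => ContinuousAlternatingMap.ofSubsingleton ℝ
      (EuclideanSpace ℝ (Fin 3)) ℝ (0 : Fin 1) (localForm lam p y)) (extChartAt (𝓡 3) p p) =
      _ := (ContinuousAlternatingMap.ofSubsingletonLIE (𝕜 := ℝ)
        (E := EuclideanSpace ℝ (Fin 3)) (F := ℝ) (i := (0 : Fin 1))).comp_fderiv (f := localForm lam p) (x := extChartAt (𝓡 3) p p)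
  unfold dForm extDeriv dAt
  rw [h2]
  rw [ContinuousAlternatingMap.alternatizeUncurryFin_apply]
  simp [Fin.sum_univ_two]
  rfl

theorem pullForm_congr (lam : OneForm M) {Φ Ψ : X → M} {x : X} (h : Φ =ᶠ[𝓝 x] Ψ) :
    pullForm lam Φ x = pullForm lam Ψ x := by
  have h0 := h.eq_of_nhds
  have h1 := h.mfderiv_eq (I := 𝓘(ℝ, X)) (I' := 𝓡 3)
  let lam' : M → EuclideanSpace ℝ (Fin 3) →L[ℝ] ℝ := lam
  change (lam' (Φ x)).comp _ = (lam' (Ψ x)).comp _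
  rw [h0]
  exact congrArg _ h1

theorem pullForm_comp (lam : OneForm M) {Ψ : X → M} {σ : Y → X} {y : Y}
    (hΨ : MDifferentiableAt 𝓘(ℝ, X) (𝓡 3) Ψ (σ y)) (hσ : DifferentiableAt ℝ σ y) :
    pullForm lam (Ψ ∘ σ) y = (pullForm lam Ψ (σ y)).comp (fderiv ℝ σ y) := by
  ext v
  have := mfderiv_comp y hΨ hσ.mdifferentiableAt
  simp only [pullForm_apply, ContinuousLinearMap.comp_apply]
  rw [this, mfderiv_eq_fderiv]
  rfl

theorem dAt_congr {ζ ζ' : X → X →L[ℝ] ℝ} {x : X} (h : ζ =ᶠ[𝓝 x] ζ') (u v : X) :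
    dAt ζ x u v = dAt ζ' x u v := by
  unfold dAt; rw [h.fderiv_eq]

/-- Naturality of `d`: the terms containing the second derivative of `σ` cancel by its symmetry. -/
theorem dAt_pullback {ζ : X → X →L[ℝ] ℝ} {σ : Y → X} {y : Y}
    (hζ : DifferentiableAt ℝ ζ (σ y)) (hσ : ContDiffAt ℝ 2 σ y) (u v : Y) :
    dAt (fun y => (ζ (σ y)).comp (fderiv ℝ σ y)) y u v =
      dAt ζ (σ y) (fderiv ℝ σ y u) (fderiv ℝ σ y v) := by
  have h1 : DifferentiableAt ℝ σ y := hσ.differentiableAt (by norm_num)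
  have h2 : DifferentiableAt ℝ (fderiv ℝ σ) y :=
    (hσ.fderiv_right (m := 1) (by norm_num)).differentiableAt (by norm_num)
  have h3 := (hζ.hasFDerivAt.comp y h1.hasFDerivAt).clm_comp h2.hasFDerivAt
  have h4 : IsSymmSndFDerivAt ℝ σ y := hσ.isSymmSndFDerivAt (by simp)
  have h5 := h4 u v
  unfold dAt
  erw [h3.fderiv]
  simp [h5]

variable [IsManifold (𝓡 3) ∞ M]

theorem contMDiffAt_chart_symm (p : M) {y : EuclideanSpace ℝ (Fin 3)}
    (hy : y ∈ (extChartAt (𝓡 3) p).target) :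
    ContMDiffAt 𝓘(ℝ, EuclideanSpace ℝ (Fin 3)) (𝓡 3) ∞ (extChartAt (𝓡 3) p).symm y :=
  (contMDiffOn_extChartAt_symm p).contMDiffAt ((isOpen_extChartAt_target p).mem_nhds hy)

theorem contDiffAt_chart_comp {Ψ : X → M} {x : X} {n : ℕ∞ω} (hn : n ≤ ∞)
    (hΨ : ContMDiffAt 𝓘(ℝ, X) (𝓡 3) n Ψ x)
    {p : M} (hp : Ψ x ∈ (extChartAt (𝓡 3) p).source) :
    ContDiffAt ℝ n (extChartAt (𝓡 3) p ∘ Ψ) x := by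
  rw [← contMDiffAt_iff_contDiffAt]
  refine ContMDiffAt.comp x ((contMDiffAt_extChartAt' ?_).of_le hn) hΨ
  simpa using hp

/-- Factoring `Ψ` through a chart turns the pullback from `M` into a pullback between normed spaces,
to which `dAt_pullback` applies. The equality holds near `x`, so it may be differentiated. -/
theorem pullForm_eventuallyEq (lam : OneForm M) {Ψ : X → M} {x : X}
    (hΨ : ContMDiffAt 𝓘(ℝ, X) (𝓡 3) 1 Ψ x) {p : M} (hp : Ψ x ∈ (extChartAt (𝓡 3) p).source) :
    pullForm lam Ψ =ᶠ[𝓝 x] fun y => (localForm lam p (extChartAt (𝓡 3) p (Ψ y))).comp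
      (fderiv ℝ (extChartAt (𝓡 3) p ∘ Ψ) y) := by
  have h1 : ∀ᶠ y in 𝓝 x, Ψ y ∈ (extChartAt (𝓡 3) p).source :=
    hΨ.continuousAt.eventually_mem ((isOpen_extChartAt_source p).mem_nhds hp)
  have h2 : ∀ᶠ y in 𝓝 x, ContMDiffAt 𝓘(ℝ, X) (𝓡 3) 1 Ψ y := (contMDiffAt_iff_contMDiffAt_nhds (by simp)).1 hΨ
  filter_upwards [h1.eventually_nhds, h2] with y hy hy2
  have h3 : Ψ =ᶠ[𝓝 y] (extChartAt (𝓡 3) p).symm ∘ (extChartAt (𝓡 3) p ∘ Ψ) := by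
    filter_upwards [hy] with z hz
    exact ((extChartAt (𝓡 3) p).left_inv hz).symm
  rw [pullForm_congr lam h3, pullForm_comp]
  · rfl
  · exact (contMDiffAt_chart_symm p ((extChartAt (𝓡 3) p).map_source hy.self_of_nhds)
      ).mdifferentiableAt (by simp)
  · exact (contDiffAt_chart_comp (by exact_mod_cast le_top) hy2 hy.self_of_nhds
      ).differentiableAt (by simp)

theorem IsSmoothForm.contDiffAt_localForm {lam : OneForm M} (h : IsSmoothForm lam) (p : M)
    {y : EuclideanSpace ℝ (Fin 3)} (hy : y ∈ (extChartAt (𝓡 3) p).target) :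
    ContDiffAt ℝ ∞ (localForm lam p) y :=
  (h p).contDiffAt ((isOpen_extChartAt_target p).mem_nhds hy)

theorem IsSmoothForm.contDiffAt_pullForm {lam : OneForm M} (h : IsSmoothForm lam) {Ψ : X → M}
    {x : X} (hΨ : ContMDiffAt 𝓘(ℝ, X) (𝓡 3) ∞ Ψ x) : ContDiffAt ℝ ∞ (pullForm lam Ψ) x := by
  have hp := mem_extChartAt_source (I := 𝓡 3) (Ψ x)
  refine ContDiffAt.congr_of_eventuallyEq ?_ (pullForm_eventuallyEq lam
    (hΨ.of_le (by exact_mod_cast le_top)) hp)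
  have h1 := contDiffAt_chart_comp le_rfl hΨ hp
  refine ContDiffAt.clm_comp ?_ (h1.fderiv_right (by simp))
  exact (h.contDiffAt_localForm (Ψ x) ((extChartAt (𝓡 3) _).map_source hp)).comp x h1

theorem fderiv_chart_comp {Ψ : X → M} {x : X} (hΨ : MDifferentiableAt 𝓘(ℝ, X) (𝓡 3) Ψ x) :
    fderiv ℝ (extChartAt (𝓡 3) (Ψ x) ∘ Ψ) x = mfderiv 𝓘(ℝ, X) (𝓡 3) Ψ x := by
  rw [hΨ.mfderiv]
  simp only [writtenInExtChartAt, extChartAt_model_space_eq_id]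
  simp [fderivWithin_univ]

/-- `dForm` lives in the chart centred at the point; this frees the computation of `dλ` from that
choice. The manifold derivative of `Ψ` at `x` is by definition the derivative read in this chart. -/
theorem dForm_mfderiv {lam : OneForm M} (h : IsSmoothForm lam) {Ψ : X → M} {x : X}
    (hΨ : ContMDiffAt 𝓘(ℝ, X) (𝓡 3) ∞ Ψ x) (u v : X) :
    dForm lam (Ψ x) (mfderiv 𝓘(ℝ, X) (𝓡 3) Ψ x u) (mfderiv 𝓘(ℝ, X) (𝓡 3) Ψ x v) =
      dAt (pullForm lam Ψ) x u v := by
  have hp := mem_extChartAt_source (I := 𝓡 3) (Ψ x)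
  have h0 := (h.contDiffAt_localForm (Ψ x)
    ((extChartAt (𝓡 3) _).map_source hp)).differentiableAt (by simp)
  rw [dForm_eq_dAt, dAt_congr (pullForm_eventuallyEq lam
    (hΨ.of_le (by exact_mod_cast le_top)) hp)]
  have h2 := dAt_pullback (ζ := localForm lam (Ψ x)) (σ := extChartAt (𝓡 3) (Ψ x) ∘ Ψ) (y := x) h0
    ((contDiffAt_chart_comp le_rfl hΨ hp).of_le ENat.LEInfty.out) u v
  rw [fderiv_chart_comp (hΨ.mdifferentiableAt (by simp))] at h2
  exact h2.symm

end Pullback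

/-! ### Parametrizations that are local diffeomorphisms -/

section LocalDiffeo

variable {M : Type*} [TopologicalSpace M] [ChartedSpace (EuclideanSpace ℝ (Fin 3)) M]
  [IsManifold (𝓡 3) ∞ M]
  {X : Type*} [NormedAddCommGroup X] [NormedSpace ℝ X] [FiniteDimensional ℝ X]

/-- `Ψ` is smooth and immersive at the point `x`. For maps between spaces of the same dimension
this makes `Ψ` a local diffeomorphism at `x`. -/
structure ImmersiveAt (Ψ : X → M) (x : X) : Prop where
  smooth : ContMDiffAt 𝓘(ℝ, X) (𝓡 3) ∞ Ψ x
  injective : Function.Injective (mfderiv 𝓘(ℝ, X) (𝓡 3) Ψ x)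

theorem ImmersiveAt.mdifferentiableAt {Ψ : X → M} {x : X} (h : ImmersiveAt Ψ x) :
    MDifferentiableAt 𝓘(ℝ, X) (𝓡 3) Ψ x := h.smooth.mdifferentiableAt (by simp)

theorem ImmersiveAt.surjective {Ψ : X → M} {x : X} (h : ImmersiveAt Ψ x)
    (hX : Module.finrank ℝ X = 3) :
    Function.Surjective (mfderiv 𝓘(ℝ, X) (𝓡 3) Ψ x) := by
  have h1 := h.injective
  let L : X →L[ℝ] EuclideanSpace ℝ (Fin 3) := mfderiv 𝓘(ℝ, X) (𝓡 3) Ψ x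
  have h2 : Function.Injective (L : X →ₗ[ℝ] EuclideanSpace ℝ (Fin 3)) := h1
  have h3 : Function.Surjective (L : X →ₗ[ℝ] EuclideanSpace ℝ (Fin 3)) :=
    (LinearMap.injective_iff_surjective_of_finrank_eq_finrank (by simp [hX])).1 h2
  exact h3

/-- Inverse function theorem, read in the chart at `Ψ x`. `σ` is a total function, but it is an
inverse only near the point. -/
theorem ImmersiveAt.exists_inverse {Ψ : X → M} {x : X} (h : ImmersiveAt Ψ x)
    (hX : Module.finrank ℝ X = 3) :
    ∃ σ : M → X, ContMDiffAt (𝓡 3) 𝓘(ℝ, X) ∞ σ (Ψ x) ∧ σ (Ψ x) = x ∧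
      (∀ᶠ p in 𝓝 (Ψ x), Ψ (σ p) = p) ∧ ∀ᶠ y in 𝓝 x, σ (Ψ y) = y := by
  have hp := mem_extChartAt_source (I := 𝓡 3) (Ψ x)
  have h1 := contDiffAt_chart_comp le_rfl h.smooth hp
  set f := extChartAt (𝓡 3) (Ψ x) ∘ Ψ with hf
  have hd : fderiv ℝ f x = mfderiv 𝓘(ℝ, X) (𝓡 3) Ψ x := fderiv_chart_comp h.mdifferentiableAt
  let L : X ≃L[ℝ] EuclideanSpace ℝ (Fin 3) := (LinearEquiv.ofBijective
    (fderiv ℝ f x : X →ₗ[ℝ] EuclideanSpace ℝ (Fin 3))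
    ⟨by rw [hd]; exact h.injective, by rw [hd]; exact h.surjective hX⟩).toContinuousLinearEquiv
  have hL : HasFDerivAt f (L : X →L[ℝ] EuclideanSpace ℝ (Fin 3)) x :=
    (h1.differentiableAt (by simp)).hasFDerivAt
  have hs := h1.hasStrictFDerivAt' hL (by simp)
  let e := hs.toOpenPartialHomeomorph f
  have he : (e : X → EuclideanSpace ℝ (Fin 3)) = f := rfl
  have hx : x ∈ e.source := hs.mem_toOpenPartialHomeomorph_source
  have hfx : f x ∈ e.target := hs.image_mem_toOpenPartialHomeomorph_target
  have hsm : ContDiffAt ℝ ∞ e.symm (f x) := h1.to_localInverse hL (by simp)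
  have hes : e.symm (f x) = x := e.left_inv hx
  refine ⟨fun p => e.symm (extChartAt (𝓡 3) (Ψ x) p), ?_, hes, ?_, ?_⟩
  · exact ContMDiffAt.comp (Ψ x) (hsm.contMDiffAt) contMDiffAt_extChartAt
  · have c1 : ContinuousAt (extChartAt (𝓡 3) (Ψ x)) (Ψ x) := continuousAt_extChartAt _
    have c2 : ContinuousAt (fun p => e.symm (extChartAt (𝓡 3) (Ψ x) p)) (Ψ x) :=
      ContinuousAt.comp (g := e.symm) hsm.continuousAt c1
    have c3 : ∀ᶠ p in 𝓝 (Ψ x), Ψ (e.symm (extChartAt (𝓡 3) (Ψ x) p)) ∈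
        (extChartAt (𝓡 3) (Ψ x)).source := by
      refine ContinuousAt.eventually_mem (ContinuousAt.comp (g := Ψ) ?_ c2)
        ((isOpen_extChartAt_source _).mem_nhds ?_)
      · show ContinuousAt Ψ (e.symm (f x))
        rw [hes]; exact h.smooth.continuousAt
      · show Ψ (e.symm (f x)) ∈ _
        rw [hes]; exact hp
    filter_upwards [c3, c1.eventually_mem (e.open_target.mem_nhds hfx),
      (isOpen_extChartAt_source (I := 𝓡 3) (Ψ x)).mem_nhds hp] with p h3 h4 h5
    have : f (e.symm (extChartAt (𝓡 3) (Ψ x) p)) = extChartAt (𝓡 3) (Ψ x) p := e.right_inv h4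
    exact (extChartAt (𝓡 3) (Ψ x)).injOn h3 h5 this
  · filter_upwards [e.open_source.mem_nhds hx] with y hy
    exact e.left_inv hy

theorem ImmersiveAt.map_nhds {Ψ : X → M} {x : X} (h : ImmersiveAt Ψ x)
    (hX : Module.finrank ℝ X = 3) : map Ψ (𝓝 x) = 𝓝 (Ψ x) := by
  obtain ⟨σ, h1, h2, h3, -⟩ := h.exists_inverse hX
  refine le_antisymm h.smooth.continuousAt ?_
  have h4 : Tendsto σ (𝓝 (Ψ x)) (𝓝 x) := by
    have := h1.continuousAt.tendsto
    rwa [h2] at this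
  intro s hs
  filter_upwards [h4 hs, h3] with p hp hp'
  rw [← hp']; exact hp

theorem ImmersiveAt.eventually {Ψ : X → M} {x : X} (h : ImmersiveAt Ψ x)
    (hX : Module.finrank ℝ X = 3) {q : M → Prop} :
    (∀ᶠ p in 𝓝 (Ψ x), q p) ↔ ∀ᶠ y in 𝓝 x, q (Ψ y) := by
  rw [← h.map_nhds hX]; rfl

theorem ImmersiveAt.contMDiffAt_of_comp {V : Type*} [NormedAddCommGroup V] [NormedSpace ℝ V]
    {Ψ : X → M} {x : X} (h : ImmersiveAt Ψ x) (hX : Module.finrank ℝ X = 3) {f : M → V}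
    (hf : ContDiffAt ℝ ∞ (f ∘ Ψ) x) : ContMDiffAt (𝓡 3) 𝓘(ℝ, V) ∞ f (Ψ x) := by
  obtain ⟨σ, h1, h2, h3, -⟩ := h.exists_inverse hX
  have h4 : f =ᶠ[𝓝 (Ψ x)] (f ∘ Ψ) ∘ σ := by
    filter_upwards [h3] with p hp
    simp [hp]
  refine ContMDiffAt.congr_of_eventuallyEq ?_ h4
  refine ContMDiffAt.comp (Ψ x) (ContDiffAt.contMDiffAt ?_) h1
  rwa [h2]

theorem ImmersiveAt.mdifferentiableAt_of_comp {Ψ : X → M} {x : X} (h : ImmersiveAt Ψ x)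
    (hX : Module.finrank ℝ X = 3) {f : M → M}
    (hf : MDifferentiableAt 𝓘(ℝ, X) (𝓡 3) (f ∘ Ψ) x) :
    MDifferentiableAt (𝓡 3) (𝓡 3) f (Ψ x) := by
  obtain ⟨σ, h1, h2, h3, -⟩ := h.exists_inverse hX
  have h4 : f =ᶠ[𝓝 (Ψ x)] (f ∘ Ψ) ∘ σ := by
    filter_upwards [h3] with p hp
    simp [hp]
  refine MDifferentiableAt.congr_of_eventuallyEq ?_ h4
  refine MDifferentiableAt.comp (Ψ x) (I' := 𝓘(ℝ, X)) ?_ (h1.mdifferentiableAt (by simp))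
  rwa [h2]

/-- Smoothness of a form may be tested in any immersive parametrization: the expression in a chart
is the pullback of `pullForm lam Ψ` by the transition map `S`. -/
theorem ImmersiveAt.contDiffAt_localForm {Ψ : X → M} {x : X} (h : ImmersiveAt Ψ x)
    (hX : Module.finrank ℝ X = 3) {lam : OneForm M} (hl : ContDiffAt ℝ ∞ (pullForm lam Ψ) x)
    {p : M} (hp : Ψ x ∈ (extChartAt (𝓡 3) p).source) :
    ContDiffAt ℝ ∞ (localForm lam p) (extChartAt (𝓡 3) p (Ψ x)) := by
  obtain ⟨σ, h1, h2, h3, -⟩ := h.exists_inverse hX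
  set y := extChartAt (𝓡 3) p (Ψ x) with hy
  have hyt : y ∈ (extChartAt (𝓡 3) p).target := (extChartAt (𝓡 3) p).map_source hp
  have hys : (extChartAt (𝓡 3) p).symm y = Ψ x := (extChartAt (𝓡 3) p).left_inv hp
  have hcs := contMDiffAt_chart_symm p hyt
  set S := σ ∘ (extChartAt (𝓡 3) p).symm with hS
  have hSs : ContDiffAt ℝ ∞ S y := by
    rw [← contMDiffAt_iff_contDiffAt]
    refine ContMDiffAt.comp y ?_ hcs
    rwa [hys]
  have hSy : S y = x := by rw [hS, Function.comp_apply, hys, h2]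
  have h5 : ∀ᶠ z in 𝓝 y, Ψ (S z) = (extChartAt (𝓡 3) p).symm z := by
    have := hcs.continuousAt.tendsto
    rw [hys] at this
    exact this.eventually h3
  have h6 : ∀ᶠ z in 𝓝 y, MDifferentiableAt 𝓘(ℝ, X) (𝓡 3) Ψ (S z) := by
    have := hSs.continuousAt.tendsto
    rw [hSy] at this
    exact this.eventually (((contMDiffAt_iff_contMDiffAt_nhds (by simp)).1
      (h.smooth.of_le (by exact_mod_cast le_top : (1 : ℕ∞ω) ≤ ∞))).mono
        fun z hz => hz.mdifferentiableAt (by simp))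
  have h7 : ∀ᶠ z in 𝓝 y, DifferentiableAt ℝ S z :=
    ((hSs.of_le (by exact_mod_cast le_top : (1 : ℕ∞ω) ≤ ∞)).eventually (by simp)).mono
      fun z hz => hz.differentiableAt (by simp)
  have h8 : localForm lam p =ᶠ[𝓝 y] fun z => (pullForm lam Ψ (S z)).comp (fderiv ℝ S z) := by
    filter_upwards [h5.eventually_nhds, h6, h7] with z hz5 hz6 hz7
    rw [localForm_eq_pullForm, ← pullForm_comp lam hz6 hz7]
    refine pullForm_congr lam ?_
    filter_upwards [hz5] with w hw using hw.symm
  refine ContDiffAt.congr_of_eventuallyEq ?_ h8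
  refine ContDiffAt.clm_comp ?_ (hSs.fderiv_right (by simp))
  refine ContDiffAt.comp (g := pullForm lam Ψ) y ?_ hSs
  rwa [hSy]

theorem isSmoothForm_of_forall {lam : OneForm M} (h : ∀ p : M, ∀ p₀ : M,
    p ∈ (extChartAt (𝓡 3) p₀).source →
      ContDiffAt ℝ ∞ (localForm lam p₀) (extChartAt (𝓡 3) p₀ p)) : IsSmoothForm lam := by
  intro p₀ y hy
  have := h _ p₀ ((extChartAt (𝓡 3) p₀).map_target hy)
  rw [(extChartAt (𝓡 3) p₀).right_inv hy] at this
  exact this.contDiffWithinAt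

theorem contDiffAt_localForm_of_eventually_zero {lam : OneForm M} {p p₀ : M}
    (h : ∀ᶠ q in 𝓝 p, lam q = 0) (hp : p ∈ (extChartAt (𝓡 3) p₀).source) :
    ContDiffAt ℝ ∞ (localForm lam p₀) (extChartAt (𝓡 3) p₀ p) := by
  have hcs := contMDiffAt_chart_symm p₀ ((extChartAt (𝓡 3) p₀).map_source hp)
  have h1 := hcs.continuousAt.tendsto
  rw [(extChartAt (𝓡 3) p₀).left_inv hp] at h1
  have h2 : localForm lam p₀ =ᶠ[𝓝 (extChartAt (𝓡 3) p₀ p)] fun _ => 0 := by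
    filter_upwards [h1.eventually h] with y hy
    ext v
    rw [localForm_eq_pullForm, pullForm_apply, hy]
    rfl
  exact contDiffAt_const.congr_of_eventuallyEq h2

end LocalDiffeo

/-! ### Linear algebra of contact forms in dimension 3 -/

section LinearAlgebra

variable {E : Type*} [AddCommGroup E] [Module ℝ E]

theorem exists_coords_of_linearIndependent (hE : Module.finrank ℝ E = 3) {u v w : E}
    (h : LinearIndependent ℝ ![u, v, w]) (x : E) : ∃ a b c : ℝ, x = a • u + b • v + c • w := by
  have hs := h.span_eq_top_of_card_eq_finrank (by simp [hE])
  have hx : x ∈ Submodule.span ℝ (range ![u, v, w]) := hs ▸ Submodule.mem_top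
  obtain ⟨c, hc⟩ := (Submodule.mem_span_range_iff_exists_fun ℝ).1 hx
  refine ⟨c 0, c 1, c 2, ?_⟩
  rw [← hc, Fin.sum_univ_three]
  rfl

/-- The 3-form `l ∧ d`, where `d(u, v) = B(u, v) - B(v, u)`. -/
def wedgeAlt (l : E →ₗ[ℝ] ℝ) (B : E →ₗ[ℝ] E →ₗ[ℝ] ℝ) (u v w : E) : ℝ :=
  l u * (B v w - B w v) - l v * (B u w - B w u) + l w * (B u v - B v u)

/-- A 3-form on a 3-dimensional space changes by a determinant, so nonvanishing on one frame gives
nonvanishing on every frame. -/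
theorem wedgeAlt_ne_zero (hE : Module.finrank ℝ E = 3) {l : E →ₗ[ℝ] ℝ} {B : E →ₗ[ℝ] E →ₗ[ℝ] ℝ}
    {e₁ e₂ e₃ u v w : E} (he : wedgeAlt l B e₁ e₂ e₃ ≠ 0) (h : LinearIndependent ℝ ![u, v, w]) :
    wedgeAlt l B u v w ≠ 0 := by
  intro h0
  apply he
  obtain ⟨a₁, b₁, c₁, h1⟩ := exists_coords_of_linearIndependent hE h e₁
  obtain ⟨a₂, b₂, c₂, h2⟩ := exists_coords_of_linearIndependent hE h e₂
  obtain ⟨a₃, b₃, c₃, h3⟩ := exists_coords_of_linearIndependent hE h e₃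
  have : wedgeAlt l B e₁ e₂ e₃ = (a₁ * (b₂ * c₃ - b₃ * c₂) - b₁ * (a₂ * c₃ - a₃ * c₂)
      + c₁ * (a₂ * b₃ - a₃ * b₂)) * wedgeAlt l B u v w := by
    subst h1 h2 h3
    simp only [wedgeAlt, map_add, map_smul, LinearMap.add_apply, LinearMap.smul_apply,
      smul_eq_mul]
    ring
  rw [this, h0, mul_zero]

/-- In dimension 3 the vector `d(v,w) u - d(u,w) v + d(u,v) w` lies in the kernel of the 2-form `d`,
and `l` takes the value `(l ∧ d)(u,v,w)` on it. -/
theorem exists_reeb_vector (hE : Module.finrank ℝ E = 3) {l : E →ₗ[ℝ] ℝ}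
    {B : E →ₗ[ℝ] E →ₗ[ℝ] ℝ} {u v w : E} (h : LinearIndependent ℝ ![u, v, w])
    (h0 : wedgeAlt l B u v w ≠ 0) : ∃ X : E, l X = 1 ∧ ∀ y, B X y - B y X = 0 := by
  refine ⟨(wedgeAlt l B u v w)⁻¹ • ((B v w - B w v) • u - (B u w - B w u) • v
    + (B u v - B v u) • w), ?_, ?_⟩
  · rw [map_smul, smul_eq_mul, inv_mul_eq_one₀ h0]
    simp only [wedgeAlt, map_add, map_sub, map_smul, smul_eq_mul]
    ring
  · intro y
    obtain ⟨a, b, c, rfl⟩ := exists_coords_of_linearIndependent hE h y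
    simp only [map_add, map_sub, map_smul, LinearMap.add_apply, LinearMap.sub_apply,
      LinearMap.smul_apply, smul_eq_mul]
    ring

theorem reeb_vector_unique (hE : Module.finrank ℝ E = 3) {l : E →ₗ[ℝ] ℝ}
    {B : E →ₗ[ℝ] E →ₗ[ℝ] ℝ} {u v w : E} (h : LinearIndependent ℝ ![u, v, w])
    (h0 : wedgeAlt l B u v w ≠ 0) {X X' : E} (hX : l X = 1) (hX' : l X' = 1)
    (hB : ∀ y, B X y - B y X = 0) (hB' : ∀ y, B X' y - B y X' = 0) : X = X' := by
  rw [← sub_eq_zero]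
  have hY : l (X - X') = 0 := by simp [hX, hX']
  have hd : ∀ y, B (X - X') y - B y (X - X') = 0 := by
    intro y
    have h1 := hB y
    have h2 := hB' y
    simp only [map_sub, LinearMap.sub_apply]
    linarith
  obtain ⟨a, b, c, hY2⟩ := exists_coords_of_linearIndependent hE h (X - X')
  have hu := hd u
  have hv := hd v
  have hw := hd w
  rw [hY2] at hY hu hv hw ⊢
  simp only [map_add, map_smul, LinearMap.add_apply, LinearMap.smul_apply, smul_eq_mul]
    at hY hu hv hw
  -- Cramer's rule: `l = 0` and `d(X - X', ·) = 0` form a homogeneous system for the coordinates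
  -- with determinant `l ∧ d`.
  have ha : a * wedgeAlt l B u v w = 0 := by
    unfold wedgeAlt
    linear_combination (B v w - B w v) * hY - l v * hw + l w * hv
  have hb : b * wedgeAlt l B u v w = 0 := by
    unfold wedgeAlt
    linear_combination -(B u w - B w u) * hY + l u * hw - l w * hu
  have hc : c * wedgeAlt l B u v w = 0 := by
    unfold wedgeAlt
    linear_combination (B u v - B v u) * hY - l u * hv + l v * hu
  simp only [mul_eq_zero, h0, or_false] at ha hb hc
  simp [ha, hb, hc]

end LinearAlgebra

/-! ### Contact forms, Reeb vectors and affine combinations of forms -/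

section FormAlgebra

variable {M : Type*} [TopologicalSpace M] [ChartedSpace (EuclideanSpace ℝ (Fin 3)) M]

/-- The bilinear form whose antisymmetrization is `dλ`. -/
def dBilin (lam : OneForm M) (p : M) :
    EuclideanSpace ℝ (Fin 3) →ₗ[ℝ] EuclideanSpace ℝ (Fin 3) →ₗ[ℝ] ℝ :=
  (ContinuousLinearMap.coeLM ℝ).comp
    (fderiv ℝ (localForm lam p) (extChartAt (𝓡 3) p p)).toLinearMap

/-- `λ_p` as a linear form. -/
def formLin (lam : OneForm M) (p : M) : EuclideanSpace ℝ (Fin 3) →ₗ[ℝ] ℝ :=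
  (lam p : EuclideanSpace ℝ (Fin 3) →L[ℝ] ℝ).toLinearMap

theorem dForm_eq_dBilin (lam : OneForm M) (p : M) (u v : EuclideanSpace ℝ (Fin 3)) :
    dForm lam p u v = dBilin lam p u v - dBilin lam p v u := dForm_eq_dAt lam p u v

theorem wedgeForm_eq_wedgeAlt (lam : OneForm M) (p : M) (u v w : EuclideanSpace ℝ (Fin 3)) :
    wedgeForm lam p u v w = wedgeAlt (formLin lam p) (dBilin lam p) u v w := by
  simp only [wedgeForm, wedgeAlt, dForm_eq_dBilin]
  rfl

theorem wedgeForm_ne_zero {lam : OneForm M} {p : M} {e₁ e₂ e₃ u v w : EuclideanSpace ℝ (Fin 3)}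
    (he : wedgeForm lam p e₁ e₂ e₃ ≠ 0) (h : LinearIndependent ℝ ![u, v, w]) :
    wedgeForm lam p u v w ≠ 0 := by
  rw [wedgeForm_eq_wedgeAlt] at he ⊢
  exact wedgeAlt_ne_zero (E := EuclideanSpace ℝ (Fin 3)) (by simp) he h

theorem exists_frame : ∃ u v w : EuclideanSpace ℝ (Fin 3), LinearIndependent ℝ ![u, v, w] := by
  have h := (EuclideanSpace.basisFun (Fin 3) ℝ).toBasis.linearIndependent
  refine ⟨EuclideanSpace.basisFun (Fin 3) ℝ 0, EuclideanSpace.basisFun (Fin 3) ℝ 1,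
    EuclideanSpace.basisFun (Fin 3) ℝ 2, ?_⟩
  have he : ![EuclideanSpace.basisFun (Fin 3) ℝ 0, EuclideanSpace.basisFun (Fin 3) ℝ 1,
    EuclideanSpace.basisFun (Fin 3) ℝ 2] = ⇑(EuclideanSpace.basisFun (Fin 3) ℝ).toBasis := by
    ext i
    fin_cases i <;> simp
  rw [he]
  exact h

/-- A pointwise choice, with value `0` off `U`. No smoothness of `X` is needed later, because the
orbits of interest are given by explicit formulas. -/
theorem IsContactOn.exists_reeb {lam : OneForm M} {U : Set M} (h : IsContactOn lam U) :
    ∃ X, IsReebOn lam X U := by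
  obtain ⟨u, v, w, hf⟩ := exists_frame
  have : ∀ p : M, ∃ X : EuclideanSpace ℝ (Fin 3), p ∈ U → formLin lam p X = 1 ∧
      ∀ y, dBilin lam p X y - dBilin lam p y X = 0 := by
    intro p
    by_cases hp : p ∈ U
    · have h1 := h p hp u v w hf
      rw [wedgeForm_eq_wedgeAlt] at h1
      obtain ⟨X, hX⟩ := exists_reeb_vector (by simp) hf h1
      exact ⟨X, fun _ => hX⟩
    · exact ⟨0, fun h => absurd h hp⟩
  choose X hX using this
  exact ⟨X, fun p hp => ⟨(hX p hp).1, fun y => by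
    exact (dForm_eq_dBilin lam p (X p) y).trans ((hX p hp).2 y)⟩⟩

theorem IsReebOn.unique {lam : OneForm M} {U : Set M} (h : IsContactOn lam U)
    {X : ∀ p : M, TangentSpace (𝓡 3) p} (hX : IsReebOn lam X U) {p : M} (hp : p ∈ U)
    {Y : TangentSpace (𝓡 3) p} (hY : lam p Y = 1) (hd : ∀ v, dForm lam p Y v = 0) : X p = Y := by
  obtain ⟨u, v, w, hf⟩ := exists_frame
  have h1 := h p hp u v w hf
  rw [wedgeForm_eq_wedgeAlt] at h1
  refine reeb_vector_unique (E := EuclideanSpace ℝ (Fin 3)) (by simp) hf h1 (hX p hp).1 hY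
    (fun y => ?_) fun y => ?_
  · exact (dForm_eq_dBilin lam p (X p) y).symm.trans ((hX p hp).2 y)
  · exact (dForm_eq_dBilin lam p Y y).symm.trans (hd y)

theorem dForm_combination (lam : OneForm M) (p : M) (u v : EuclideanSpace ℝ (Fin 3)) (a b c d : ℝ) :
    dForm lam p (a • u + b • v : EuclideanSpace ℝ (Fin 3)) (c • u + d • v) =
      (a * d - b * c) * dForm lam p u v := by
  rw [dForm_eq_dBilin, dForm_eq_dBilin]
  simp only [map_add, map_smul, LinearMap.add_apply, LinearMap.smul_apply, smul_eq_mul]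
  ring

theorem localForm_add_smul (lam β : OneForm M) (c : ℝ) (p : M) :
    localForm (lam + c • β) p = localForm lam p + c • localForm β p := by
  ext y
  rfl

theorem pullForm_add_smul {X : Type*} [NormedAddCommGroup X] [NormedSpace ℝ X]
    (lam β : OneForm M) (c : ℝ) (Ψ : X → M) :
    pullForm (lam + c • β) Ψ = pullForm lam Ψ + c • pullForm β Ψ := by
  ext y
  rfl

variable [IsManifold (𝓡 3) ∞ M]

theorem IsSmoothForm.add_smul {lam β : OneForm M} (h : IsSmoothForm lam) (h' : IsSmoothForm β)
    (c : ℝ) : IsSmoothForm (lam + c • β) := by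
  intro p
  rw [localForm_add_smul]
  exact (h p).add (contDiffOn_const.smul (h' p))

theorem dForm_add_smul {lam β : OneForm M} (h : IsSmoothForm lam) (h' : IsSmoothForm β)
    (c : ℝ) (p : M) (u v : TangentSpace (𝓡 3) p) :
    dForm (lam + c • β) p u v = dForm lam p u v + c * dForm β p u v := by
  have hp : extChartAt (𝓡 3) p p ∈ (extChartAt (𝓡 3) p).target := mem_extChartAt_target p
  have h1 := (h.contDiffAt_localForm p hp).differentiableAt (by simp)
  have h2 := (h'.contDiffAt_localForm p hp).differentiableAt (by simp)
  simp only [dForm_eq_dAt, localForm_add_smul, dAt]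
  rw [fderiv_add h1 (h2.const_smul c), fderiv_const_smul h2]
  have : ∀ (A B : EuclideanSpace ℝ (Fin 3) →L[ℝ] EuclideanSpace ℝ (Fin 3) →L[ℝ] ℝ) (u v),
      (A + c • B) u v - (A + c • B) v u = A u v - A v u + c * (B u v - B v u) := by
    intro A B u v
    simp only [add_apply, smul_apply, smul_eq_mul]
    ring
  exact this _ _ u v

theorem isSmoothForm_zero : IsSmoothForm (0 : OneForm M) := by
  intro p
  have : localForm (0 : OneForm M) p = fun _ => 0 := by
    ext y; rfl
  rw [this]
  exact contDiffOn_const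

theorem dForm_congr {lam lam' : OneForm M} {p : M} (h : ∀ᶠ q in 𝓝 p, lam q = lam' q)
    (u v : TangentSpace (𝓡 3) p) : dForm lam p u v = dForm lam' p u v := by
  rw [dForm_eq_dAt, dForm_eq_dAt]
  refine dAt_congr ?_ _ _
  have h1 := (contMDiffAt_chart_symm p (mem_extChartAt_target p)).continuousAt.tendsto
  rw [(extChartAt (𝓡 3) p).left_inv (mem_extChartAt_source p)] at h1
  filter_upwards [h1.eventually h] with y hy
  rw [localForm, localForm, hy]

theorem dForm_zero (p : M) (u v : TangentSpace (𝓡 3) p) : dForm (0 : OneForm M) p u v = 0 := by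
  have h := dForm_add_smul (lam := (0 : OneForm M)) (β := 0) isSmoothForm_zero isSmoothForm_zero 1
    p u v
  simp only [smul_zero, add_zero, one_mul] at h
  linarith

theorem IsSmoothForm.isSmoothFamily {lam β : OneForm M} (h : IsSmoothForm lam)
    (h' : IsSmoothForm β) (s : Set ℝ) : IsSmoothFamily (fun δ => lam + δ • β) s := by
  intro p
  simp only [localForm_add_smul, Pi.add_apply, Pi.smul_apply]
  refine ContDiffOn.add ?_ (ContDiffOn.smul contDiff_fst.contDiffOn ?_)
  · exact (h p).comp contDiff_snd.contDiffOn fun y hy => hy.2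
  · exact (h' p).comp contDiff_snd.contDiffOn fun y hy => hy.2

end FormAlgebra

/-! ### Pushing forward 1-forms by parametrizations -/

section Push

variable {M : Type*} [TopologicalSpace M] [ChartedSpace (EuclideanSpace ℝ (Fin 3)) M]
  [IsManifold (𝓡 3) ∞ M]
  {X : Type*} [NormedAddCommGroup X] [NormedSpace ℝ X] [FiniteDimensional ℝ X]

/-- Gluing with extension by zero. The compatibility condition compares values on equal tangent
vectors of `M`; it covers overlaps and also, for `i = j`, the noninjectivity of a periodic
parametrization. Closedness of the union of the sets `Ψ i '' C i` makes the zero extension smooth.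
-/
theorem exists_form_of_pullForm (hX : Module.finrank ℝ X = 3) {ι : Type*} {Ψ : ι → X → M}
    {U C : ι → Set X} {ζ : ι → X → X →L[ℝ] ℝ}
    (hU : ∀ i, IsOpen (U i)) (hΨ : ∀ i, ∀ x ∈ U i, ImmersiveAt (Ψ i) x)
    (hζ : ∀ i, ∀ x ∈ U i, ContDiffAt ℝ ∞ (ζ i) x)
    (hC : ∀ i, ∀ x ∈ U i, x ∉ C i → ζ i x = 0)
    (hT : IsClosed (⋃ i, Ψ i '' C i)) (hCU : ∀ i, C i ⊆ U i)
    (hcomp : ∀ i j, ∀ x ∈ U i, ∀ y ∈ U j, Ψ i x = Ψ j y → ∀ a b : X,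
      (mfderiv 𝓘(ℝ, X) (𝓡 3) (Ψ i) x a : EuclideanSpace ℝ (Fin 3)) =
        mfderiv 𝓘(ℝ, X) (𝓡 3) (Ψ j) y b → ζ i x a = ζ j y b) :
    ∃ lam : OneForm M, IsSmoothForm lam ∧ (∀ i, ∀ x ∈ U i, pullForm lam (Ψ i) x = ζ i x) ∧
      ∀ p, p ∉ ⋃ i, Ψ i '' C i → lam p = 0 := by
  have key : ∀ p : M, ∃ l : EuclideanSpace ℝ (Fin 3) →L[ℝ] ℝ,
      (∀ i, ∀ x ∈ U i, Ψ i x = p → ∀ a : X,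
        l (mfderiv 𝓘(ℝ, X) (𝓡 3) (Ψ i) x a : EuclideanSpace ℝ (Fin 3)) = ζ i x a) ∧
      (p ∉ ⋃ i, Ψ i '' C i → l = 0) := by
    intro p
    by_cases hp : ∃ i, ∃ x ∈ U i, Ψ i x = p
    · obtain ⟨i, x, hx, rfl⟩ := hp
      -- Any preimage `x` of `p` may be used to push `ζ i x` forward; `hcomp` makes the result
      -- independent of it.
      let D : X →L[ℝ] EuclideanSpace ℝ (Fin 3) := mfderiv 𝓘(ℝ, X) (𝓡 3) (Ψ i) x
      let L : X ≃L[ℝ] EuclideanSpace ℝ (Fin 3) := (LinearEquiv.ofBijective D.toLinearMap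
        ⟨(hΨ i x hx).injective, (hΨ i x hx).surjective hX⟩).toContinuousLinearEquiv
      have hL : ∀ a, L a = D a := fun a => rfl
      refine ⟨(ζ i x).comp (L.symm : EuclideanSpace ℝ (Fin 3) →L[ℝ] X), ?_, ?_⟩
      · intro j y hy hyx b
        refine hcomp i j x hx y hy hyx.symm _ b ?_
        exact L.apply_symm_apply _
      · intro hn
        have : ζ i x = 0 := by
          refine hC i x hx fun hxC => hn ?_
          exact mem_iUnion.2 ⟨i, x, hxC, rfl⟩
        rw [this]; rfl
    · refine ⟨0, fun i x hx hxp => absurd ⟨i, x, hx, hxp⟩ hp, fun _ => rfl⟩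
  choose lam h1 h2 using key
  have hpull : ∀ i, ∀ x ∈ U i, pullForm (M := M) lam (Ψ i) x = ζ i x := by
    intro i x hx
    ext a
    exact h1 _ i x hx rfl a
  refine ⟨lam, ?_, hpull, h2⟩
  refine isSmoothForm_of_forall fun p p₀ hp => ?_
  by_cases hpU : ∃ i, ∃ x ∈ U i, Ψ i x = p
  · obtain ⟨i, x, hx, rfl⟩ := hpU
    refine (hΨ i x hx).contDiffAt_localForm hX ?_ hp
    refine (hζ i x hx).congr_of_eventuallyEq ?_
    filter_upwards [(hU i).mem_nhds hx] with y hy using hpull i y hy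
  · refine contDiffAt_localForm_of_eventually_zero ?_ hp
    have : p ∉ ⋃ i, Ψ i '' C i := by
      intro hh
      obtain ⟨i, x, hx, rfl⟩ := mem_iUnion.1 hh
      exact hpU ⟨i, x, hCU i hx, rfl⟩
    filter_upwards [hT.isOpen_compl.mem_nhds this] with q hq using h2 q hq

end Push

/-! ### Geometry of the open book -/

section MfderivComp

variable {M : Type*} [TopologicalSpace M] [ChartedSpace (EuclideanSpace ℝ (Fin 3)) M]
  {X : Type*} [NormedAddCommGroup X] [NormedSpace ℝ X]
  {Y : Type*} [NormedAddCommGroup Y] [NormedSpace ℝ Y]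

theorem mfderiv_eq_comp_fderiv {Ψ : X → M} {Φ : Y → M} {σ : Y → X} {y : Y}
    (h : Φ =ᶠ[𝓝 y] Ψ ∘ σ) (hΨ : MDifferentiableAt 𝓘(ℝ, X) (𝓡 3) Ψ (σ y))
    (hσ : DifferentiableAt ℝ σ y) (v : Y) :
    (mfderiv 𝓘(ℝ, Y) (𝓡 3) Φ y v : EuclideanSpace ℝ (Fin 3)) =
      mfderiv 𝓘(ℝ, X) (𝓡 3) Ψ (σ y) (fderiv ℝ σ y v) := by
  have h1 := h.mfderiv_eq (I := 𝓘(ℝ, Y)) (I' := 𝓡 3)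
  have h2 := mfderiv_comp y hΨ hσ.mdifferentiableAt
  rw [mfderiv_eq_fderiv] at h2
  rw [h2] at h1
  exact congrArg (fun L : Y →L[ℝ] EuclideanSpace ℝ (Fin 3) => L v) h1

end MfderivComp

theorem finrank_real_prod_complex : Module.finrank ℝ (ℝ × ℂ) = 3 := by
  simp

/-! ### Area forms on the plane and oriented bases -/

section AreaForms

theorem area_combination {A : EuclideanSpace ℝ (Fin 2) [⋀^Fin 2]→L[ℝ] ℝ}
    (a b : EuclideanSpace ℝ (Fin 2)) (p q r s : ℝ) :
    A ![p • a + q • b, r • a + s • b] = (p * s - q * r) * A ![a, b] := by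
  have hupd : ∀ x y z : EuclideanSpace ℝ (Fin 2), Function.update ![x, z] 0 y = ![y, z] := by
    intro x y z
    funext i
    fin_cases i <;> rfl
  have hadd : ∀ x y z, A ![x + y, z] = A ![x, z] + A ![y, z] := by
    intro x y z
    have := A.map_update_add ![x, z] 0 x y
    simpa only [hupd, smul_eq_mul] using this
  have hsmul : ∀ (c : ℝ) (x z), A ![c • x, z] = c * A ![x, z] := by
    intro c x z
    have := A.map_update_smul ![x, z] 0 c x
    simpa only [hupd, smul_eq_mul] using this
  have hswap : ∀ x y, A ![x, y] = -A ![y, x] := by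
    intro x y
    have := A.toAlternatingMap.map_swap ![y, x] (i := 0) (j := 1) (by simp)
    rw [← ContinuousAlternatingMap.coe_toAlternatingMap, ← this]
    congr 1
    ext i
    fin_cases i <;> simp
  have hself : ∀ x, A ![x, x] = 0 := fun x => by linarith [hswap x x]
  rw [hadd, hsmul, hsmul, hswap a, hswap b, hadd, hadd, hsmul, hsmul, hsmul, hsmul, hself, hself,
    hswap b a]
  ring

theorem area_eq_det {A : EuclideanSpace ℝ (Fin 2) [⋀^Fin 2]→L[ℝ] ℝ}
    (a b : EuclideanSpace ℝ (Fin 2)) :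
    A ![a, b] = (a 0 * b 1 - a 1 * b 0) *
      A ![EuclideanSpace.single 0 1, EuclideanSpace.single 1 1] := by
  rw [← area_combination]
  congr 1
  ext i j
  fin_cases i <;> fin_cases j <;> simp

theorem exists_area_pos {A : EuclideanSpace ℝ (Fin 2) [⋀^Fin 2]→L[ℝ] ℝ} (hA : A ≠ 0) :
    ∃ a b, 0 < A ![a, b] := by
  have h : A ![EuclideanSpace.single 0 1, EuclideanSpace.single 1 1] ≠ 0 := by
    intro h
    apply hA
    ext v
    have : v = ![v 0, v 1] := by ext i j; fin_cases i <;> rfl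
    rw [this, area_eq_det, h]
    simp
  rcases lt_or_gt_of_ne h with h | h
  · refine ⟨EuclideanSpace.single 1 1, EuclideanSpace.single 0 1, ?_⟩
    rw [area_eq_det]
    simpa using h
  · exact ⟨_, _, h⟩

theorem exists_combination_of_area_pos {A : EuclideanSpace ℝ (Fin 2) [⋀^Fin 2]→L[ℝ] ℝ}
    {a b a' b' : EuclideanSpace ℝ (Fin 2)} (h : 0 < A ![a, b]) (h' : 0 < A ![a', b']) :
    ∃ p q r s : ℝ, 0 < p * s - q * r ∧ a' = p • a + q • b ∧ b' = r • a + s • b := by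
  have hd : a 0 * b 1 - a 1 * b 0 ≠ 0 := by
    intro h0
    rw [area_eq_det, h0, zero_mul] at h
    exact lt_irrefl _ h
  have key : ∀ c : EuclideanSpace ℝ (Fin 2), c =
      ((c 0 * b 1 - c 1 * b 0) / (a 0 * b 1 - a 1 * b 0)) • a +
        ((a 0 * c 1 - a 1 * c 0) / (a 0 * b 1 - a 1 * b 0)) • b := by
    intro c
    ext j
    fin_cases j <;> simp only [Fin.zero_eta, Fin.mk_one, PiLp.add_apply, PiLp.smul_apply,
      smul_eq_mul] <;> rw [div_mul_eq_mul_div, div_mul_eq_mul_div, ← add_div, eq_div_iff hd] <;> ring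
  refine ⟨_, _, _, _, ?_, key a', key b'⟩
  rw [key a', key b', area_combination] at h'
  exact (pos_iff_pos_of_mul_pos h').2 h

end AreaForms

/-! ### Identifications and overlaps of the parametrizations `fiber` and `nbhd` -/

namespace OpenBookManifold

variable {W : Type*} [TopologicalSpace W] [ChartedSpace (EuclideanHalfSpace 2) W]
  {B : Type*} {O : AbstractOpenBook W B} {M : Type*} [TopologicalSpace M]
  [ChartedSpace (EuclideanSpace ℝ (Fin 3)) M] [IsManifold (𝓡 3) ∞ M]

/-- The monodromy as a permutation. -/
def _root_.AbstractOpenBook.perm (O : AbstractOpenBook W B) : Equiv.Perm W := O.monodromy.toEquiv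

theorem fiber_zpow (P : OpenBookManifold O M) (k : ℤ) (x : W) (s : ℝ) :
    P.fiber ((O.perm ^ k) x, s + k * (2 * Real.pi)) = P.fiber (x, s) := by
  induction k using Int.induction_on with
  | zero => simp
  | succ n ih =>
    rw [← ih, ← P.fiber_monodromy ((O.perm ^ (n : ℤ)) x)]
    congr 2
    · rw [add_comm, zpow_add, zpow_one]; rfl
    · push_cast; ring
  | pred n ih =>
    rw [← ih, ← P.fiber_monodromy]
    congr 2
    · show O.perm _ = _
      rw [← Equiv.Perm.mul_apply, ← zpow_one_add]
      congr 2; ring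
    · push_cast; ring

/-- Both points are moved by powers of the deck transformation into the fundamental domain `0 ≤ τ <
2π`, where `fiber` is injective. -/
theorem fiber_eq (P : OpenBookManifold O M) {x y : W} {s t : ℝ}
    (h : P.fiber (x, s) = P.fiber (y, t)) :
    ∃ k : ℤ, t = s + k * (2 * Real.pi) ∧ y = (O.perm ^ k) x := by
  have hp := Real.two_pi_pos
  have key : ∀ (x : W) (s : ℝ), P.fiber (x, s) =
      P.fiber ((O.perm ^ (-toIcoDiv hp 0 s)) x, toIcoMod hp 0 s) := by
    intro x s
    rw [← P.fiber_zpow (-toIcoDiv hp 0 s) x s]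
    congr 2
    have := toIcoMod_add_toIcoDiv_zsmul hp 0 s
    rw [zsmul_eq_mul] at this
    push_cast
    linarith
  rw [key x s, key y t] at h
  have hm : ∀ s, toIcoMod hp 0 s ∈ Ico 0 (2 * Real.pi) := fun s => by
    simpa using toIcoMod_mem_Ico hp 0 s
  have h1 := P.fiber_injective ⟨mem_univ _, hm s⟩ ⟨mem_univ _, hm t⟩ h
  rw [Prod.mk.injEq] at h1
  have hs := toIcoMod_add_toIcoDiv_zsmul hp 0 s
  have ht := toIcoMod_add_toIcoDiv_zsmul hp 0 t
  rw [zsmul_eq_mul] at hs ht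
  refine ⟨toIcoDiv hp 0 t - toIcoDiv hp 0 s, ?_, ?_⟩
  · push_cast
    linarith [h1.2]
  · rw [sub_eq_add_neg, zpow_add, Equiv.Perm.mul_apply, h1.1, ← Equiv.Perm.mul_apply, ← zpow_add]
    simp

/-- A property invariant under the generator of the deck group depends only on the point of `M`;
this replaces explicit powers of the monodromy below. -/
theorem fiber_invariant (P : OpenBookManifold O M) {Q : W → ℝ → Prop}
    (hQ : ∀ x s, Q (O.monodromy x) (s + 2 * Real.pi) ↔ Q x s) {x y : W} {s t : ℝ}
    (h : P.fiber (x, s) = P.fiber (y, t)) : Q x s ↔ Q y t := by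
  obtain ⟨k, rfl, rfl⟩ := P.fiber_eq h
  clear h
  induction k using Int.induction_on with
  | zero => simp
  | succ n ih =>
    rw [ih, ← hQ]
    have h1 : O.monodromy ((O.perm ^ (n : ℤ)) x) = (O.perm ^ ((n : ℤ) + 1)) x := by
      rw [add_comm, zpow_add, zpow_one]; rfl
    rw [h1]
    push_cast
    ring_nf
  | pred n ih =>
    rw [ih, ← hQ _ (s + ((-(n : ℤ) - 1 : ℤ) : ℝ) * _)]
    have h1 : O.monodromy ((O.perm ^ (-(n : ℤ) - 1)) x) = (O.perm ^ (-(n : ℤ))) x := by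
      show O.perm _ = _
      rw [← Equiv.Perm.mul_apply, ← zpow_one_add]
      congr 2; ring
    rw [h1]
    push_cast
    ring_nf

theorem nbhd_eq_fiber (P : OpenBookManifold O M) (i : B) (θ : ℝ) {z : ℂ} (hz : 1 ≤ ‖z‖)
    (hz' : ‖z‖ < 1 + O.width) {s : ℝ} (hs : z = ‖z‖ * Complex.exp (s * Complex.I)) :
    P.nbhd i (θ, z) = P.fiber (O.collar i (θ, ‖z‖ - 1), s) := by
  rw [← P.glue i θ s (‖z‖ - 1) ⟨by linarith, by linarith⟩]
  congr 2
  rw [add_sub_cancel, ← hs]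

/-- On the collar the monodromy is the identity, so both the collar point and `e^{is}` are invariant
under the deck group, and one representation of the point decides. Points with `|z| < 1` are not in
the mapping torus. -/
theorem fiber_eq_nbhd (P : OpenBookManifold O M) {i : B} {θ s : ℝ} {z : ℂ} {x : W}
    (hz' : ‖z‖ < 1 + O.width) (h : P.fiber (x, s) = P.nbhd i (θ, z)) :
    1 ≤ ‖z‖ ∧ z = ‖z‖ * Complex.exp (s * Complex.I) ∧ x = O.collar i (θ, ‖z‖ - 1) := by
  have hz : 1 ≤ ‖z‖ := by
    by_contra! hlt
    exact P.nbhd_ne_fiber i θ z (by simpa using hlt) _ h.symm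
  refine ⟨hz, ?_⟩
  rw [P.nbhd_eq_fiber i θ hz hz' (Complex.norm_mul_exp_arg_mul_I z).symm] at h
  have ht : ‖z‖ - 1 ∈ Ico 0 O.width := ⟨by linarith, by linarith⟩
  refine (P.fiber_invariant (Q := fun x s => z = ‖z‖ * Complex.exp (s * Complex.I) ∧
    x = O.collar i (θ, ‖z‖ - 1)) ?_ h).2 ⟨(Complex.norm_mul_exp_arg_mul_I z).symm, rfl⟩
  intro y t
  have h1 : Complex.exp (((t + 2 * Real.pi : ℝ) : ℂ) * Complex.I) = Complex.exp (t * Complex.I) := by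
    rw [Complex.exp_eq_exp_iff_exists_int]
    exact ⟨1, by push_cast; ring⟩
  rw [h1]
  refine and_congr_right fun _ => ?_
  constructor
  · intro h2
    rw [← O.monodromy_collar i θ _ ht] at h2
    exact O.monodromy.injective h2
  · rintro rfl
    exact O.monodromy_collar i θ _ ht

/-- Injectivity is assumed only on the unit disk; over `1 ≤ |z| < 1 + width` it is inherited from
the injectivity of the collar. -/
theorem nbhd_eq_nbhd (P : OpenBookManifold O M) {i j : B} {θ θ' : ℝ} {z z' : ℂ}
    (hz : ‖z‖ < 1 + O.width) (hz' : ‖z'‖ < 1 + O.width)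
    (h : P.nbhd i (θ, z) = P.nbhd j (θ', z')) :
    i = j ∧ z = z' ∧ ∃ k : ℤ, θ' = θ + k * (2 * Real.pi) := by
  by_cases h1 : ‖z‖ < 1
  · by_cases h2 : ‖z'‖ < 1
    · exact P.nbhd_injective i j θ θ' z (by simpa using h1) z' (by simpa using h2) h
    · rw [P.nbhd_eq_fiber j θ' (not_lt.1 h2) hz' (Complex.norm_mul_exp_arg_mul_I z').symm] at h
      exact absurd h (P.nbhd_ne_fiber i θ z (by simpa using h1) _)
  · rw [P.nbhd_eq_fiber i θ (not_lt.1 h1) hz (Complex.norm_mul_exp_arg_mul_I z).symm] at h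
    obtain ⟨h2, h3, h4⟩ := P.fiber_eq_nbhd hz' h
    rw [not_lt] at h1
    obtain ⟨h5, h6, h7⟩ := O.collar_injective i j θ θ' _ ⟨by linarith, by linarith⟩ _
      ⟨by linarith, by linarith⟩ h4
    refine ⟨h5, ?_, h7⟩
    rw [← Complex.norm_mul_exp_arg_mul_I z, h3, show ‖z‖ = ‖z'‖ by linarith]

theorem nbhd_add_zmul (P : OpenBookManifold O M) (i : B) (k : ℤ) (θ : ℝ) {z : ℂ}
    (hz : ‖z‖ < 1 + O.width) : P.nbhd i (θ + k * (2 * Real.pi), z) = P.nbhd i (θ, z) := by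
  have hz2 : z ∈ Metric.ball (0 : ℂ) (1 + O.width) := by simpa using hz
  induction k using Int.induction_on with
  | zero => simp
  | succ n ih =>
    rw [← ih, ← P.nbhd_periodic i (θ + (n : ℤ) * (2 * Real.pi)) z hz2]
    congr 2; push_cast; ring
  | pred n ih =>
    rw [← ih, ← P.nbhd_periodic i _ z hz2]
    congr 2; push_cast; ring

theorem isOpen_tubeDomain (r : ℝ) : IsOpen {x : ℝ × ℂ | ‖x.2‖ < r} :=
  isOpen_lt (by fun_prop) continuous_const

theorem immersiveAt_nbhd (P : OpenBookManifold O M) (i : B) {x : ℝ × ℂ}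
    (hx : ‖x.2‖ < 1 + O.width) : ImmersiveAt (P.nbhd i) x := by
  have h1 : x ∈ (univ ×ˢ Metric.ball 0 (1 + O.width) : Set (ℝ × ℂ)) := by simpa using hx
  exact ⟨(P.nbhd_smooth i).contMDiffAt ((isOpen_univ.prod Metric.isOpen_ball).mem_nhds h1),
    P.nbhd_immersion i x h1⟩

theorem mfderiv_nbhd_add_zmul (P : OpenBookManifold O M) (i : B) (k : ℤ) (θ : ℝ) {z : ℂ}
    (hz : ‖z‖ < 1 + O.width) (v : ℝ × ℂ) :
    (mfderiv 𝓘(ℝ, ℝ × ℂ) (𝓡 3) (P.nbhd i) (θ + k * (2 * Real.pi), z) v :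
      EuclideanSpace ℝ (Fin 3)) = mfderiv 𝓘(ℝ, ℝ × ℂ) (𝓡 3) (P.nbhd i) (θ, z) v := by
  have h1 : P.nbhd i =ᶠ[𝓝 (θ, z)]
      P.nbhd i ∘ fun x : ℝ × ℂ => (x.1 + k * (2 * Real.pi), x.2) := by
    filter_upwards [(isOpen_tubeDomain (1 + O.width)).mem_nhds hz] with x hx
    exact (P.nbhd_add_zmul i k x.1 hx).symm
  have h3 : HasFDerivAt (fun x : ℝ × ℂ => (x.1 + k * (2 * Real.pi), x.2))
      ((ContinuousLinearMap.fst ℝ ℝ ℂ).prod (ContinuousLinearMap.snd ℝ ℝ ℂ)) (θ, z) :=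
    (hasFDerivAt_fst.add_const _).prodMk hasFDerivAt_snd
  have h2 := mfderiv_eq_comp_fderiv h1
    (P.immersiveAt_nbhd i (x := (_, z)) hz).mdifferentiableAt h3.differentiableAt v
  rw [h2, h3.fderiv]
  rfl

/-- A list of the page frames in terms of a fiber presentation or a disk presentation. -/
theorem pageFrame_cases (P : OpenBookManifold O M) {p : M} {u v : EuclideanSpace ℝ (Fin 3)}
    (h : P.PageFrame p u v) :
    (∃ (x : W) (α : ℝ) (a b : EuclideanSpace ℝ (Fin 2)), P.fiber (x, α) = p ∧
      0 < O.area x ![a, b] ∧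
      mfderiv ((𝓡∂ 2).prod 𝓘(ℝ, ℝ)) (𝓡 3) P.fiber (x, α)
          ((a, 0) : EuclideanSpace ℝ (Fin 2) × ℝ) = u ∧
      mfderiv ((𝓡∂ 2).prod 𝓘(ℝ, ℝ)) (𝓡 3) P.fiber (x, α)
          ((b, 0) : EuclideanSpace ℝ (Fin 2) × ℝ) = v) ∨
    ∃ (i : B) (θ : ℝ) (z : ℂ), P.nbhd i (θ, z) = p ∧ 0 < ‖z‖ ∧ ‖z‖ < 1 ∧
      mfderiv 𝓘(ℝ, ℝ × ℂ) (𝓡 3) (P.nbhd i) (θ, z) ((1, 0) : ℝ × ℂ) = u ∧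
      mfderiv 𝓘(ℝ, ℝ × ℂ) (𝓡 3) (P.nbhd i) (θ, z) ((0, z) : ℝ × ℂ) = v := by
  cases h with
  | fiber x α a b hab => exact Or.inl ⟨x, α, a, b, rfl, hab, rfl, rfl⟩
  | disk i θ z hz hz1 => exact Or.inr ⟨i, θ, z, rfl, hz, hz1, rfl, rfl⟩

end OpenBookManifold

/-! ### Frames of the pages -/

namespace OpenBookManifold

variable {W : Type*} [TopologicalSpace W] [ChartedSpace (EuclideanHalfSpace 2) W]
  [IsManifold (𝓡∂ 2) ∞ W]
  {B : Type*} {O : AbstractOpenBook W B} {M : Type*} [TopologicalSpace M]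
  [ChartedSpace (EuclideanSpace ℝ (Fin 3)) M] [IsManifold (𝓡 3) ∞ M]

/-- The derivative of `fiber` in the direction of the page. -/
def pageDeriv (P : OpenBookManifold O M) (x : W) (s : ℝ) :
    EuclideanSpace ℝ (Fin 2) →L[ℝ] EuclideanSpace ℝ (Fin 3) :=
  ContinuousLinearMap.comp (mfderiv ((𝓡∂ 2).prod 𝓘(ℝ, ℝ)) (𝓡 3) P.fiber (x, s) :
    EuclideanSpace ℝ (Fin 2) × ℝ →L[ℝ] EuclideanSpace ℝ (Fin 3))
    (ContinuousLinearMap.inl ℝ (EuclideanSpace ℝ (Fin 2)) ℝ)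

theorem mdifferentiableAt_fiber (P : OpenBookManifold O M) (x : W × ℝ) :
    MDifferentiableAt ((𝓡∂ 2).prod 𝓘(ℝ, ℝ)) (𝓡 3) P.fiber x :=
  (P.fiber_smooth x).mdifferentiableAt (by simp)

/-- The chain rule for the identity saying that `fiber` is invariant under `(x, s) ↦ (h x, s + 2π)`.
-/
theorem pageDeriv_monodromy (P : OpenBookManifold O M) (x : W) (s : ℝ)
    (a : EuclideanSpace ℝ (Fin 2)) :
    P.pageDeriv (O.monodromy x) (s + 2 * Real.pi) (mfderiv (𝓡∂ 2) (𝓡∂ 2) O.monodromy x a) =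
      P.pageDeriv x s a := by
  have h0 : MDifferentiableAt (𝓡∂ 2) (𝓡∂ 2) O.monodromy x :=
    (O.monodromy.contMDiff x).mdifferentiableAt (by simp)
  have h1 : HasMFDerivAt 𝓘(ℝ, ℝ) 𝓘(ℝ, ℝ) (fun s : ℝ => s + 2 * Real.pi) s
      (ContinuousLinearMap.id ℝ ℝ) :=
    ((hasFDerivAt_id s).add_const _).hasMFDerivAt
  have h2 := h0.hasMFDerivAt.prodMap (p := (x, s)) h1
  have h3 := HasMFDerivAt.comp (x, s) (P.mdifferentiableAt_fiber
    (O.monodromy x, s + 2 * Real.pi)).hasMFDerivAt h2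
  have h4 : P.fiber ∘ Prod.map O.monodromy (fun s : ℝ => s + 2 * Real.pi) = P.fiber := by
    ext ⟨y, t⟩
    exact P.fiber_monodromy y t
  rw [h4] at h3
  have h5 := h3.mfderiv
  have h6 := congrArg (fun L : EuclideanSpace ℝ (Fin 2) × ℝ →L[ℝ] EuclideanSpace ℝ (Fin 3) =>
    L (a, 0)) h5
  refine Eq.trans ?_ h6.symm
  exact congrArg (fun c : ℝ => (mfderiv ((𝓡∂ 2).prod 𝓘(ℝ, ℝ)) (𝓡 3) P.fiber
    (O.monodromy x, s + 2 * Real.pi) : EuclideanSpace ℝ (Fin 2) × ℝ →L[ℝ]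
      EuclideanSpace ℝ (Fin 3)) ((mfderiv (𝓡∂ 2) (𝓡∂ 2) O.monodromy x :
        EuclideanSpace ℝ (Fin 2) →L[ℝ] EuclideanSpace ℝ (Fin 2)) a, c))
    (map_zero (mfderiv 𝓘(ℝ, ℝ) 𝓘(ℝ, ℝ) (fun s : ℝ => s + 2 * Real.pi) s : ℝ →L[ℝ] ℝ)).symm

/-- All page frames at a point of the mapping torus are positive combinations of a given one. -/
theorem pageFrame_combination_of_fiber (P : OpenBookManifold O M) {x : W} {s : ℝ}
    {a b : EuclideanSpace ℝ (Fin 2)} (hab : 0 < O.area x ![a, b])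
    {u v : EuclideanSpace ℝ (Fin 3)} (h : P.PageFrame (P.fiber (x, s)) u v) :
    ∃ p q r t : ℝ, 0 < p * t - q * r ∧ u = p • P.pageDeriv x s a + q • P.pageDeriv x s b ∧
      v = r • P.pageDeriv x s a + t • P.pageDeriv x s b := by
  rcases P.pageFrame_cases h with ⟨y, α, c, d, hy, hcd, hu, hv⟩ | ⟨i, θ, z, hp, -, hz, -⟩
  -- That `(u, v)` comes from an oriented basis of `W` does not depend on the representation of the
  -- point, because the monodromy preserves the orientation.
  · let Q : W → ℝ → Prop := fun x s => ∃ c d : EuclideanSpace ℝ (Fin 2), 0 < O.area x ![c, d] ∧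
      P.pageDeriv x s c = u ∧ P.pageDeriv x s d = v
    have hQ : ∀ x s, Q (O.monodromy x) (s + 2 * Real.pi) ↔ Q x s := by
      intro x s
      constructor
      · rintro ⟨c, d, hcd, rfl, rfl⟩
        -- The given basis at `h x` is expressed in the image of an oriented basis at `x`; this
        -- avoids the derivative of `h⁻¹`.
        obtain ⟨a, b, hab⟩ := exists_area_pos (O.area_ne_zero x)
        obtain ⟨a', b', hab', ha', hb'⟩ : ∃ a' b' : EuclideanSpace ℝ (Fin 2),
            0 < O.area (O.monodromy x) ![a', b'] ∧
            P.pageDeriv (O.monodromy x) (s + 2 * Real.pi) a' = P.pageDeriv x s a ∧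
            P.pageDeriv (O.monodromy x) (s + 2 * Real.pi) b' = P.pageDeriv x s b :=
          ⟨_, _, O.monodromy_oriented x a b hab, P.pageDeriv_monodromy x s a,
            P.pageDeriv_monodromy x s b⟩
        obtain ⟨p, q, r, t, hd, rfl, rfl⟩ := exists_combination_of_area_pos hab' hcd
        refine ⟨p • a + q • b, r • a + t • b, ?_, ?_, ?_⟩
        · exact (area_combination (A := O.area x) a b p q r t).symm ▸ mul_pos hd hab
        · rw [map_add, map_smul, map_smul, map_add, map_smul, map_smul, ha', hb']
        · rw [map_add, map_smul, map_smul, map_add, map_smul, map_smul, ha', hb']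
      · rintro ⟨a, b, hab, rfl, rfl⟩
        exact ⟨_, _, O.monodromy_oriented x a b hab, P.pageDeriv_monodromy x s a,
          P.pageDeriv_monodromy x s b⟩
    obtain ⟨c', d', hcd', rfl, rfl⟩ := (P.fiber_invariant hQ hy).1 ⟨c, d, hcd, hu, hv⟩
    obtain ⟨p, q, r, t, hd, rfl, rfl⟩ := exists_combination_of_area_pos hab hcd'
    exact ⟨p, q, r, t, hd, by simp, by simp⟩
  · exact absurd hp (P.nbhd_ne_fiber i θ z (by simpa using hz) _)

theorem pageFrame_fiber (P : OpenBookManifold O M) {x : W} {s : ℝ}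
    {a b : EuclideanSpace ℝ (Fin 2)} (hab : 0 < O.area x ![a, b]) :
    P.PageFrame (P.fiber (x, s)) (P.pageDeriv x s a) (P.pageDeriv x s b) :=
  PageFrame.fiber x s a b hab

theorem hasFDerivAt_polar (s : ℝ) (y : ℝ × ℝ) :
    HasFDerivAt (fun y : ℝ × ℝ => (y.1, ((1 + y.2 : ℝ) : ℂ) * Complex.exp (s * Complex.I)))
      ((ContinuousLinearMap.fst ℝ ℝ ℝ).prod
        ((ContinuousLinearMap.snd ℝ ℝ ℝ).smulRight (Complex.exp (s * Complex.I)))) y := by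
  refine hasFDerivAt_fst.prodMk ?_
  have h1 : HasFDerivAt (fun y : ℝ × ℝ => (1 + y.2) • Complex.exp (s * Complex.I))
      ((ContinuousLinearMap.snd ℝ ℝ ℝ).smulRight (Complex.exp (s * Complex.I))) y :=
    (hasFDerivAt_snd.const_add 1).smul_const _
  simpa using h1

/-- Differentiate the gluing relation in `(θ, t)` at fixed `s`. At `t = 0` only one-sided
derivatives in `t` exist, so both sides are derivatives within the half-open collar, where
uniqueness still holds. -/
theorem pageDeriv_collar (P : OpenBookManifold O M) (i : B) (θ s : ℝ) {t : ℝ}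
    (ht : t ∈ Ico 0 O.width) (v : ℝ × ℝ) :
    P.pageDeriv (O.collar i (θ, t)) s (mfderivWithin 𝓘(ℝ, ℝ × ℝ) (𝓡∂ 2) (O.collar i)
      (univ ×ˢ Ico 0 O.width) (θ, t) v) =
      mfderiv 𝓘(ℝ, ℝ × ℂ) (𝓡 3) (P.nbhd i)
        (θ, ((1 + t : ℝ) : ℂ) * Complex.exp (s * Complex.I))
        ((v.1, v.2 * Complex.exp (s * Complex.I)) : ℝ × ℂ) := by
  set S : Set (ℝ × ℝ) := univ ×ˢ Ico 0 O.width with hS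
  have hy : ((θ, t) : ℝ × ℝ) ∈ S := ⟨mem_univ _, ht⟩
  have h1 : MDifferentiableWithinAt 𝓘(ℝ, ℝ × ℝ) (𝓡∂ 2) (O.collar i) S (θ, t) :=
    (O.collar_smooth i _ hy).mdifferentiableWithinAt (by simp)
  have h2 : HasMFDerivWithinAt 𝓘(ℝ, ℝ × ℝ) 𝓘(ℝ, ℝ) (fun _ : ℝ × ℝ => s) S (θ, t) 0 :=
    hasMFDerivWithinAt_const _ _ _
  have h3 := h1.hasMFDerivWithinAt.prodMk h2
  have h4 := HasMFDerivAt.comp_hasMFDerivWithinAt (θ, t) (P.mdifferentiableAt_fiber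
    (O.collar i (θ, t), s)).hasMFDerivAt h3
  have hz : ‖(((1 + t : ℝ) : ℂ) * Complex.exp (s * Complex.I))‖ < 1 + O.width := by
    rw [norm_mul, Complex.norm_exp_ofReal_mul_I, mul_one, Complex.norm_real, Real.norm_eq_abs,
      abs_of_pos (by linarith [ht.1])]
    linarith [ht.2]
  have h5 := HasMFDerivAt.comp_hasMFDerivWithinAt (θ, t) (P.immersiveAt_nbhd i (x := (θ,
    ((1 + t : ℝ) : ℂ) * Complex.exp (s * Complex.I))) hz).mdifferentiableAt.hasMFDerivAt
    (hasFDerivAt_polar s (θ, t)).hasFDerivWithinAt.hasMFDerivWithinAt (s := S)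
  have h6 : ∀ y ∈ S, (P.fiber ∘ fun y => (O.collar i y, s)) y = (P.nbhd i ∘ fun y : ℝ × ℝ =>
      (y.1, ((1 + y.2 : ℝ) : ℂ) * Complex.exp (s * Complex.I))) y := by
    intro y hy
    exact (P.glue i y.1 s y.2 hy.2).symm
  have h7 := h5.congr_of_eventuallyEq (f₁ := P.fiber ∘ fun y => (O.collar i y, s))
    (eventually_of_mem self_mem_nhdsWithin h6) (h6 _ hy)
  have h8 : UniqueMDiffWithinAt 𝓘(ℝ, ℝ × ℝ) S (θ, t) :=
    (uniqueDiffOn_univ.prod (uniqueDiffOn_Ico 0 O.width) _ hy).uniqueMDiffWithinAt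
  have h9 := h8.eq h4 h7
  exact congrArg (fun L : ℝ × ℝ →L[ℝ] EuclideanSpace ℝ (Fin 3) => L v) h9

/-- Gives one frame `(∂θ, r∂r)` for the pages on the whole enlarged disk. For `|z| < 1` it is the
`disk` frame; for `|z| ≥ 1` it comes from the collar frame `(∂θ, ∂t)` with the second vector scaled
by `|z|`. -/
theorem nbhd_frame (P : OpenBookManifold O M) (i : B) (θ : ℝ) {z : ℂ} (hz0 : z ≠ 0)
    (hz : ‖z‖ < 1 + O.width) :
    P.PageFrame (P.nbhd i (θ, z))
      (mfderiv 𝓘(ℝ, ℝ × ℂ) (𝓡 3) (P.nbhd i) (θ, z) ((1, 0) : ℝ × ℂ))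
      (mfderiv 𝓘(ℝ, ℝ × ℂ) (𝓡 3) (P.nbhd i) (θ, z) ((0, z) : ℝ × ℂ)) ∧
    ∀ u v : EuclideanSpace ℝ (Fin 3), P.PageFrame (P.nbhd i (θ, z)) u v →
      ∃ p q r t : ℝ, 0 < p * t - q * r ∧
        u = p • (mfderiv 𝓘(ℝ, ℝ × ℂ) (𝓡 3) (P.nbhd i) (θ, z) ((1, 0) : ℝ × ℂ) :
            EuclideanSpace ℝ (Fin 3)) +
          q • (mfderiv 𝓘(ℝ, ℝ × ℂ) (𝓡 3) (P.nbhd i) (θ, z) ((0, z) : ℝ × ℂ) :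
            EuclideanSpace ℝ (Fin 3)) ∧
        v = r • (mfderiv 𝓘(ℝ, ℝ × ℂ) (𝓡 3) (P.nbhd i) (θ, z) ((1, 0) : ℝ × ℂ) :
            EuclideanSpace ℝ (Fin 3)) +
          t • (mfderiv 𝓘(ℝ, ℝ × ℂ) (𝓡 3) (P.nbhd i) (θ, z) ((0, z) : ℝ × ℂ) :
            EuclideanSpace ℝ (Fin 3)) := by
  by_cases hz1 : ‖z‖ < 1
  · refine ⟨PageFrame.disk i θ z (norm_pos_iff.2 hz0) hz1, fun u v h => ?_⟩
    rcases P.pageFrame_cases h with ⟨y, α, c, d, hy, -⟩ | ⟨j, θ', z', hp, -, hz', hu, hv⟩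
    · exact absurd hy.symm (P.nbhd_ne_fiber i θ z (by simpa using hz1) _)
    · obtain ⟨rfl, rfl, k, rfl⟩ := P.nbhd_eq_nbhd hz
        (by linarith [O.width_pos] : ‖z'‖ < 1 + O.width) hp.symm
      have e1 := P.mfderiv_nbhd_add_zmul i k θ hz (1, 0)
      have e2 := P.mfderiv_nbhd_add_zmul i k θ hz (0, z)
      refine ⟨1, 0, 0, 1, by norm_num, ?_, ?_⟩
      · rw [one_smul, zero_smul, add_zero]; exact hu.symm.trans e1
      · rw [one_smul, zero_smul, zero_add]; exact hv.symm.trans e2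
  · rw [not_lt] at hz1
    set s := Complex.arg z
    have hs : z = ‖z‖ * Complex.exp (s * Complex.I) := (Complex.norm_mul_exp_arg_mul_I z).symm
    have ht : ‖z‖ - 1 ∈ Ico 0 O.width := ⟨by linarith, by linarith⟩
    have hpos := O.collar_oriented i (θ, ‖z‖ - 1) ⟨mem_univ _, ht⟩
    set a : EuclideanSpace ℝ (Fin 2) := mfderivWithin 𝓘(ℝ, ℝ × ℝ) (𝓡∂ 2) (O.collar i)
      (univ ×ˢ Ico 0 O.width) (θ, ‖z‖ - 1) ((1, 0) : ℝ × ℝ) with ha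
    set b : EuclideanSpace ℝ (Fin 2) := mfderivWithin 𝓘(ℝ, ℝ × ℝ) (𝓡∂ 2) (O.collar i)
      (univ ×ˢ Ico 0 O.width) (θ, ‖z‖ - 1) ((0, 1) : ℝ × ℝ) with hb
    have hab : 0 < O.area (O.collar i (θ, ‖z‖ - 1)) ![a, ‖z‖ • b] := by
      have := area_combination (A := O.area (O.collar i (θ, ‖z‖ - 1))) a b 1 0 0 ‖z‖
      simp only [one_smul, zero_smul, add_zero, zero_add, one_mul, zero_mul, sub_zero] at this
      exact lt_of_lt_of_eq (mul_pos (by linarith) hpos) this.symm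
    have hbase : P.nbhd i (θ, z) = P.fiber (O.collar i (θ, ‖z‖ - 1), s) :=
      P.nbhd_eq_fiber i θ hz1 hz hs
    have hzz : ((1 + (‖z‖ - 1) : ℝ) : ℂ) * Complex.exp (s * Complex.I) = z := by
      rw [add_sub_cancel]; exact hs.symm
    have e1 : P.pageDeriv (O.collar i (θ, ‖z‖ - 1)) s a =
        mfderiv 𝓘(ℝ, ℝ × ℂ) (𝓡 3) (P.nbhd i) (θ, z) ((1, 0) : ℝ × ℂ) := by
      have := P.pageDeriv_collar i θ s ht (1, 0)
      rw [hzz] at this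
      have h2 : (((1 : ℝ), ((0 : ℝ) : ℂ) * Complex.exp (s * Complex.I)) : ℝ × ℂ) = (1, 0) := by
        simp
      exact this.trans (congrArg _ h2)
    have e2 : P.pageDeriv (O.collar i (θ, ‖z‖ - 1)) s (‖z‖ • b) =
        mfderiv 𝓘(ℝ, ℝ × ℂ) (𝓡 3) (P.nbhd i) (θ, z) ((0, z) : ℝ × ℂ) := by
      have := P.pageDeriv_collar i θ s ht (0, ‖z‖)
      rw [hzz, ← hs] at this
      rw [← this, hb]
      have h2 : ((0, ‖z‖) : ℝ × ℝ) = ‖z‖ • ((0, 1) : ℝ × ℝ) := by simp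
      rw [h2]
      exact congrArg _ (map_smul (mfderivWithin 𝓘(ℝ, ℝ × ℝ) (𝓡∂ 2) (O.collar i)
        (univ ×ˢ Ico 0 O.width) (θ, ‖z‖ - 1) : ℝ × ℝ →L[ℝ] EuclideanSpace ℝ (Fin 2)) _ _).symm
    rw [← e1, ← e2]
    have f1 := P.pageFrame_fiber (s := s) hab
    have f2 := fun u v => P.pageFrame_combination_of_fiber (s := s) hab (u := u) (v := v)
    rw [← hbase] at f1 f2
    exact ⟨f1, f2⟩

end OpenBookManifold

/-! ### Page charts: testing positivity of `dβ` on a single frame -/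

namespace OpenBookManifold

variable {W : Type*} [TopologicalSpace W] [ChartedSpace (EuclideanHalfSpace 2) W]
  [IsManifold (𝓡∂ 2) ∞ W]
  {B : Type*} {O : AbstractOpenBook W B} {M : Type*} [TopologicalSpace M]
  [ChartedSpace (EuclideanSpace ℝ (Fin 3)) M] [IsManifold (𝓡 3) ∞ M]

/-- A parametrization `Ψ` of `M` together with vector fields `e₁`, `e₂` that, at the point `x`,
span the page in the positive direction. -/
structure PageChart (P : OpenBookManifold O M) (Ψ : ℝ × ℂ → M) (e₁ e₂ : ℝ × ℂ → ℝ × ℂ)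
    (x : ℝ × ℂ) : Prop where
  immersive : ImmersiveAt Ψ x
  frame : P.PageFrame (Ψ x) (mfderiv 𝓘(ℝ, ℝ × ℂ) (𝓡 3) Ψ x (e₁ x))
    (mfderiv 𝓘(ℝ, ℝ × ℂ) (𝓡 3) Ψ x (e₂ x))
  combination : ∀ u v : EuclideanSpace ℝ (Fin 3), P.PageFrame (Ψ x) u v →
    ∃ p q r t : ℝ, 0 < p * t - q * r ∧
      u = p • (mfderiv 𝓘(ℝ, ℝ × ℂ) (𝓡 3) Ψ x (e₁ x) : EuclideanSpace ℝ (Fin 3)) +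
        q • (mfderiv 𝓘(ℝ, ℝ × ℂ) (𝓡 3) Ψ x (e₂ x) : EuclideanSpace ℝ (Fin 3)) ∧
      v = r • (mfderiv 𝓘(ℝ, ℝ × ℂ) (𝓡 3) Ψ x (e₁ x) : EuclideanSpace ℝ (Fin 3)) +
        t • (mfderiv 𝓘(ℝ, ℝ × ℂ) (𝓡 3) Ψ x (e₂ x) : EuclideanSpace ℝ (Fin 3))

/-- `dβ` is positive on the page through `p`. -/
def PagePos (P : OpenBookManifold O M) (β : OneForm M) (p : M) : Prop :=
  ∀ u v, P.PageFrame p u v → 0 < dForm β p u v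

/-- `dβ` is nonnegative on the page through `p`. -/
def PageNonneg (P : OpenBookManifold O M) (β : OneForm M) (p : M) : Prop :=
  ∀ u v, P.PageFrame p u v → 0 ≤ dForm β p u v

/-- Page frames at a point differ by matrices of positive determinant, so the sign of `dβ` on the
page is the sign of a single function in coordinates. -/
theorem PageChart.dForm_eq {P : OpenBookManifold O M} {Ψ : ℝ × ℂ → M} {e₁ e₂ : ℝ × ℂ → ℝ × ℂ}
    {x : ℝ × ℂ} (h : P.PageChart Ψ e₁ e₂ x) {β : OneForm M} (hβ : IsSmoothForm β)
    {u v : EuclideanSpace ℝ (Fin 3)} (huv : P.PageFrame (Ψ x) u v) :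
    ∃ c : ℝ, 0 < c ∧ dForm β (Ψ x) u v = c * dAt (pullForm β Ψ) x (e₁ x) (e₂ x) := by
  obtain ⟨p, q, r, t, hd, rfl, rfl⟩ := h.combination u v huv
  refine ⟨_, hd, ?_⟩
  rw [← dForm_mfderiv hβ h.immersive.smooth]
  exact dForm_combination β (Ψ x) _ _ p q r t

theorem PageChart.pagePos_iff {P : OpenBookManifold O M} {Ψ : ℝ × ℂ → M}
    {e₁ e₂ : ℝ × ℂ → ℝ × ℂ} {x : ℝ × ℂ} (h : P.PageChart Ψ e₁ e₂ x) {β : OneForm M}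
    (hβ : IsSmoothForm β) :
    P.PagePos β (Ψ x) ↔ 0 < dAt (pullForm β Ψ) x (e₁ x) (e₂ x) := by
  constructor
  · intro hp
    rw [← dForm_mfderiv hβ h.immersive.smooth]
    exact hp _ _ h.frame
  · intro hp u v huv
    obtain ⟨c, hc, he⟩ := h.dForm_eq hβ huv
    rw [he]
    positivity

theorem PageChart.pageNonneg_iff {P : OpenBookManifold O M} {Ψ : ℝ × ℂ → M}
    {e₁ e₂ : ℝ × ℂ → ℝ × ℂ} {x : ℝ × ℂ} (h : P.PageChart Ψ e₁ e₂ x) {β : OneForm M}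
    (hβ : IsSmoothForm β) :
    P.PageNonneg β (Ψ x) ↔ 0 ≤ dAt (pullForm β Ψ) x (e₁ x) (e₂ x) := by
  constructor
  · intro hp
    rw [← dForm_mfderiv hβ h.immersive.smooth]
    exact hp _ _ h.frame
  · intro hp u v huv
    obtain ⟨c, hc, he⟩ := h.dForm_eq hβ huv
    rw [he]
    positivity

theorem pageChart_nbhd (P : OpenBookManifold O M) (i : B) {x : ℝ × ℂ} (hx0 : x.2 ≠ 0)
    (hx : ‖x.2‖ < 1 + O.width) :
    P.PageChart (P.nbhd i) (fun _ => (1, 0)) (fun x => (0, x.2)) x :=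
  ⟨P.immersiveAt_nbhd i hx, (P.nbhd_frame i x.1 hx0 hx).1, (P.nbhd_frame i x.1 hx0 hx).2⟩

/-- In a convex chart neighbourhood of an interior point of `W`, the orientation is constant. -/
theorem exists_oriented_chart (O : AbstractOpenBook W B) {x₀ : W}
    (h : (𝓡∂ 2).IsInteriorPoint x₀) :
    ∃ (N : Set (EuclideanSpace ℝ (Fin 2))) (σ : ℝ), IsOpen N ∧ Convex ℝ N ∧ σ ≠ 0 ∧
      extChartAt (𝓡∂ 2) x₀ x₀ ∈ N ∧ N ⊆ (extChartAt (𝓡∂ 2) x₀).target ∧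
      ∀ y ∈ N, ContMDiffAt 𝓘(ℝ, EuclideanSpace ℝ (Fin 2)) (𝓡∂ 2) ∞
          (extChartAt (𝓡∂ 2) x₀).symm y ∧
        Function.Injective (mfderiv 𝓘(ℝ, EuclideanSpace ℝ (Fin 2)) (𝓡∂ 2)
          (extChartAt (𝓡∂ 2) x₀).symm y) ∧
        ∀ a b : EuclideanSpace ℝ (Fin 2), 0 < σ * (a 0 * b 1 - a 1 * b 0) →
          0 < O.area ((extChartAt (𝓡∂ 2) x₀).symm y)
            ![mfderiv 𝓘(ℝ, EuclideanSpace ℝ (Fin 2)) (𝓡∂ 2) (extChartAt (𝓡∂ 2) x₀).symm y a,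
              mfderiv 𝓘(ℝ, EuclideanSpace ℝ (Fin 2)) (𝓡∂ 2) (extChartAt (𝓡∂ 2) x₀).symm y b] := by
  set e := extChartAt (𝓡∂ 2) x₀ with he
  set y₀ := e x₀ with hy₀
  have hint : y₀ ∈ interior e.target := ModelWithCorners.isInteriorPoint_iff.1 h
  let D : EuclideanSpace ℝ (Fin 2) → EuclideanSpace ℝ (Fin 2) →L[ℝ] EuclideanSpace ℝ (Fin 2) :=
    fun y => mfderiv 𝓘(ℝ, EuclideanSpace ℝ (Fin 2)) (𝓡∂ 2) e.symm y
  have hD : ∀ y ∈ interior e.target, D y = mfderivWithin 𝓘(ℝ, EuclideanSpace ℝ (Fin 2)) (𝓡∂ 2)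
      e.symm (range (𝓡∂ 2)) y := by
    intro y hy
    refine (mfderivWithin_of_mem_nhds ?_).symm
    exact mem_of_superset (isOpen_interior.mem_nhds hy)
      (interior_subset.trans (extChartAt_target_subset_range x₀))
  have hinv : ∀ y ∈ interior e.target, (D y).IsInvertible := by
    intro y hy
    rw [hD y hy]
    exact isInvertible_mfderivWithin_extChartAt_symm (interior_subset hy)
  let A : EuclideanSpace ℝ (Fin 2) → EuclideanSpace ℝ (Fin 2) [⋀^Fin 2]→L[ℝ] ℝ :=
    fun y => (O.area (e.symm y) : EuclideanSpace ℝ (Fin 2) [⋀^Fin 2]→L[ℝ] ℝ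
      ).compContinuousLinearMap (D y)
  have hAc : ContinuousOn A (interior e.target) := by
    refine ((O.area_smooth x₀).continuousOn.mono interior_subset).congr fun y hy => ?_
    show (O.area (e.symm y) : EuclideanSpace ℝ (Fin 2) [⋀^Fin 2]→L[ℝ] ℝ
      ).compContinuousLinearMap (D y) = _
    rw [hD y hy]
  have hAab : ∀ y a b, A y ![a, b] =
      (O.area (e.symm y) : EuclideanSpace ℝ (Fin 2) [⋀^Fin 2]→L[ℝ] ℝ) ![D y a, D y b] := by
    intro y a b
    show (O.area (e.symm y) : EuclideanSpace ℝ (Fin 2) [⋀^Fin 2]→L[ℝ] ℝ) _ = _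
    congr 1
    funext i
    fin_cases i <;> rfl
  -- The density of the area form in the chart: continuous and nonzero at `y₀`. Its value there
  -- serves as `σ`, of which only the sign matters.
  let f : EuclideanSpace ℝ (Fin 2) → ℝ := fun y =>
    A y ![EuclideanSpace.single 0 1, EuclideanSpace.single 1 1]
  have hfc : ContinuousAt f y₀ := by
    have h1 := hAc.continuousAt (isOpen_interior.mem_nhds hint)
    exact ((ContinuousAlternatingMap.apply ℝ _ ℝ
      ![EuclideanSpace.single 0 1, EuclideanSpace.single 1 1]).continuous.continuousAt).comp h1
  have hf0 : f y₀ ≠ 0 := by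
    obtain ⟨a, b, hab⟩ := exists_area_pos (O.area_ne_zero (e.symm y₀))
    obtain ⟨L, hL⟩ := hinv y₀ hint
    have h1 : A y₀ ![L.symm a, L.symm b] =
        (O.area (e.symm y₀) : EuclideanSpace ℝ (Fin 2) [⋀^Fin 2]→L[ℝ] ℝ) ![a, b] := by
      rw [hAab, ← hL]
      simp
    intro h0
    rw [area_eq_det, show A y₀ ![EuclideanSpace.single 0 1, EuclideanSpace.single 1 1] = 0 from h0,
      mul_zero] at h1
    exact hab.ne h1
  have hpos : ∀ᶠ y in 𝓝 y₀, 0 < f y₀ * f y ∧ y ∈ interior e.target := by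
    refine Eventually.and ?_ (isOpen_interior.mem_nhds hint)
    have h1 : ContinuousAt (fun y => f y₀ * f y) y₀ := continuousAt_const.mul hfc
    exact h1.eventually_const_lt (mul_self_pos.2 hf0)
  obtain ⟨r, hr, hball⟩ := Metric.eventually_nhds_iff_ball.1 hpos
  refine ⟨Metric.ball y₀ r, f y₀, Metric.isOpen_ball, convex_ball _ _, hf0,
    Metric.mem_ball_self hr, fun y hy => interior_subset (hball y hy).2, fun y hy => ⟨?_, ?_, ?_⟩⟩
  · exact (contMDiffOn_extChartAt_symm x₀).contMDiffAt
      (mem_interior_iff_mem_nhds.1 (hball y hy).2)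
  · obtain ⟨L, hL⟩ := hinv y (hball y hy).2
    have : Function.Injective (D y) := by rw [← hL]; exact L.injective
    exact this
  · intro a b hab
    have h1 := (hball y hy).1
    have h2 : 0 < A y ![a, b] := by
      rw [area_eq_det]
      refine (pos_iff_pos_of_mul_pos ?_).1 (mul_self_pos.2 hf0)
      have := mul_pos hab h1
      show 0 < f y₀ * f y₀ * (_ * f y)
      nlinarith
    rw [hAab] at h2
    exact h2

/-- The parametrization of a neighbourhood of a point in the interior of the mapping torus by
`(s, z) ↦ (y₁ + (Re z) a + (Im z) b, s)` in a chart of `W`. -/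
def fiberChart (P : OpenBookManifold O M) (x₀ : W) (y₁ a b : EuclideanSpace ℝ (Fin 2))
    (x : ℝ × ℂ) : M :=
  P.fiber ((extChartAt (𝓡∂ 2) x₀).symm (y₁ + x.2.re • a + x.2.im • b), x.1)

theorem pageChart_fiberChart (P : OpenBookManifold O M) {x₀ : W}
    {y₁ a b : EuclideanSpace ℝ (Fin 2)} {x : ℝ × ℂ}
    (hs : ContMDiffAt 𝓘(ℝ, EuclideanSpace ℝ (Fin 2)) (𝓡∂ 2) ∞ (extChartAt (𝓡∂ 2) x₀).symm
      (y₁ + x.2.re • a + x.2.im • b))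
    (hinj : Function.Injective (mfderiv 𝓘(ℝ, EuclideanSpace ℝ (Fin 2)) (𝓡∂ 2)
      (extChartAt (𝓡∂ 2) x₀).symm (y₁ + x.2.re • a + x.2.im • b)))
    (hdet : a 0 * b 1 - a 1 * b 0 ≠ 0)
    (hpos : 0 < O.area ((extChartAt (𝓡∂ 2) x₀).symm (y₁ + x.2.re • a + x.2.im • b))
      ![mfderiv 𝓘(ℝ, EuclideanSpace ℝ (Fin 2)) (𝓡∂ 2) (extChartAt (𝓡∂ 2) x₀).symm
          (y₁ + x.2.re • a + x.2.im • b) a,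
        mfderiv 𝓘(ℝ, EuclideanSpace ℝ (Fin 2)) (𝓡∂ 2) (extChartAt (𝓡∂ 2) x₀).symm
          (y₁ + x.2.re • a + x.2.im • b) b]) :
    P.PageChart (P.fiberChart x₀ y₁ a b) (fun _ => (0, 1)) (fun _ => (0, Complex.I)) x := by
  set e := extChartAt (𝓡∂ 2) x₀ with he
  let L : ℝ × ℂ →L[ℝ] EuclideanSpace ℝ (Fin 2) :=
    (Complex.reCLM.comp (ContinuousLinearMap.snd ℝ ℝ ℂ)).smulRight a +
      (Complex.imCLM.comp (ContinuousLinearMap.snd ℝ ℝ ℂ)).smulRight b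
  have hL : ∀ v : ℝ × ℂ, L v = v.2.re • a + v.2.im • b := fun v => rfl
  let ℓ : ℝ × ℂ → EuclideanSpace ℝ (Fin 2) := fun x => y₁ + x.2.re • a + x.2.im • b
  have hℓ : ∀ x, HasFDerivAt ℓ L x := by
    intro x
    have : ℓ = fun x => y₁ + L x := by ext1 x; rw [hL, ← add_assoc]
    rw [this]
    exact L.hasFDerivAt.const_add y₁
  have hℓs : ContDiff ℝ ∞ ℓ := by
    have : ℓ = fun x => y₁ + L x := by ext1 x; rw [hL, ← add_assoc]
    rw [this]
    exact contDiff_const.add L.contDiff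
  let D : EuclideanSpace ℝ (Fin 2) →L[ℝ] EuclideanSpace ℝ (Fin 2) :=
    mfderiv 𝓘(ℝ, EuclideanSpace ℝ (Fin 2)) (𝓡∂ 2) e.symm (ℓ x)
  let G : ℝ × ℂ → W × ℝ := fun x => (e.symm (ℓ x), x.1)
  have hG : ContMDiffAt 𝓘(ℝ, ℝ × ℂ) ((𝓡∂ 2).prod 𝓘(ℝ, ℝ)) ∞ G x := by
    refine ContMDiffAt.prodMk ?_ contDiff_fst.contMDiff.contMDiffAt
    exact ContMDiffAt.comp x hs hℓs.contMDiff.contMDiffAt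
  have hGd : HasMFDerivAt 𝓘(ℝ, ℝ × ℂ) ((𝓡∂ 2).prod 𝓘(ℝ, ℝ)) G x
      ((D.comp L).prod (ContinuousLinearMap.fst ℝ ℝ ℂ)) := by
    refine HasMFDerivAt.prodMk ?_ hasFDerivAt_fst.hasMFDerivAt
    exact HasMFDerivAt.comp x (hs.mdifferentiableAt (by simp)).hasMFDerivAt (hℓ x).hasMFDerivAt
  let F : EuclideanSpace ℝ (Fin 2) × ℝ →L[ℝ] EuclideanSpace ℝ (Fin 3) :=
    mfderiv ((𝓡∂ 2).prod 𝓘(ℝ, ℝ)) (𝓡 3) P.fiber (G x)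
  have hd : HasMFDerivAt 𝓘(ℝ, ℝ × ℂ) (𝓡 3) (P.fiberChart x₀ y₁ a b) x
      (F.comp ((D.comp L).prod (ContinuousLinearMap.fst ℝ ℝ ℂ))) :=
    HasMFDerivAt.comp x (P.mdifferentiableAt_fiber (G x)).hasMFDerivAt hGd
  have hd' : ∀ v : ℝ × ℂ, (mfderiv 𝓘(ℝ, ℝ × ℂ) (𝓡 3) (P.fiberChart x₀ y₁ a b) x v :
      EuclideanSpace ℝ (Fin 3)) = F (D (L v), v.1) := fun v =>
    congrArg (fun L : ℝ × ℂ →L[ℝ] EuclideanSpace ℝ (Fin 3) => L v) hd.mfderiv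
  have e1 : (mfderiv 𝓘(ℝ, ℝ × ℂ) (𝓡 3) (P.fiberChart x₀ y₁ a b) x ((0, 1) : ℝ × ℂ) :
      EuclideanSpace ℝ (Fin 3)) = P.pageDeriv (e.symm (ℓ x)) x.1 (D a) := by
    rw [hd', hL]
    simp
    rfl
  have e2 : (mfderiv 𝓘(ℝ, ℝ × ℂ) (𝓡 3) (P.fiberChart x₀ y₁ a b) x ((0, Complex.I) : ℝ × ℂ) :
      EuclideanSpace ℝ (Fin 3)) = P.pageDeriv (e.symm (ℓ x)) x.1 (D b) := by
    rw [hd', hL]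
    simp
    rfl
  refine ⟨⟨ContMDiffAt.comp x (P.fiber_smooth (G x)) hG, ?_⟩, ?_, ?_⟩
  · rintro (v : ℝ × ℂ) (w : ℝ × ℂ) hvw
    have h1 : F (D (L v), v.1) = F (D (L w), w.1) := (hd' v).symm.trans (Eq.trans hvw (hd' w))
    have h2 : ((D (L v), v.1) : EuclideanSpace ℝ (Fin 2) × ℝ) = (D (L w), w.1) :=
      P.fiber_immersion (G x) h1
    rw [Prod.mk.injEq] at h2
    have h3 : L v = L w := hinj h2.1
    rw [hL, hL] at h3
    have h4 := congrArg (fun y : EuclideanSpace ℝ (Fin 2) => y 0) h3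
    have h5 := congrArg (fun y : EuclideanSpace ℝ (Fin 2) => y 1) h3
    -- Real and imaginary parts are coordinates with respect to the basis `a`, `b`; both are
    -- recovered by Cramer's rule.
    simp only [PiLp.add_apply, PiLp.smul_apply, smul_eq_mul] at h4 h5
    refine Prod.ext h2.2 (Complex.ext ?_ ?_)
    · refine mul_right_cancel₀ hdet ?_
      linear_combination b 1 * h4 - b 0 * h5
    · refine mul_right_cancel₀ hdet ?_
      linear_combination a 0 * h5 - a 1 * h4
  · have := P.pageFrame_fiber (s := x.1) hpos
    show P.PageFrame (P.fiber (e.symm (ℓ x), x.1)) _ _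
    exact e1 ▸ e2 ▸ this
  · intro u v huv
    rw [e1, e2]
    exact P.pageFrame_combination_of_fiber hpos huv

/-- The parametrization `fiberChart` is a page chart near an interior point of `W`. -/
theorem exists_pageChart_fiberChart (P : OpenBookManifold O M) {x : W}
    (hint : (𝓡∂ 2).IsInteriorPoint x) (s : ℝ) :
    ∃ a b : EuclideanSpace ℝ (Fin 2),
      P.fiberChart x (extChartAt (𝓡∂ 2) x x) a b (s, 0) = P.fiber (x, s) ∧
      ∀ᶠ y in 𝓝 ((s, 0) : ℝ × ℂ), P.PageChart (P.fiberChart x (extChartAt (𝓡∂ 2) x x) a b)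
        (fun _ => (0, 1)) (fun _ => (0, Complex.I)) y := by
  obtain ⟨N, σ, hNo, -, hσ, hxN, hNt, hN⟩ := exists_oriented_chart O hint
  -- The factor `σ` makes `(a, b)` positively oriented: the determinant is `σ`, and `σ · σ > 0`.
  set b : EuclideanSpace ℝ (Fin 2) := σ • EuclideanSpace.single 1 1 with hbdef
  set a : EuclideanSpace ℝ (Fin 2) := EuclideanSpace.single 0 1 with hadef
  have hdet : a 0 * b 1 - a 1 * b 0 = σ := by simp [hadef, hbdef]
  refine ⟨a, b, ?_, ?_⟩
  · simp only [fiberChart, Complex.zero_re, Complex.zero_im, zero_smul, add_zero]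
    rw [extChartAt_to_inv]
  · have hc : ContinuousAt (fun y : ℝ × ℂ => extChartAt (𝓡∂ 2) x x + y.2.re • a + y.2.im • b)
        (s, 0) := by
      have := Complex.continuous_re
      have := Complex.continuous_im
      fun_prop
    have hm := hc.eventually_mem (hNo.mem_nhds (by simpa using hxN))
    filter_upwards [hm] with y hy
    obtain ⟨h1, h2, h3⟩ := hN _ hy
    refine P.pageChart_fiberChart h1 h2 (by rw [hdet]; exact hσ) (h3 _ _ ?_)
    rw [hdet]
    exact mul_self_pos.2 hσ

theorem nbhd_exp_eq_fiber (P : OpenBookManifold O M) (i : B) (θ s : ℝ) :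
    P.nbhd i (θ, Complex.exp (s * Complex.I)) = P.fiber (O.collar i (θ, 0), s) := by
  rw [← P.glue i θ s 0 ⟨le_rfl, O.width_pos⟩]
  simp

/-- Every point lies in the enlarged neighbourhood of the binding or in the interior of the mapping
torus. -/
theorem mem_nbhd_or_interior (P : OpenBookManifold O M) (p : M) :
    (∃ i x, ‖x.2‖ < 1 + O.width ∧ P.nbhd i x = p) ∨
      ∃ x s, (𝓡∂ 2).IsInteriorPoint x ∧ P.fiber (x, s) = p := by
  rcases P.cover p with ⟨⟨x, s⟩, hx⟩ | ⟨i, θ, z, hz, h⟩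
  · by_cases hb : x ∈ (𝓡∂ 2).boundary W
    · rw [← O.collar_boundary] at hb
      obtain ⟨i, θ, rfl⟩ := hb
      refine Or.inl ⟨i, (θ, Complex.exp (s * Complex.I)), ?_, ?_⟩
      · rw [Complex.norm_exp_ofReal_mul_I]; linarith [O.width_pos]
      · rw [← hx, nbhd_exp_eq_fiber]
    · exact Or.inr ⟨x, s,
        (ModelWithCorners.isInteriorPoint_or_isBoundaryPoint x).resolve_right hb, hx⟩
  · have : ‖z‖ < 1 := by simpa using hz
    exact Or.inl ⟨i, (θ, z), by linarith [O.width_pos], h⟩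

/-- Away from the binding, every point has a page chart. -/
theorem exists_pageChart (P : OpenBookManifold O M) {p : M}
    (hp : ∀ i, p ∉ P.bindingComponent i) :
    ∃ (Ψ : ℝ × ℂ → M) (e₁ e₂ : ℝ × ℂ → ℝ × ℂ) (x : ℝ × ℂ), Continuous e₁ ∧ Continuous e₂ ∧
      Ψ x = p ∧ ∀ᶠ y in 𝓝 x, P.PageChart Ψ e₁ e₂ y := by
  rcases P.mem_nbhd_or_interior p with ⟨i, ⟨θ, z⟩, hz, h⟩ | ⟨x, s, hint, h⟩
  · have hz0 : z ≠ 0 := by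
      rintro rfl
      exact hp i ⟨θ, h⟩
    refine ⟨P.nbhd i, fun _ => (1, 0), fun x => (0, x.2), (θ, z), continuous_const, by fun_prop,
      h, ?_⟩
    have hc : ContinuousAt (fun y : ℝ × ℂ => y.2) (θ, z) := continuousAt_snd
    filter_upwards [(isOpen_tubeDomain (1 + O.width)).mem_nhds hz,
      hc.eventually_ne hz0] with y h3 h4
    exact P.pageChart_nbhd i h4 h3
  · obtain ⟨a, b, h1, h2⟩ := P.exists_pageChart_fiberChart hint s
    exact ⟨_, fun _ => (0, 1), fun _ => (0, Complex.I), (s, 0), continuous_const,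
      continuous_const, h1.trans h, h2⟩

end OpenBookManifold

/-! ### Calculus of the forms `Γ dθ + Q Im(z̄ dz)` -/

section Polar

/-- The bilinear form `(z, w) ↦ Im (z̄ w)`. -/
def angular : ℂ →L[ℝ] ℂ →L[ℝ] ℝ :=
  Complex.reCLM.smulRight Complex.imCLM - Complex.imCLM.smulRight Complex.reCLM

theorem angular_apply (z w : ℂ) : angular z w = z.re * w.im - z.im * w.re := rfl

theorem angular_eq_im (z w : ℂ) : angular z w = ((starRingEnd ℂ) z * w).im := by
  rw [angular_apply]; simp; ring

/-- The form `Γ dθ + Q Im(z̄ dz)` on `ℝ × ℂ`. -/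
def polarForm (Γ Q : ℂ → ℝ) (x : ℝ × ℂ) : ℝ × ℂ →L[ℝ] ℝ :=
  Γ x.2 • ContinuousLinearMap.fst ℝ ℝ ℂ +
    Q x.2 • (angular x.2).comp (ContinuousLinearMap.snd ℝ ℝ ℂ)

theorem polarForm_apply (Γ Q : ℂ → ℝ) (x v : ℝ × ℂ) :
    polarForm Γ Q x v = Γ x.2 * v.1 + Q x.2 * angular x.2 v.2 := rfl

theorem contDiffAt_polarForm {Γ Q : ℂ → ℝ} {x : ℝ × ℂ} (hΓ : ContDiffAt ℝ ∞ Γ x.2)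
    (hQ : ContDiffAt ℝ ∞ Q x.2) : ContDiffAt ℝ ∞ (polarForm Γ Q) x := by
  refine ContDiffAt.add (ContDiffAt.smul (hΓ.comp x contDiffAt_snd) contDiffAt_const)
    (ContDiffAt.smul (hQ.comp x contDiffAt_snd) (ContDiffAt.clm_comp ?_ contDiffAt_const))
  exact angular.contDiff.contDiffAt.comp x contDiffAt_snd

theorem dAt_polarForm {Γ Q : ℂ → ℝ} {x : ℝ × ℂ} (hΓ : DifferentiableAt ℝ Γ x.2)
    (hQ : DifferentiableAt ℝ Q x.2) (u v : ℝ × ℂ) :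
    dAt (polarForm Γ Q) x u v = fderiv ℝ Γ x.2 u.2 * v.1 - fderiv ℝ Γ x.2 v.2 * u.1 +
      2 * Q x.2 * angular u.2 v.2 + fderiv ℝ Q x.2 u.2 * angular x.2 v.2 -
        fderiv ℝ Q x.2 v.2 * angular x.2 u.2 := by
  have h1 : HasFDerivAt (fun x : ℝ × ℂ => Γ x.2)
    ((fderiv ℝ Γ x.2).comp (ContinuousLinearMap.snd ℝ ℝ ℂ)) x := hΓ.hasFDerivAt.comp x hasFDerivAt_snd
  have h2 : HasFDerivAt (fun x : ℝ × ℂ => Q x.2)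
    ((fderiv ℝ Q x.2).comp (ContinuousLinearMap.snd ℝ ℝ ℂ)) x := hQ.hasFDerivAt.comp x hasFDerivAt_snd
  let K : ℂ →L[ℝ] (ℝ × ℂ →L[ℝ] ℝ) := ((ContinuousLinearMap.compL ℝ (ℝ × ℂ) ℂ ℝ).flip
    (ContinuousLinearMap.snd ℝ ℝ ℂ)).comp angular
  have h3 : HasFDerivAt (fun x : ℝ × ℂ => K x.2) (K.comp (ContinuousLinearMap.snd ℝ ℝ ℂ)) x :=
    K.hasFDerivAt.comp x hasFDerivAt_snd
  have h4 := (h1.smul_const (ContinuousLinearMap.fst ℝ ℝ ℂ)).add (h2.smul h3)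
  have h5 : fderiv ℝ (polarForm Γ Q) x = _ := h4.fderiv
  have hK : ∀ z w, K z w = angular z w.2 := fun z w => rfl
  unfold dAt
  rw [h5]
  simp only [add_apply, ContinuousLinearMap.smulRight_apply, ContinuousLinearMap.comp_apply,
    smul_apply, ContinuousLinearMap.coe_fst', ContinuousLinearMap.coe_snd', smul_eq_mul, hK,
    angular_apply]
  ring

/-- The angular part does not contribute, since `dφ` vanishes on the pages. Positivity on the pages
thus means that `Γ` decreases along rays. -/
theorem dAt_polarForm_page {Γ Q : ℂ → ℝ} {x : ℝ × ℂ} (hΓ : DifferentiableAt ℝ Γ x.2)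
    (hQ : DifferentiableAt ℝ Q x.2) :
    dAt (polarForm Γ Q) x (1, 0) (0, x.2) = -fderiv ℝ Γ x.2 x.2 := by
  rw [dAt_polarForm hΓ hQ]
  simp

theorem complex_eq_re_im (z : ℂ) : z = z.re • (1 : ℂ) + z.im • Complex.I := by
  apply Complex.ext <;> simp

theorem fderiv_apply_self {f : ℂ → ℝ} (z : ℂ) :
    fderiv ℝ f z z = z.re * fderiv ℝ f z 1 + z.im * fderiv ℝ f z Complex.I := by
  conv_lhs => rw [show fderiv ℝ f z z = fderiv ℝ f z (z.re • (1 : ℂ) + z.im • Complex.I) by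
    rw [← complex_eq_re_im]]
  rw [map_add, map_smul, map_smul, smul_eq_mul, smul_eq_mul]

/-- The value of `λ ∧ dλ` for `λ = Γ dθ + Q Im(z̄ dz)` on the standard frame. -/
theorem wedge_polarForm {Γ Q : ℂ → ℝ} {x : ℝ × ℂ} (hΓ : DifferentiableAt ℝ Γ x.2)
    (hQ : DifferentiableAt ℝ Q x.2) :
    polarForm Γ Q x (1, 0) * dAt (polarForm Γ Q) x (0, 1) (0, Complex.I) -
      polarForm Γ Q x (0, 1) * dAt (polarForm Γ Q) x (1, 0) (0, Complex.I) +
      polarForm Γ Q x (0, Complex.I) * dAt (polarForm Γ Q) x (1, 0) (0, 1) =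
    Γ x.2 * (2 * Q x.2 + fderiv ℝ Q x.2 x.2) - Q x.2 * fderiv ℝ Γ x.2 x.2 := by
  simp only [dAt_polarForm hΓ hQ, polarForm_apply, angular_apply, fderiv_apply_self]
  simp
  ring

/-- A function constant on the circle through `z` has zero derivative along `iz`; decompose `|z|² w`
into its components along `z` and `iz`. -/
theorem fderiv_radial {f : ℂ → ℝ} {z : ℂ} (hf : DifferentiableAt ℝ f z)
    (hr : ∀ w, ‖w‖ = ‖z‖ → f w = f z) (w : ℂ) :
    ‖z‖ ^ 2 * fderiv ℝ f z w = (z.re * w.re + z.im * w.im) * fderiv ℝ f z z := by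
  have h1 : fderiv ℝ f z (Complex.I * z) = 0 := by
    have h2 : HasDerivAt (fun s : ℝ => Complex.exp (s * Complex.I) * z) (Complex.I * z) 0 := by
      have h3 : HasDerivAt (fun s : ℂ => Complex.exp (s * Complex.I) * z) (Complex.I * z)
          ((0 : ℝ) : ℂ) := by
        have := (((hasDerivAt_id ((0 : ℝ) : ℂ)).mul_const Complex.I).cexp).mul_const z
        simpa using this
      exact h3.comp_ofReal
    have h4 : HasFDerivAt f (fderiv ℝ f z) (Complex.exp ((0 : ℝ) * Complex.I) * z) := by
      simpa using hf.hasFDerivAt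
    have h5 := h4.comp_hasDerivAt (0 : ℝ) h2
    have h6 : (f ∘ fun s : ℝ => Complex.exp (s * Complex.I) * z) = fun _ => f z := by
      ext s
      refine hr _ ?_
      rw [norm_mul, Complex.norm_exp_ofReal_mul_I, one_mul]
    rw [h6] at h5
    exact h5.unique (hasDerivAt_const _ _)
  have h2 : (‖z‖ ^ 2 : ℝ) • w = (z.re * w.re + z.im * w.im) • z + angular z w • (Complex.I * z) := by
    rw [← Complex.normSq_eq_norm_sq, angular_apply]
    apply Complex.ext
    · simp [Complex.normSq_apply]; ring
    · simp [Complex.normSq_apply]; ring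
  have h3 := congrArg (fderiv ℝ f z) h2
  rw [map_add, map_smul, map_smul, map_smul, h1] at h3
  simpa using h3

/-- If `|f| = 1`, then `Im (f̄ df)` is closed. -/
theorem dAt_angular_eq_zero {X : Type*} [NormedAddCommGroup X] [NormedSpace ℝ X] {f : X → ℂ}
    {x : X} (hf : ContDiffAt ℝ 2 f x) (h1 : ∀ᶠ y in 𝓝 x, ‖f y‖ = 1) (u v : X) :
    dAt (fun y => (angular (f y)).comp (fderiv ℝ f y)) x u v = 0 := by
  rw [dAt_pullback (ζ := fun z => angular z) (angular.differentiableAt) hf]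
  have h2 : DifferentiableAt ℝ f x := hf.differentiableAt (by norm_num)
  -- Differentiating `|f|² = 1` shows that `df` takes values in the tangent line of the circle, so
  -- any two values are parallel and span no area.
  have hre : ∀ u, (f x).re * (fderiv ℝ f x u).re + (f x).im * (fderiv ℝ f x u).im = 0 := by
    intro u
    have h3 : HasFDerivAt (fun y => (f y).re * (f y).re + (f y).im * (f y).im) _ x :=
      ((Complex.reCLM.hasFDerivAt.comp x h2.hasFDerivAt).mul
      (Complex.reCLM.hasFDerivAt.comp x h2.hasFDerivAt)).add
      ((Complex.imCLM.hasFDerivAt.comp x h2.hasFDerivAt).mul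
      (Complex.imCLM.hasFDerivAt.comp x h2.hasFDerivAt))
    have h4 : (fun y => (f y).re * (f y).re + (f y).im * (f y).im) =ᶠ[𝓝 x] fun _ => 1 := by
      filter_upwards [h1] with y hy
      rw [← Complex.normSq_apply, Complex.normSq_eq_norm_sq, hy]; norm_num
    have h5 := (h4.hasFDerivAt_iff.1 h3).unique (hasFDerivAt_const _ _)
    have h6 := congrArg (fun L : X →L[ℝ] ℝ => L u) h5
    simp at h6
    linarith
  have hn : (f x).re * (f x).re + (f x).im * (f x).im = 1 := by
    rw [← Complex.normSq_apply, Complex.normSq_eq_norm_sq, h1.self_of_nhds]; norm_num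
  have hang : ∀ a b : ℂ, dAt (fun z => angular z) (f x) a b = 2 * angular a b := by
    intro a b
    unfold dAt
    rw [angular.hasFDerivAt.fderiv, angular_apply, angular_apply]
    ring
  rw [hang, angular_apply]
  have hu := hre u
  have hv := hre v
  set a := fderiv ℝ f x u
  set b := fderiv ℝ f x v
  have e1 : (f x).re * (a.re * b.im - a.im * b.re) = 0 := by
    linear_combination b.im * hu - a.im * hv
  have e2 : (f x).im * (a.re * b.im - a.im * b.re) = 0 := by
    linear_combination a.re * hv - b.re * hu
  have : a.re * b.im - a.im * b.re = 0 := by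
    linear_combination -(a.re * b.im - a.im * b.re) * hn + (f x).re * e1 + (f x).im * e2
  rw [this, mul_zero]

end Polar

/-! ### The forms `Γ dθ` and `dφ` on `M` -/

namespace OpenBookManifold

variable {W : Type*} [TopologicalSpace W] [ChartedSpace (EuclideanHalfSpace 2) W]
  [IsManifold (𝓡∂ 2) ∞ W]
  {B : Type*} {O : AbstractOpenBook W B} {M : Type*} [TopologicalSpace M]
  [ChartedSpace (EuclideanSpace ℝ (Fin 3)) M] [IsManifold (𝓡 3) ∞ M]

theorem exists_mem_Icc_nbhd_eq (P : OpenBookManifold O M) (i : B) (θ : ℝ) {z : ℂ}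
    (hz : ‖z‖ < 1 + O.width) :
    ∃ θ' ∈ Icc 0 (2 * Real.pi), P.nbhd i (θ, z) = P.nbhd i (θ', z) := by
  have hp := Real.two_pi_pos
  have h2 := toIcoMod_mem_Ico hp 0 θ
  rw [zero_add] at h2
  refine ⟨toIcoMod hp 0 θ, ⟨h2.1, h2.2.le⟩, ?_⟩
  rw [← P.nbhd_add_zmul i (toIcoDiv hp 0 θ) (toIcoMod hp 0 θ) hz]
  congr 2
  have := toIcoMod_add_toIcoDiv_zsmul hp 0 θ
  rw [zsmul_eq_mul] at this
  exact this.symm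

/-- By periodicity `θ` may be restricted to `[0, 2π]`. -/
theorem isCompact_nbhd_image (P : OpenBookManifold O M) (i : B) {K : Set ℂ} (hK : IsCompact K)
    (hc : ∀ z ∈ K, ‖z‖ < 1 + O.width) : IsCompact (P.nbhd i '' (univ ×ˢ K)) := by
  have h1 : P.nbhd i '' (univ ×ˢ K) = P.nbhd i '' (Icc 0 (2 * Real.pi) ×ˢ K) := by
    refine Subset.antisymm ?_ (image_mono (prod_mono (subset_univ _) le_rfl))
    rintro _ ⟨⟨θ, z⟩, ⟨-, hz⟩, rfl⟩
    obtain ⟨θ', h, he⟩ := P.exists_mem_Icc_nbhd_eq i θ (hc z hz)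
    exact ⟨(θ', z), ⟨h, hz⟩, he.symm⟩
  rw [h1]
  refine (isCompact_Icc.prod hK).image_of_continuousOn ?_
  refine (P.nbhd_smooth i).continuousOn.mono ?_
  rintro ⟨θ, z⟩ ⟨-, hz⟩
  exact ⟨mem_univ _, by simpa using hc z hz⟩

/-- `Γ dθ` on the tubes, extended by zero. The bound `c < 1 + width` leaves room for the support to
be compact inside the domain of `nbhd`, so the extension is smooth. -/
theorem exists_tubeForm [T2Space M] [Finite B] (P : OpenBookManifold O M) {Γ : B → ℂ → ℝ} {c : ℝ}
    (hc : c < 1 + O.width) (hΓ : ∀ i z, ‖z‖ < 1 + O.width → ContDiffAt ℝ ∞ (Γ i) z)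
    (h0 : ∀ i z, c < ‖z‖ → Γ i z = 0) :
    ∃ lam : OneForm M, IsSmoothForm lam ∧
      (∀ i x, ‖x.2‖ < 1 + O.width → pullForm lam (P.nbhd i) x = polarForm (Γ i) 0 x) ∧
      ∀ p, (∀ i x, ‖x.2‖ ≤ c → P.nbhd i x ≠ p) → lam p = 0 := by
  have hcw : ∀ z ∈ Metric.closedBall (0 : ℂ) c, ‖z‖ < 1 + O.width := by
    intro z hz
    have : ‖z‖ ≤ c := by simpa using hz
    linarith
  obtain ⟨lam, h1, h2, h3⟩ := exists_form_of_pullForm (M := M) finrank_real_prod_complex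
    (Ψ := P.nbhd) (U := fun _ => {x : ℝ × ℂ | ‖x.2‖ < 1 + O.width})
    (C := fun _ => univ ×ˢ Metric.closedBall (0 : ℂ) c)
    (ζ := fun i => polarForm (Γ i) 0)
    (fun _ => isOpen_tubeDomain _) (fun i x hx => P.immersiveAt_nbhd i hx)
    (fun i x hx => contDiffAt_polarForm (hΓ i _ hx) contDiffAt_const)
    (fun i x hx hxC => by
      have : c < ‖x.2‖ := by simpa using hxC
      refine ContinuousLinearMap.ext fun v => ?_
      rw [polarForm_apply, h0 i _ this]
      simp)
    (isClosed_iUnion_of_finite fun i =>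
      (P.isCompact_nbhd_image i (isCompact_closedBall _ _) hcw).isClosed)
    (fun i x hx => hcw _ hx.2)
    (by
      rintro i j ⟨θ, z⟩ hx ⟨θ', z'⟩ hy hxy a b hab
      obtain ⟨rfl, rfl, k, rfl⟩ := P.nbhd_eq_nbhd hx hy hxy
      have h4 := hab.trans (P.mfderiv_nbhd_add_zmul i k θ hx b)
      have h5 : a = b := (P.immersiveAt_nbhd i (x := (θ, z)) hx).injective h4
      rw [h5]
      rfl)
  refine ⟨lam, h1, h2, fun p hp => h3 p ?_⟩
  intro hm
  obtain ⟨i, x, hx, rfl⟩ := mem_iUnion.1 hm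
  exact hp i x (by simpa using hx.2) rfl

/-- The function `M → ℂ` whose argument is the angular coordinate of the open book. -/
theorem exists_angularFunction (P : OpenBookManifold O M) {Q : B → ℂ → ℝ}
    (hQ : ∀ i z, 1 ≤ ‖z‖ → Q i z = (‖z‖ ^ 2)⁻¹) :
    ∃ E : M → ℂ, (∀ x s, E (P.fiber (x, s)) = Complex.exp (s * Complex.I)) ∧
      ∀ i x, ‖x.2‖ < 1 + O.width → E (P.nbhd i x) = (Real.sqrt (Q i x.2) : ℝ) • x.2 := by
  have key : ∀ p : M, ∃ e : ℂ, (∀ x s, P.fiber (x, s) = p → e = Complex.exp (s * Complex.I)) ∧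
      ∀ i x, ‖x.2‖ < 1 + O.width → P.nbhd i x = p → e = (Real.sqrt (Q i x.2) : ℝ) • x.2 := by
    intro p
    rcases P.cover p with ⟨⟨x, s⟩, rfl⟩ | ⟨i, θ, z, hz, rfl⟩
    · refine ⟨Complex.exp (s * Complex.I), ?_, ?_⟩
      · intro y t h
        obtain ⟨k, rfl, -⟩ := P.fiber_eq h
        rw [Complex.exp_eq_exp_iff_exists_int]
        exact ⟨k, by push_cast; ring⟩
      · rintro i ⟨θ, z⟩ hz h
        obtain ⟨h1, h2, -⟩ := P.fiber_eq_nbhd hz h.symm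
        dsimp only at h1 h2 hz
        show _ = (Real.sqrt (Q i z) : ℝ) • z
        rw [hQ i z h1, Real.sqrt_inv, Real.sqrt_sq (norm_nonneg z)]
        have h3 : (‖z‖ : ℂ) ≠ 0 := by
          rw [Complex.ofReal_ne_zero]; linarith
        rw [Complex.real_smul, Complex.ofReal_inv, eq_inv_mul_iff_mul_eq₀ h3]
        exact h2.symm
    · refine ⟨(Real.sqrt (Q i z) : ℝ) • z, ?_, ?_⟩
      · intro y t h
        exact absurd h.symm (P.nbhd_ne_fiber i θ z hz _)
      · rintro j ⟨θ', z'⟩ hz' h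
        have : ‖z‖ < 1 := by simpa using hz
        obtain ⟨rfl, rfl, -⟩ := P.nbhd_eq_nbhd hz' (by linarith [O.width_pos]) h
        rfl
  choose E h1 h2 using key
  exact ⟨E, fun x s => h1 _ x s rfl, fun i x hx => h2 _ i x hx rfl⟩

/-- The form `Im (Ē dE)`. -/
def angularForm (E : M → ℂ) : OneForm M := fun p =>
  (angular (E p)).comp (mfderiv (𝓡 3) 𝓘(ℝ, ℂ) E p)

theorem pullForm_angularForm {E : M → ℂ} {Ψ : ℝ × ℂ → M} {x : ℝ × ℂ}
    (hE : MDifferentiableAt (𝓡 3) 𝓘(ℝ, ℂ) E (Ψ x))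
    (hΨ : MDifferentiableAt 𝓘(ℝ, ℝ × ℂ) (𝓡 3) Ψ x) :
    pullForm (angularForm E) Ψ x = (angular (E (Ψ x))).comp (fderiv ℝ (E ∘ Ψ) x) := by
  have h := mfderiv_comp x hE hΨ
  rw [mfderiv_eq_fderiv] at h
  rw [h]
  rfl

theorem pullForm_angularForm_eventually {E : M → ℂ} {Ψ : ℝ × ℂ → M} {x : ℝ × ℂ}
    (hΨ : ImmersiveAt Ψ x) (hE : ContDiffAt ℝ ∞ (E ∘ Ψ) x) :
    pullForm (angularForm E) Ψ =ᶠ[𝓝 x]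
      fun y => (angular ((E ∘ Ψ) y)).comp (fderiv ℝ (E ∘ Ψ) y) := by
  have h1 := hΨ.contMDiffAt_of_comp finrank_real_prod_complex hE
  have h2 : ∀ᶠ p in 𝓝 (Ψ x), ContMDiffAt (𝓡 3) 𝓘(ℝ, ℂ) 1 E p :=
    (contMDiffAt_iff_contMDiffAt_nhds (by simp)).1 (h1.of_le (by exact_mod_cast le_top))
  have h3 : ∀ᶠ y in 𝓝 x, ContMDiffAt 𝓘(ℝ, ℝ × ℂ) (𝓡 3) 1 Ψ y :=
    (contMDiffAt_iff_contMDiffAt_nhds (by simp)).1 (hΨ.smooth.of_le (by exact_mod_cast le_top))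
  filter_upwards [(hΨ.eventually finrank_real_prod_complex).1 h2, h3] with y hy hy'
  exact pullForm_angularForm (hy.mdifferentiableAt (by simp)) (hy'.mdifferentiableAt (by simp))

/-- The form `dφ`, extended over the binding by the given coefficients. -/
theorem exists_angularForm [T2Space M] [Finite B] (P : OpenBookManifold O M) {Q : B → ℂ → ℝ} {ρ : ℝ} (hρ1 : ρ < 1)
    (hQ : ∀ i z, ρ ≤ ‖z‖ → Q i z = (‖z‖ ^ 2)⁻¹) (hQ0 : ∀ i z, ‖z‖ < 1 + O.width → 0 < Q i z)
    (hQs : ∀ i z, ‖z‖ < 1 + O.width → ContDiffAt ℝ ∞ (Q i) z) :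
    ∃ α : OneForm M, IsSmoothForm α ∧
      (∀ i x, ‖x.2‖ < 1 + O.width → pullForm α (P.nbhd i) x = polarForm 0 (Q i) x) ∧
      (∀ x s (v : EuclideanSpace ℝ (Fin 2) × ℝ), α (P.fiber (x, s))
        (mfderiv ((𝓡∂ 2).prod 𝓘(ℝ, ℝ)) (𝓡 3) P.fiber (x, s) v) = v.2) ∧
      ∀ p, (∀ i x, ‖x.2‖ ≤ ρ → P.nbhd i x ≠ p) → ∀ u v, dForm α p u v = 0 := by
  -- Since the angle is multivalued, `dφ` is written as `Im(Ē dE)`. With `E = √Q z` near the binding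
  -- this equals `Q Im(z̄ dz)`, since differentiating the real factor `√Q` contributes only to the
  -- real part of `Ē dE`.
  obtain ⟨E, hE1, hE2⟩ := P.exists_angularFunction (Q := Q) fun i z hz => hQ i z (by linarith)
  have hEn : ∀ i x, ‖x.2‖ < 1 + O.width → ContDiffAt ℝ ∞ (E ∘ P.nbhd i) x := by
    intro i x hx
    have h1 : ContDiffAt ℝ ∞ (fun x : ℝ × ℂ => (Real.sqrt (Q i x.2) : ℝ) • x.2) x :=
      ((((hQs i x.2 hx).comp x contDiffAt_snd).sqrt (hQ0 i x.2 hx).ne')).smul contDiffAt_snd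
    refine h1.congr_of_eventuallyEq ?_
    filter_upwards [(isOpen_tubeDomain _).mem_nhds hx] with y hy using hE2 i y hy
  have hsm : ∀ p, ∃ (Ψ : ℝ × ℂ → M) (x : ℝ × ℂ), Ψ x = p ∧ ImmersiveAt Ψ x ∧
      ContDiffAt ℝ ∞ (E ∘ Ψ) x := by
    intro p
    rcases P.mem_nbhd_or_interior p with ⟨i, x, hx, h⟩ | ⟨x, s, hint, h⟩
    · exact ⟨P.nbhd i, x, h, P.immersiveAt_nbhd i hx, hEn i x hx⟩
    · obtain ⟨a, b, h1, h2⟩ := P.exists_pageChart_fiberChart hint s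
      refine ⟨_, _, h1.trans h, h2.self_of_nhds.immersive, ?_⟩
      have h3 : E ∘ P.fiberChart x (extChartAt (𝓡∂ 2) x x) a b =
          fun y : ℝ × ℂ => Complex.exp (y.1 * Complex.I) := by
        ext y
        exact hE1 _ _
      rw [h3]
      have : ContDiff ℝ ∞ fun y : ℝ × ℂ => (y.1 : ℂ) :=
        Complex.ofRealCLM.contDiff.comp contDiff_fst
      exact (this.mul contDiff_const).cexp.contDiffAt
  have hEs : ∀ p, ContMDiffAt (𝓡 3) 𝓘(ℝ, ℂ) ∞ E p := by
    intro p
    obtain ⟨Ψ, x, rfl, h1, h2⟩ := hsm p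
    exact h1.contMDiffAt_of_comp finrank_real_prod_complex h2
  have hEd : ∀ p, MDifferentiableAt (𝓡 3) 𝓘(ℝ, ℂ) E p := fun p =>
    (hEs p).mdifferentiableAt (by simp)
  have hα : IsSmoothForm (angularForm E) := by
    refine isSmoothForm_of_forall fun p p₀ hp => ?_
    obtain ⟨Ψ, x, rfl, h1, h2⟩ := hsm p
    refine h1.contDiffAt_localForm finrank_real_prod_complex ?_ hp
    refine ContDiffAt.congr_of_eventuallyEq ?_ (pullForm_angularForm_eventually h1 h2)
    exact (angular.contDiff.contDiffAt.comp x h2).clm_comp (h2.fderiv_right (by simp))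
  refine ⟨angularForm E, hα, ?_, ?_, ?_⟩
  · intro i x hx
    rw [pullForm_angularForm (hEd _) (P.immersiveAt_nbhd i hx).mdifferentiableAt]
    have hq : DifferentiableAt ℝ (fun x : ℝ × ℂ => Real.sqrt (Q i x.2)) x :=
      (((hQs i x.2 hx).comp x contDiffAt_snd).sqrt (hQ0 i x.2 hx).ne').differentiableAt (by simp)
    have h1 := hq.hasFDerivAt.smul (hasFDerivAt_snd (𝕜 := ℝ) (p := x) (E := ℝ) (F := ℂ))
    have h2 : E ∘ P.nbhd i =ᶠ[𝓝 x] fun x : ℝ × ℂ => (Real.sqrt (Q i x.2) : ℝ) • x.2 := by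
      filter_upwards [(isOpen_tubeDomain _).mem_nhds hx] with y hy using hE2 i y hy
    rw [(h2.hasFDerivAt_iff.2 h1).fderiv, hE2 i x hx]
    ext v
    · simp [polarForm_apply, angular_apply]
      ring
    · simp [polarForm_apply, angular_apply]
      have h3 := Real.mul_self_sqrt (hQ0 i x.2 hx).le
      linear_combination (x.2.re * v.im - x.2.im * v.re) * h3
  · intro x s v
    have h1 := mfderiv_comp (x, s) (hEd (P.fiber (x, s))) (P.mdifferentiableAt_fiber (x, s))
    have h2 : E ∘ P.fiber = (fun s : ℝ => Complex.exp (s * Complex.I)) ∘ Prod.snd := by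
      ext ⟨y, t⟩
      exact hE1 y t
    have h3 : HasDerivAt (fun s : ℝ => Complex.exp (s * Complex.I))
        (Complex.exp (s * Complex.I) * Complex.I) s := by
      have h4 : HasDerivAt (fun s : ℂ => Complex.exp (s * Complex.I))
          (Complex.exp (s * Complex.I) * Complex.I) (s : ℂ) := by
        simpa using ((hasDerivAt_id (s : ℂ)).mul_const Complex.I).cexp
      exact h4.comp_ofReal
    have h5 := HasMFDerivAt.comp ((x, s) : W × ℝ) h3.hasFDerivAt.hasMFDerivAt
      (hasMFDerivAt_snd (I := 𝓡∂ 2) (I' := 𝓘(ℝ, ℝ)) (x, s))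
    rw [h2, h5.mfderiv] at h1
    have h6 := congrArg (fun L : EuclideanSpace ℝ (Fin 2) × ℝ →L[ℝ] ℂ => L v) h1
    have h7 : (mfderiv (𝓡 3) 𝓘(ℝ, ℂ) E (P.fiber (x, s)) : EuclideanSpace ℝ (Fin 3) →L[ℝ] ℂ)
        (mfderiv ((𝓡∂ 2).prod 𝓘(ℝ, ℝ)) (𝓡 3) P.fiber (x, s) v) =
        v.2 • (Complex.exp (s * Complex.I) * Complex.I) := h6.symm
    show angular (E (P.fiber (x, s))) _ = _
    refine (congrArg _ h7).trans ?_
    rw [hE1, map_smul, angular_apply, smul_eq_mul]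
    have h8 : (Complex.exp (s * Complex.I)).re = Real.cos s := Complex.exp_ofReal_mul_I_re s
    have h9 : (Complex.exp (s * Complex.I)).im = Real.sin s := Complex.exp_ofReal_mul_I_im s
    simp only [Complex.mul_re, Complex.mul_im, Complex.I_re, Complex.I_im, h8, h9]
    have := Real.sin_sq_add_cos_sq s
    linear_combination v.2 * this
  · have hcl : IsClosed (⋃ i, P.nbhd i '' (univ ×ˢ Metric.closedBall (0 : ℂ) ρ)) :=
      isClosed_iUnion_of_finite fun i =>
        (P.isCompact_nbhd_image i (isCompact_closedBall _ _) fun z hz => by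
          have : ‖z‖ ≤ ρ := by simpa using hz
          linarith [O.width_pos]).isClosed
    intro p hp u v
    -- Off the closed tube of radius `ρ` one has `Q = |z|⁻²`, so `|E| = 1` there and
    -- `dAt_angular_eq_zero` gives closedness.
    have hn : ∀ q, q ∉ (⋃ i, P.nbhd i '' (univ ×ˢ Metric.closedBall (0 : ℂ) ρ)) → ‖E q‖ = 1 := by
      intro q hq
      rcases P.cover q with ⟨⟨y, s⟩, rfl⟩ | ⟨i, θ, z, hz, rfl⟩
      · rw [hE1, Complex.norm_exp_ofReal_mul_I]
      · have h1 : ρ < ‖z‖ := by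
          by_contra h
          exact hq (mem_iUnion.2 ⟨i, (θ, z), ⟨mem_univ _, by simpa using h⟩, rfl⟩)
        have h2 : ‖z‖ < 1 := by simpa using hz
        have h3 : ‖z‖ < 1 + O.width := by linarith [O.width_pos]
        have h4 : 0 < ‖z‖ := by
          rcases (norm_nonneg z).eq_or_lt with h | h
          · have h5 := hQ0 i z h3
            rw [hQ i z h1.le, ← h] at h5
            simp at h5
          · exact h
        rw [hE2 i (θ, z) h3, norm_smul, hQ i z h1.le, Real.sqrt_inv, Real.sqrt_sq (norm_nonneg z),
          norm_inv, norm_norm, inv_mul_cancel₀ h4.ne']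
    obtain ⟨Ψ, x, rfl, h1, h2⟩ := hsm p
    obtain ⟨(a : ℝ × ℂ), rfl⟩ := h1.surjective finrank_real_prod_complex u
    obtain ⟨(b : ℝ × ℂ), rfl⟩ := h1.surjective finrank_real_prod_complex v
    refine (dForm_mfderiv hα h1.smooth a b).trans ?_
    rw [dAt_congr (pullForm_angularForm_eventually h1 h2)]
    refine dAt_angular_eq_zero (h2.of_le ENat.LEInfty.out) ?_ a b
    refine (h1.eventually finrank_real_prod_complex (q := fun p => ‖E p‖ = 1)).1 ?_
    have h3 : Ψ x ∉ (⋃ i, P.nbhd i '' (univ ×ˢ Metric.closedBall (0 : ℂ) ρ)) := by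
      intro h
      obtain ⟨i, y, hy, h⟩ := mem_iUnion.1 h
      exact hp i y (by simpa using hy.2) h
    filter_upwards [hcl.isOpen_compl.mem_nhds h3] with q hq using hn q hq

end OpenBookManifold

/-! ### Radial functions and local models -/

section Radial

theorem hasDerivAt_smul_self {f : ℂ → ℝ} {z : ℂ} (hf : DifferentiableAt ℝ f z) :
    HasDerivAt (fun s : ℝ => f (s • z)) (fderiv ℝ f z z) 1 := by
  have h1 : HasDerivAt (fun s : ℝ => s • z) z 1 := by
    simpa using (hasDerivAt_id (1 : ℝ)).smul_const z
  have h2 : HasFDerivAt f (fderiv ℝ f z) ((1 : ℝ) • z) := by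
    rw [one_smul]; exact hf.hasFDerivAt
  exact h2.comp_hasDerivAt (1 : ℝ) h1

/-- Monotonicity along the outward ray only is needed: the difference quotients at `s > 1` have the
right sign. -/
theorem fderiv_apply_self_nonpos {f : ℂ → ℝ} {z : ℂ} (hf : DifferentiableAt ℝ f z)
    (h : ∀ s : ℝ, 1 ≤ s → f (s • z) ≤ f z) : fderiv ℝ f z z ≤ 0 := by
  have h1 := (hasDerivAt_smul_self hf).hasDerivWithinAt (s := Ici 1)
  have h2 := hasDerivWithinAt_iff_tendsto_slope.1 h1
  have h3 : (𝓝[Ici (1 : ℝ) \ {1}] 1).NeBot := by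
    rw [Ici_sdiff_left]; infer_instance
  refine le_of_tendsto h2 ?_
  filter_upwards [self_mem_nhdsWithin] with s hs
  have h4 : (1 : ℝ) < s := lt_of_le_of_ne hs.1 fun h => hs.2 h.symm
  rw [slope_def_field, one_smul]
  exact div_nonpos_of_nonpos_of_nonneg (by linarith [h s hs.1]) (by linarith)

theorem fderiv_apply_self_rotate {f : ℂ → ℝ} {z u : ℂ}
    (hf : DifferentiableAt ℝ f (u * z)) (hr : ∀ᶠ w in 𝓝 z, f (u * w) = f w) :
    fderiv ℝ f (u * z) (u * z) = fderiv ℝ f z z := by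
  have h1 : HasFDerivAt (fun w : ℂ => u * w) (u • ContinuousLinearMap.id ℝ ℂ) z := by
    simpa using (hasFDerivAt_id (𝕜 := ℝ) z).const_mul u
  have h2 : HasFDerivAt (fun w => f (u * w)) _ z := hf.hasFDerivAt.comp z h1
  have h3 := (EventuallyEq.hasFDerivAt_iff (f₀ := fun w => f (u * w)) hr).1 h2
  rw [h3.fderiv]
  simp

/-- With `f = Q` this gives `r (Qr²)' = r² (2Q + rQ')`, the combination appearing in `λ ∧ dλ`. -/
theorem fderiv_apply_self_norm_sq_mul {f : ℂ → ℝ} {z : ℂ} (hf : DifferentiableAt ℝ f z) :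
    fderiv ℝ (fun w => ‖w‖ ^ 2 * f w) z z = ‖z‖ ^ 2 * (2 * f z + fderiv ℝ f z z) := by
  have h1 : HasDerivAt (fun s : ℝ => ‖s • z‖ ^ 2 * f (s • z))
      (2 * ‖z‖ ^ 2 * f z + ‖z‖ ^ 2 * fderiv ℝ f z z) 1 := by
    have h2 : HasDerivAt (fun s : ℝ => s ^ 2 * ‖z‖ ^ 2) (2 * ‖z‖ ^ 2) 1 := by
      simpa using ((hasDerivAt_id (1 : ℝ)).pow 2).mul_const (‖z‖ ^ 2)
    have h3 := h2.mul (hasDerivAt_smul_self hf)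
    simp only [one_smul, one_pow, one_mul] at h3
    refine h3.congr_of_eventuallyEq (Eventually.of_forall fun s => ?_)
    simp [mul_pow]
  have h4 : DifferentiableAt ℝ (fun w : ℂ => ‖w‖ ^ 2 * f w) z :=
    ((contDiff_norm_sq ℝ (n := 1)).differentiable (by simp) z).mul hf
  rw [(hasDerivAt_smul_self h4).unique h1]
  ring

/-- A smooth radial function on `ℂ` which is `1` for `|z| ≤ a`, `0` for `|z| ≥ c`, and does not
increase with `|z|`. -/
def radialCut (a c : ℝ) (z : ℂ) : ℝ :=
  1 - Real.smoothTransition ((‖z‖ ^ 2 - a ^ 2) / (c ^ 2 - a ^ 2))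

variable {a c : ℝ}

theorem contDiff_radialCut (a c : ℝ) : ContDiff ℝ ∞ (radialCut a c) := by
  refine contDiff_const.sub (Real.smoothTransition.contDiff.comp ?_)
  exact ((contDiff_norm_sq ℝ).sub contDiff_const).div_const _

theorem radialCut_nonneg (z : ℂ) : 0 ≤ radialCut a c z :=
  sub_nonneg.2 (Real.smoothTransition.le_one _)

theorem radialCut_le_one (z : ℂ) : radialCut a c z ≤ 1 :=
  sub_le_self _ (Real.smoothTransition.nonneg _)

theorem radialCut_eq_one (ha : 0 ≤ a) (hac : a < c) {z : ℂ} (hz : ‖z‖ ≤ a) :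
    radialCut a c z = 1 := by
  rw [radialCut, Real.smoothTransition.zero_of_nonpos, sub_zero]
  have := norm_nonneg z
  exact div_nonpos_of_nonpos_of_nonneg (by nlinarith) (by nlinarith)

theorem radialCut_eq_zero (ha : 0 ≤ a) (hac : a < c) {z : ℂ} (hz : c ≤ ‖z‖) :
    radialCut a c z = 0 := by
  rw [radialCut, Real.smoothTransition.one_of_one_le, sub_self]
  have := norm_nonneg z
  rw [one_le_div (by nlinarith)]
  nlinarith

theorem radialCut_smul_le (ha : 0 ≤ a) (hac : a < c) (z : ℂ) {s : ℝ} (hs : 1 ≤ s) :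
    radialCut a c (s • z) ≤ radialCut a c z := by
  refine sub_le_sub_left (Real.smoothTransition.monotone ?_) _
  have : 0 < c ^ 2 - a ^ 2 := by nlinarith
  gcongr
  rw [norm_smul, Real.norm_of_nonneg (by linarith)]
  nlinarith [norm_nonneg z]

theorem fderiv_radialCut_nonpos (ha : 0 ≤ a) (hac : a < c) (z : ℂ) :
    fderiv ℝ (radialCut a c) z z ≤ 0 :=
  fderiv_apply_self_nonpos ((contDiff_radialCut a c).differentiable (by simp) z)
    fun _ hs => radialCut_smul_le ha hac z hs

end Radial

/-! ### Local models at the centre of the disk -/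

section LocalModel

/-- The radial derivative of a function of `|z|`. -/
theorem fderiv_norm_apply_self {γ : ℝ → ℝ} {R : ℝ} (h : ContDiffOn ℝ ∞ γ (Ici 0))
    (hd : ContDiffOn ℝ ∞ (fun z : ℂ => γ ‖z‖) (Metric.ball 0 R)) {z : ℂ} (hz : z ≠ 0)
    (hz1 : ‖z‖ < R) :
    fderiv ℝ (fun z : ℂ => γ ‖z‖) z z = ‖z‖ * derivWithin γ (Ici 0) ‖z‖ := by
  have hz0 : 0 < ‖z‖ := norm_pos_iff.2 hz
  have h1 : DifferentiableAt ℝ γ ‖z‖ :=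
    (h.contDiffAt (Ici_mem_nhds hz0)).differentiableAt (by simp)
  have h2 : DifferentiableAt ℝ (fun z : ℂ => γ ‖z‖) z :=
    (hd.contDiffAt (Metric.isOpen_ball.mem_nhds (by simpa using hz1))).differentiableAt (by simp)
  have h3 : HasDerivAt (fun s : ℝ => s * ‖z‖) ‖z‖ 1 := by
    simpa using (hasDerivAt_id (1 : ℝ)).mul_const ‖z‖
  have h4 : HasDerivAt γ (deriv γ ‖z‖) (1 * ‖z‖) := by rw [one_mul]; exact h1.hasDerivAt
  have h5 := h4.comp (1 : ℝ) h3
  rw [derivWithin_of_mem_nhds (Ici_mem_nhds hz0), mul_comm]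
  refine (hasDerivAt_smul_self h2).unique (h5.congr_of_eventuallyEq ?_)
  filter_upwards [lt_mem_nhds (show (0 : ℝ) < 1 by norm_num)] with s hs
  simp [abs_of_pos hs]

/-- Smoothness on the disk makes the even function `s ↦ γ |s|` differentiable at `0`, so its
derivative there vanishes. -/
theorem derivWithin_eq_zero_of_norm {γ : ℝ → ℝ} {R : ℝ} (hR : 0 < R)
    (hd : ContDiffOn ℝ ∞ (fun z : ℂ => γ ‖z‖) (Metric.ball 0 R)) :
    derivWithin γ (Ici 0) 0 = 0 := by
  have h2 : DifferentiableAt ℝ (fun z : ℂ => γ ‖z‖) ((0 : ℝ) : ℂ) :=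
    (hd.contDiffAt (Metric.isOpen_ball.mem_nhds (by simpa using hR))).differentiableAt (by simp)
  have h3 : DifferentiableAt ℝ (fun s : ℝ => γ |s|) 0 := by
    have := h2.comp (0 : ℝ) Complex.ofRealCLM.differentiableAt
    simpa [Function.comp_def] using this
  have h4 := h3.hasDerivAt
  have h5 : HasDerivAt (fun s : ℝ => γ |s|) (-deriv (fun s : ℝ => γ |s|) 0) 0 := by
    have h6 : HasDerivAt (fun s : ℝ => γ |s|) (deriv (fun s : ℝ => γ |s|) 0) (-(0 : ℝ)) := by
      simpa using h4
    have := h6.comp (0 : ℝ) (hasDerivAt_neg (0 : ℝ))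
    simpa [Function.comp_def] using this
  have h7 := h4.unique h5
  have h8 : HasDerivWithinAt γ 0 (Ici 0) 0 := by
    have h9 : deriv (fun s : ℝ => γ |s|) 0 = 0 := by linarith
    rw [h9] at h4
    refine h4.hasDerivWithinAt.congr (fun s hs => ?_) (by simp)
    rw [abs_of_nonneg hs]
  exact h8.derivWithin (uniqueDiffWithinAt_Ici 0)

/-- The quotient is `γ'(r) / r`, a difference quotient of `γ'` at `0` because `γ'(0) = 0`. -/
theorem tendsto_fderiv_norm_div {γ : ℝ → ℝ} {R : ℝ} (hR : 0 < R) (h : ContDiffOn ℝ ∞ γ (Ici 0))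
    (hd : ContDiffOn ℝ ∞ (fun z : ℂ => γ ‖z‖) (Metric.ball 0 R)) :
    Tendsto (fun z : ℂ => fderiv ℝ (fun z : ℂ => γ ‖z‖) z z / ‖z‖ ^ 2) (𝓝[≠] 0)
      (𝓝 (iteratedDerivWithin 2 γ (Ici 0) 0)) := by
  have hu : UniqueDiffOn ℝ (Ici (0 : ℝ)) := uniqueDiffOn_Ici 0
  have h1 : DifferentiableWithinAt ℝ (derivWithin γ (Ici 0)) (Ici 0) 0 :=
    ((h.derivWithin hu (m := 1) (by norm_cast)).differentiableOn (by simp)) 0 (by simp)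
  have h2 : iteratedDerivWithin 2 γ (Ici 0) 0 = derivWithin (derivWithin γ (Ici 0)) (Ici 0) 0 := by
    rw [iteratedDerivWithin_succ, iteratedDerivWithin_one]
  have h3 := hasDerivWithinAt_iff_tendsto_slope.1 h1.hasDerivWithinAt
  rw [← h2, Ici_sdiff_left] at h3
  have h4 : Tendsto (fun z : ℂ => ‖z‖) (𝓝[≠] 0) (𝓝[>] 0) := tendsto_norm_nhdsNE_zero
  refine (h3.comp h4).congr' ?_
  filter_upwards [self_mem_nhdsWithin, mem_nhdsWithin_of_mem_nhds (Metric.ball_mem_nhds 0 hR)]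
    with z hz hz1
  have hz0 : ‖z‖ ≠ 0 := norm_ne_zero_iff.2 hz
  rw [Function.comp_apply, slope_def_field, derivWithin_eq_zero_of_norm hR hd,
    fderiv_norm_apply_self h hd hz (by simpa using hz1)]
  field_simp
  ring

/-- The coefficient of `Im(z̄ dz)` in a local model, and its properties at the centre. -/
theorem IsLocalModel.exists_coefficient {γ₁ γ₂ : ℝ → ℝ} (h : IsLocalModel γ₁ γ₂) :
    ∃ G : ℂ → ℝ, (∀ z, ‖z‖ < 1 → ContDiffAt ℝ ∞ G z) ∧
      (∀ z, ‖z‖ < 1 → γ₂ ‖z‖ = ‖z‖ ^ 2 * G z) ∧ 0 < G 0 ∧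
      2 * G 0 = iteratedDerivWithin 2 γ₂ (Ici 0) 0 := by
  obtain ⟨G, hG, hγ⟩ := h.quotient
  have hGs : ∀ z, ‖z‖ < 1 → ContDiffAt ℝ ∞ G z := fun z hz =>
    hG.contDiffAt (Metric.isOpen_ball.mem_nhds (by simpa using hz))
  have h1 : ContinuousAt (fun z => 2 * G z + fderiv ℝ G z z) 0 := by
    have h2 := hGs 0 (by simp)
    refine (continuousAt_const.mul h2.continuousAt).add ?_
    exact ((h2.fderiv_right (m := 0) (by simp)).continuousAt).clm_apply continuousAt_id
  have h2 := tendsto_fderiv_norm_div one_pos h.smooth₂ h.disk₂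
  -- Both sides are the limit of `γ₂'(r) / r` at the centre, computed once from `γ₂` and once from
  -- `|z|² G`.
  have h3 : 2 * G 0 = iteratedDerivWithin 2 γ₂ (Ici 0) 0 := by
    have h4 : Tendsto (fun z => 2 * G z + fderiv ℝ G z z) (𝓝[≠] 0) (𝓝 (2 * G 0)) := by
      have := h1.tendsto
      simp only [map_zero, add_zero] at this
      exact this.mono_left nhdsWithin_le_nhds
    refine tendsto_nhds_unique (h4.congr' ?_) h2
    filter_upwards [self_mem_nhdsWithin, mem_nhdsWithin_of_mem_nhds
      (Metric.ball_mem_nhds (0 : ℂ) one_pos)] with z hz hz1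
    have hz0 : ‖z‖ ≠ 0 := norm_ne_zero_iff.2 hz
    have hz2 : ‖z‖ < 1 := by simpa using hz1
    have h5 : (fun z : ℂ => γ₂ ‖z‖) =ᶠ[𝓝 z] fun w => ‖w‖ ^ 2 * G w := by
      filter_upwards [Metric.isOpen_ball.mem_nhds hz1] with w hw using hγ w hw
    rw [h5.fderiv_eq, fderiv_apply_self_norm_sq_mul ((hGs z hz2).differentiableAt (by simp))]
    field_simp
  refine ⟨G, hGs, fun z hz => hγ z (by simpa using hz), ?_, h3⟩
  have := pos_of_mul_pos_right h.second_pos h.zero_pos.le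
  linarith

end LocalModel

/-! ### A form that is exact-positive on the pages -/

/-- A translate of the smooth step: the mean value theorem yields a point of `(0, 1)` where its
derivative is `1`, and this point is moved to the origin. -/
theorem exists_profile : ∃ S : ℝ → ℝ, ContDiff ℝ ∞ S ∧ Monotone S ∧ 0 < deriv S 0 ∧
    (∀ t, t ≤ -1 → S t = 0) ∧ ∀ t, 1 ≤ t → S t = 1 := by
  have hd : Differentiable ℝ Real.smoothTransition :=
    (Real.smoothTransition.contDiff (n := 1)).differentiable (by simp)
  obtain ⟨c, hc, h⟩ := exists_deriv_eq_slope Real.smoothTransition (zero_lt_one (α := ℝ))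
    Real.smoothTransition.continuous.continuousOn hd.differentiableOn
  rw [Real.smoothTransition.zero, Real.smoothTransition.one] at h
  refine ⟨fun t => Real.smoothTransition (c + t), Real.smoothTransition.contDiff.comp
    (contDiff_const.add contDiff_id), fun a b hab => Real.smoothTransition.monotone (by gcongr),
    ?_, fun t ht => Real.smoothTransition.zero_of_nonpos (by linarith [hc.2]),
    fun t ht => Real.smoothTransition.one_of_one_le (by linarith [hc.1])⟩
  rw [deriv_comp_const_add, add_zero, h]
  norm_num

/-- A function which decreases only near `0`, is constant near the complement of `[-κ, 1 + κ]`,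
and has positive derivative at `1`. -/
theorem exists_valley {κ : ℝ} (hκ : 0 < κ) (hκ1 : κ < 1) : ∃ v : ℝ → ℝ, ContDiff ℝ ∞ v ∧
    (∀ t, t ∉ Icc (-κ) (1 + κ) → v t = 0) ∧ (∀ t, t ∉ Icc (-κ) κ → 0 ≤ deriv v t) ∧
    0 < deriv v 1 := by
  obtain ⟨S, hS, hm, h0, hl, hr⟩ := exists_profile
  have hd : Differentiable ℝ S := hS.differentiable (by simp)
  have hder : ∀ t, HasDerivAt (fun t => S ((t - 1) / κ) - S (t / κ))
      (deriv S ((t - 1) / κ) * (1 / κ) - deriv S (t / κ) * (1 / κ)) t := by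
    intro t
    have h1 : HasDerivAt (fun t : ℝ => (t - 1) / κ) (1 / κ) t :=
      ((hasDerivAt_id t).sub_const 1).div_const κ
    have h2 : HasDerivAt (fun t : ℝ => t / κ) (1 / κ) t := (hasDerivAt_id t).div_const κ
    exact ((hd _).hasDerivAt.comp t h1).sub ((hd _).hasDerivAt.comp t h2)
  have hflat : ∀ t, 1 < |t| → deriv S t = 0 := by
    intro t ht
    rcases lt_abs.1 ht with h | h
    · have : S =ᶠ[𝓝 t] fun _ => 1 := by
        filter_upwards [lt_mem_nhds h] with s hs using hr s hs.le
      rw [this.deriv_eq, deriv_const]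
    · have : S =ᶠ[𝓝 t] fun _ => 0 := by
        filter_upwards [gt_mem_nhds (show t < -1 by linarith)] with s hs using hl s hs.le
      rw [this.deriv_eq, deriv_const]
  have hflat' : ∀ t, κ < |t| → deriv S (t / κ) = 0 := by
    intro t ht
    refine hflat _ ?_
    rwa [abs_div, abs_of_pos hκ, one_lt_div hκ]
  -- A step down at `0` followed by a step up at `1`, both of width `κ`.
  refine ⟨fun t => S ((t - 1) / κ) - S (t / κ), ?_, ?_, ?_, ?_⟩
  · exact (hS.comp ((contDiff_id.sub contDiff_const).div_const _)).sub
      (hS.comp (contDiff_id.div_const _))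
  · intro t ht
    rw [mem_Icc, not_and_or, not_le, not_le] at ht
    rcases ht with h | h
    · simp only
      rw [hl, hl, sub_self]
      · rw [div_le_iff₀ hκ]; linarith
      · rw [div_le_iff₀ hκ]; linarith
    · simp only
      rw [hr, hr, sub_self]
      · rw [le_div_iff₀ hκ]; linarith
      · rw [le_div_iff₀ hκ]; linarith
  · intro t ht
    rw [(hder t).deriv, hflat' t (by rwa [← not_le, abs_le])]
    have := hm.deriv_nonneg (x := (t - 1) / κ)
    simp only [zero_mul, sub_zero]
    exact mul_nonneg this (by positivity)
  · rw [(hder 1).deriv, hflat' 1 (by simpa using hκ1), sub_self, zero_div]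
    simp only [zero_mul, sub_zero]
    exact mul_pos h0 (by positivity)

/-- A bump function on `ℝ`. -/
theorem exists_bump (τ : ℝ) {κ : ℝ} (hκ : 0 < κ) : ∃ u : ℝ → ℝ, ContDiff ℝ ∞ u ∧ (∀ t, 0 ≤ u t) ∧
    0 < u τ ∧ ∀ t, t ∉ Icc (τ - κ) (τ + κ) → u t = 0 := by
  refine ⟨fun t => Real.smoothTransition (κ ^ 2 - (t - τ) ^ 2), Real.smoothTransition.contDiff.comp
    (contDiff_const.sub ((contDiff_id.sub contDiff_const).pow 2)),
    fun t => Real.smoothTransition.nonneg _, ?_, ?_⟩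
  · refine Real.smoothTransition.pos_of_pos ?_
    simpa using pow_pos hκ 2
  · intro t ht
    refine Real.smoothTransition.zero_of_nonpos ?_
    rw [mem_Icc, not_and_or, not_le, not_le] at ht
    rcases ht with h | h <;> nlinarith

/-- The form `w(t) v(Re z) u(Im z) d(Im z)` in the coordinates `(t, z)`. -/
def boxForm (w v u : ℝ → ℝ) (x : ℝ × ℂ) : ℝ × ℂ →L[ℝ] ℝ :=
  (w x.1 * v x.2.re * u x.2.im) • Complex.imCLM.comp (ContinuousLinearMap.snd ℝ ℝ ℂ)

theorem contDiff_boxForm {w v u : ℝ → ℝ} (hw : ContDiff ℝ ∞ w) (hv : ContDiff ℝ ∞ v)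
    (hu : ContDiff ℝ ∞ u) : ContDiff ℝ ∞ (boxForm w v u) :=
  (((hw.comp contDiff_fst).mul (hv.comp (Complex.reCLM.contDiff.comp contDiff_snd))).mul
    (hu.comp (Complex.imCLM.contDiff.comp contDiff_snd))).smul contDiff_const

/-- Only `v` is differentiated: `t` is constant on the pages, so localizing in `t` by `w` costs
nothing, and `u` multiplies its own differential. -/
theorem dAt_boxForm {w v u : ℝ → ℝ} (hw : ContDiff ℝ ∞ w) (hv : ContDiff ℝ ∞ v)
    (hu : ContDiff ℝ ∞ u) (x : ℝ × ℂ) :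
    dAt (boxForm w v u) x (0, 1) (0, Complex.I) = w x.1 * deriv v x.2.re * u x.2.im := by
  have h1 : HasFDerivAt (fun x : ℝ × ℂ => w x.1)
      (deriv w x.1 • ContinuousLinearMap.fst ℝ ℝ ℂ) x :=
    (hw.differentiable (by simp) _).hasDerivAt.comp_hasFDerivAt x hasFDerivAt_fst
  have h2 : HasFDerivAt (fun x : ℝ × ℂ => v x.2.re)
      (deriv v x.2.re • Complex.reCLM.comp (ContinuousLinearMap.snd ℝ ℝ ℂ)) x :=
    (hv.differentiable (by simp) _).hasDerivAt.comp_hasFDerivAt x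
      (Complex.reCLM.comp (ContinuousLinearMap.snd ℝ ℝ ℂ)).hasFDerivAt
  have h3 : HasFDerivAt (fun x : ℝ × ℂ => u x.2.im)
      (deriv u x.2.im • Complex.imCLM.comp (ContinuousLinearMap.snd ℝ ℝ ℂ)) x :=
    (hu.differentiable (by simp) _).hasDerivAt.comp_hasFDerivAt x
      (Complex.imCLM.comp (ContinuousLinearMap.snd ℝ ℝ ℂ)).hasFDerivAt
  have h4 : fderiv ℝ (boxForm w v u) x = _ := (((h1.mul h2).mul h3).smul_const
    (Complex.imCLM.comp (ContinuousLinearMap.snd ℝ ℝ ℂ))).fderiv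
  unfold dAt
  rw [h4]
  simp
  ring

/-- The box `|t - τ| ≤ κ`, `-κ ≤ Re z ≤ 1 + κ`, `|Im z| ≤ κ`. -/
def box (τ κ : ℝ) : Set (ℝ × ℂ) :=
  Icc (τ - κ) (τ + κ) ×ˢ (Icc (-κ) (1 + κ) ×ℂ Icc (-κ) κ)

theorem isCompact_box (τ κ : ℝ) : IsCompact (box τ κ) :=
  isCompact_Icc.prod (isCompact_Icc.reProdIm isCompact_Icc)

theorem exists_box_subset {N : Set ℂ} (hN : IsOpen N) (hc : Convex ℝ N) (h0 : 0 ∈ N) (h1 : 1 ∈ N) :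
    ∃ κ₀ > 0, ∀ κ, 0 < κ → κ ≤ κ₀ → Icc (-κ) (1 + κ) ×ℂ Icc (-κ) κ ⊆ N := by
  obtain ⟨ε, hε, h⟩ := Metric.isOpen_iff.1 hN 0 h0
  obtain ⟨ε', hε', h'⟩ := Metric.isOpen_iff.1 hN 1 h1
  have hm : 0 < min ε ε' := lt_min hε hε'
  refine ⟨min ε ε' / 3, by positivity, fun κ hκ hκ1 z hz => ?_⟩
  obtain ⟨⟨h1, h2⟩, h3, h4⟩ := hz
  -- `t` is the point of `[0, 1]` nearest to `z`. Then `z` is the convex combination, with weights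
  -- `1 - t` and `t`, of `z - t` near `0` and `1 + (z - t)` near `1`.
  set t : ℝ := max 0 (min z.re 1) with ht
  have ht0 : 0 ≤ t := le_max_left _ _
  have ht1 : t ≤ 1 := max_le zero_le_one (min_le_right _ _)
  have hd : ‖z - t‖ < min ε ε' := by
    refine (Complex.norm_le_abs_re_add_abs_im _).trans_lt ?_
    have h5 : |(z - t).re| ≤ κ := by
      rw [Complex.sub_re, Complex.ofReal_re, abs_le, ht]
      rcases le_total z.re 0 with h | h
      · rw [min_eq_left (by linarith), max_eq_left h]
        constructor <;> linarith
      · rcases le_total z.re 1 with h' | h'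
        · rw [min_eq_left h', max_eq_right h]
          constructor <;> linarith
        · rw [min_eq_right h', max_eq_right zero_le_one]
          constructor <;> linarith
    have h6 : |(z - t).im| ≤ κ := by
      rw [Complex.sub_im, Complex.ofReal_im, sub_zero, abs_le]
      exact ⟨h3, h4⟩
    linarith
  have ha : z - t ∈ N := h (by simpa using hd.trans_le (min_le_left _ _))
  have hb : 1 + (z - t) ∈ N := h' (by
    rw [Metric.mem_ball, dist_eq_norm, add_sub_cancel_left]
    exact hd.trans_le (min_le_right _ _))
  have := hc ha hb (sub_nonneg.2 ht1) ht0 (by ring)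
  convert this using 1
  apply Complex.ext <;> simp <;> ring

/-! ### Forms adapted to a tube, and one that is positive near `∂W` -/

namespace OpenBookManifold

variable {W : Type*} [TopologicalSpace W] [ChartedSpace (EuclideanHalfSpace 2) W]
  [IsManifold (𝓡∂ 2) ∞ W]
  {B : Type*} {O : AbstractOpenBook W B} {M : Type*} [TopologicalSpace M]
  [ChartedSpace (EuclideanSpace ℝ (Fin 3)) M] [IsManifold (𝓡 3) ∞ M]

theorem continuousAt_dAt {β : OneForm M} (hβ : IsSmoothForm β) {Ψ : ℝ × ℂ → M} {x : ℝ × ℂ}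
    (hΨ : ContMDiffAt 𝓘(ℝ, ℝ × ℂ) (𝓡 3) ∞ Ψ x) {e₁ e₂ : ℝ × ℂ → ℝ × ℂ} (h₁ : Continuous e₁)
    (h₂ : Continuous e₂) : ContinuousAt (fun y => dAt (pullForm β Ψ) y (e₁ y) (e₂ y)) x := by
  have h := ((hβ.contDiffAt_pullForm hΨ).fderiv_right (m := 0) (by simp)).continuousAt
  exact ((h.clm_apply h₁.continuousAt).clm_apply h₂.continuousAt).sub
    ((h.clm_apply h₂.continuousAt).clm_apply h₁.continuousAt)

/-- Positivity on the pages is an open condition away from the binding, where the pages form a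
continuous plane field. -/
theorem PagePos.eventually {P : OpenBookManifold O M} {β : OneForm M} (hβ : IsSmoothForm β) {p : M}
    (h : P.PagePos β p) (hp : ∀ i, p ∉ P.bindingComponent i) : ∀ᶠ q in 𝓝 p, P.PagePos β q := by
  obtain ⟨Ψ, e₁, e₂, x, h₁, h₂, rfl, hx⟩ := P.exists_pageChart hp
  have hx0 := hx.self_of_nhds
  rw [hx0.immersive.eventually finrank_real_prod_complex]
  have h3 := (continuousAt_dAt hβ hx0.immersive.smooth h₁ h₂).eventually
    (lt_mem_nhds ((hx0.pagePos_iff hβ).1 h))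
  filter_upwards [hx, h3] with y hy hy' using (hy.pagePos_iff hβ).2 hy'

theorem fiber_not_mem_tube (P : OpenBookManifold O M) {ρ : ℝ} (hρ : ρ < 1) (x : W × ℝ) :
    P.fiber x ∉ P.tube ρ := by
  rintro ⟨i, θ, z, hz, h⟩
  exact P.nbhd_ne_fiber i θ z (by simpa using hz.trans hρ) x h

theorem fiber_not_mem_bindingComponent (P : OpenBookManifold O M) (x : W × ℝ) (i : B) :
    P.fiber x ∉ P.bindingComponent i := by
  rintro ⟨θ, h⟩
  exact P.nbhd_ne_fiber i θ 0 (by simp) x h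

theorem nbhd_mem_tube_iff (P : OpenBookManifold O M) {i : B} {x : ℝ × ℂ} {ρ : ℝ} (hρ : ρ < 1)
    (hx : ‖x.2‖ < 1 + O.width) : P.nbhd i x ∈ P.tube ρ ↔ ‖x.2‖ < ρ := by
  constructor
  · rintro ⟨j, θ, z, hz, h⟩
    obtain ⟨-, h2, -⟩ := P.nbhd_eq_nbhd (θ' := x.1) (z' := x.2) (by linarith [O.width_pos]) hx h
    rwa [← h2]
  · exact fun h => ⟨i, x.1, x.2, h, rfl⟩

/-- Forms which vanish on `tube a` and whose derivative is nonnegative on the pages off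
`tube c`. -/
structure TubeAdapted (P : OpenBookManifold O M) (a c : ℝ) (β : OneForm M) : Prop where
  smooth : IsSmoothForm β
  zero : ∀ p ∈ P.tube a, β p = 0
  nonneg : ∀ p, p ∉ P.tube c → P.PageNonneg β p

theorem TubeAdapted.add_smul {P : OpenBookManifold O M} {a c : ℝ} {β β' : OneForm M}
    (h : P.TubeAdapted a c β) (h' : P.TubeAdapted a c β') {s : ℝ} (hs : 0 ≤ s) :
    P.TubeAdapted a c (β + s • β') where
  smooth := h.smooth.add_smul h'.smooth s
  zero p hp := by
    show β p + s • β' p = 0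
    rw [h.zero p hp, h'.zero p hp, smul_zero, add_zero]
  nonneg p hp u v huv := by
    rw [dForm_add_smul h.smooth h'.smooth]
    exact add_nonneg (h.nonneg p hp u v huv) (mul_nonneg hs (h'.nonneg p hp u v huv))

/-- The seed of positivity is `V dθ`, with `V = 0` for `r ≤ a`. Beyond `b` the profile is `(1 +
width)² - r²` times a decreasing cutoff, so it does not increase; it strictly decreases past `r =
1`, hence also on the boundary of the mapping torus. Taking `b < c` makes this formula valid around
`r = c`. -/
theorem exists_tubeAdapted_tube [T2Space M] [Finite B] (P : OpenBookManifold O M) {a c : ℝ}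
    (ha : 0 ≤ a) (hac : a < c) (hc : c < 1) :
    ∃ β : OneForm M, P.TubeAdapted a c β ∧ ∀ i x, c ≤ ‖x.2‖ → ‖x.2‖ ≤ 1 →
      P.PagePos β (P.nbhd i x) := by
  have hw := O.width_pos
  set b := (a + c) / 2 with hb
  have hab : a < b := by rw [hb]; linarith
  have hbc : b < c := by rw [hb]; linarith
  set V : ℂ → ℝ := fun z => (1 - radialCut a b z) * ((1 + O.width) ^ 2 - ‖z‖ ^ 2) *
    radialCut (1 + O.width / 4) (1 + O.width / 2) z with hV
  have hVs : ContDiff ℝ ∞ V := ((contDiff_const.sub (contDiff_radialCut a b)).mul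
    (contDiff_const.sub (contDiff_norm_sq ℝ))).mul (contDiff_radialCut _ _)
  have hVd : ∀ z, DifferentiableAt ℝ V z := fun z => hVs.differentiable (by simp) z
  have hw0 : (0 : ℝ) ≤ 1 + O.width / 4 := by linarith
  have hw1 : 1 + O.width / 4 < 1 + O.width / 2 := by linarith
  obtain ⟨β, h1, h2, h3⟩ := P.exists_tubeForm (Γ := fun _ => V) (c := 1 + O.width / 2)
    (by linarith) (fun _ z _ => hVs.contDiffAt) (fun _ z hz => by
      simp only [hV]
      rw [radialCut_eq_zero hw0 hw1 hz.le, mul_zero])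
  have hd : ∀ i x, c ≤ ‖x.2‖ → ‖x.2‖ < 1 + O.width →
      dAt (pullForm β (P.nbhd i)) x (1, 0) (0, x.2) = -fderiv ℝ V x.2 x.2 := by
    intro i x hx hx1
    have h4 : pullForm β (P.nbhd i) =ᶠ[𝓝 x] polarForm V 0 := by
      filter_upwards [(isOpen_tubeDomain _).mem_nhds hx1] with y hy using h2 i y hy
    rw [dAt_congr h4, dAt_polarForm_page (Q := 0) (hVd _) (differentiableAt_const 0)]
  have hx0 : ∀ x : ℝ × ℂ, c ≤ ‖x.2‖ → x.2 ≠ 0 := by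
    intro x hx h
    rw [h, norm_zero] at hx
    linarith
  refine ⟨β, ⟨h1, ?_, ?_⟩, ?_⟩
  · rintro _ ⟨i, θ, z, hz, rfl⟩
    have hz1 : ‖z‖ < 1 + O.width := by linarith
    have h4 := h2 i (θ, z) hz1
    have h5 : polarForm V 0 (θ, z) = 0 := by
      refine ContinuousLinearMap.ext fun v => ?_
      rw [polarForm_apply]
      simp only [hV]
      rw [radialCut_eq_one ha hab hz.le]
      simp
    rw [h5] at h4
    refine ContinuousLinearMap.ext fun v => ?_
    obtain ⟨(w : ℝ × ℂ), rfl⟩ :=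
      (P.immersiveAt_nbhd i (x := (θ, z)) hz1).surjective finrank_real_prod_complex v
    exact congrArg (fun L : ℝ × ℂ →L[ℝ] ℝ => L w) h4
  · intro p hp
    by_cases hpn : ∃ i x, ‖x.2‖ < 1 + O.width ∧ P.nbhd i x = p
    · obtain ⟨i, x, hx, rfl⟩ := hpn
      rw [P.nbhd_mem_tube_iff hc hx, not_lt] at hp
      rw [(P.pageChart_nbhd i (hx0 x hp) hx).pageNonneg_iff h1, hd i x hp hx]
      refine neg_nonneg.2 (fderiv_apply_self_nonpos (hVd _) fun s hs => ?_)
      have hsx : ‖x.2‖ ≤ ‖s • x.2‖ := by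
        rw [norm_smul, Real.norm_of_nonneg (by linarith)]
        nlinarith [norm_nonneg x.2]
      simp only [hV]
      rw [radialCut_eq_zero ha hab (by linarith), radialCut_eq_zero ha hab (by linarith)]
      rcases le_or_gt (1 + O.width / 2) ‖s • x.2‖ with h | h
      · rw [radialCut_eq_zero hw0 hw1 h, mul_zero]
        refine mul_nonneg (mul_nonneg (by norm_num) ?_) (radialCut_nonneg _)
        nlinarith [norm_nonneg x.2]
      · refine mul_le_mul ?_ (radialCut_smul_le hw0 hw1 _ hs) (radialCut_nonneg _) ?_
        · nlinarith [norm_nonneg x.2]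
        · nlinarith [norm_nonneg x.2]
    · intro u v _
      have hK : IsClosed (⋃ i, P.nbhd i '' (univ ×ˢ Metric.closedBall (0 : ℂ) (1 + O.width / 2))) :=
        isClosed_iUnion_of_finite fun i =>
          (P.isCompact_nbhd_image i (isCompact_closedBall _ _) fun z hz => by
            have : ‖z‖ ≤ 1 + O.width / 2 := by simpa using hz
            linarith).isClosed
      have h4 : p ∉ ⋃ i, P.nbhd i '' (univ ×ˢ Metric.closedBall (0 : ℂ) (1 + O.width / 2)) := by
        intro h
        obtain ⟨i, x, hx, rfl⟩ := mem_iUnion.1 h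
        have : ‖x.2‖ ≤ 1 + O.width / 2 := by simpa using hx.2
        exact hpn ⟨i, x, by linarith, rfl⟩
      have h5 : ∀ᶠ q in 𝓝 p, β q = (0 : OneForm M) q := by
        filter_upwards [hK.isOpen_compl.mem_nhds h4] with q hq
        refine h3 q fun i x hx h => hq (mem_iUnion.2 ⟨i, x, ⟨mem_univ _, by simpa using hx⟩, h⟩)
      rw [dForm_congr h5, dForm_zero]
  · intro i x hx hx1
    have hx2 : ‖x.2‖ < 1 + O.width := by linarith
    rw [(P.pageChart_nbhd i (hx0 x hx) hx2).pagePos_iff h1, hd i x hx hx2]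
    have h4 : V =ᶠ[𝓝 x.2] fun z => (1 + O.width) ^ 2 - ‖z‖ ^ 2 * 1 := by
      have e1 : ∀ᶠ z : ℂ in 𝓝 x.2, b < ‖z‖ :=
        continuous_norm.continuousAt.eventually (lt_mem_nhds (hbc.trans_le hx))
      have e2 : ∀ᶠ z : ℂ in 𝓝 x.2, ‖z‖ < 1 + O.width / 4 :=
        continuous_norm.continuousAt.eventually (gt_mem_nhds (by linarith))
      filter_upwards [e1, e2] with z hz1 hz2
      simp only [hV]
      rw [radialCut_eq_zero ha hab hz1.le, radialCut_eq_one hw0 hw1 hz2.le]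
      ring
    rw [h4.fderiv_eq, fderiv_const_sub, neg_apply, neg_neg,
      fderiv_apply_self_norm_sq_mul (differentiableAt_const (1 : ℝ))]
    have : 0 < ‖x.2‖ := norm_pos_iff.2 (hx0 x hx)
    simp
    positivity

end OpenBookManifold

/-! ### Moving positivity along a page -/

namespace OpenBookManifold

variable {W : Type*} [TopologicalSpace W] [ChartedSpace (EuclideanHalfSpace 2) W]
  [IsManifold (𝓡∂ 2) ∞ W]
  {B : Type*} {O : AbstractOpenBook W B} {M : Type*} [TopologicalSpace M]
  [ChartedSpace (EuclideanSpace ℝ (Fin 3)) M] [IsManifold (𝓡 3) ∞ M]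

theorem dAt_pullForm_add_smul {lam β : OneForm M} (h : IsSmoothForm lam) (h' : IsSmoothForm β)
    (c : ℝ) {Ψ : ℝ × ℂ → M} {x : ℝ × ℂ} (hΨ : ContMDiffAt 𝓘(ℝ, ℝ × ℂ) (𝓡 3) ∞ Ψ x)
    (u v : ℝ × ℂ) : dAt (pullForm (lam + c • β) Ψ) x u v =
      dAt (pullForm lam Ψ) x u v + c * dAt (pullForm β Ψ) x u v := by
  rw [← dForm_mfderiv h hΨ, ← dForm_mfderiv h' hΨ, ← dForm_mfderiv (h.add_smul h' c) hΨ]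
  exact dForm_add_smul h h' c _ _ _

theorem fiberChart_injective (P : OpenBookManifold O M) {x₀ : W}
    {y₁ a b : EuclideanSpace ℝ (Fin 2)} (hdet : a 0 * b 1 - a 1 * b 0 ≠ 0) {x x' : ℝ × ℂ}
    (hx : y₁ + x.2.re • a + x.2.im • b ∈ (extChartAt (𝓡∂ 2) x₀).target)
    (hx' : y₁ + x'.2.re • a + x'.2.im • b ∈ (extChartAt (𝓡∂ 2) x₀).target)
    (ht : |x.1 - x'.1| < 2) (h : P.fiberChart x₀ y₁ a b x = P.fiberChart x₀ y₁ a b x') :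
    x = x' := by
  obtain ⟨k, hk, hy⟩ := P.fiber_eq h
  have hk0 : k = 0 := by
    -- Two representations of a point differ in time by a multiple of `2π`, and `2π` exceeds the
    -- allowed difference `2`.
    by_contra hne
    have h1 : (1 : ℝ) ≤ |(k : ℝ)| := by exact_mod_cast Int.one_le_abs hne
    have h2 : |x.1 - x'.1| = |(k : ℝ)| * (2 * Real.pi) := by
      rw [hk, ← abs_neg, neg_sub, add_sub_cancel_left, abs_mul, abs_of_pos Real.two_pi_pos]
    nlinarith [Real.pi_gt_three]
  subst hk0
  simp only [Int.cast_zero, zero_mul, add_zero] at hk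
  rw [zpow_zero] at hy
  have h3 := (extChartAt (𝓡∂ 2) x₀).symm.injOn hx' hx hy
  have h4 := congrArg (fun v : EuclideanSpace ℝ (Fin 2) => v 0) h3
  have h5 := congrArg (fun v : EuclideanSpace ℝ (Fin 2) => v 1) h3
  simp at h4 h5
  refine Prod.ext hk.symm (Complex.ext ?_ ?_)
  · refine mul_right_cancel₀ hdet ?_
    linear_combination b 0 * h5 - b 1 * h4
  · refine mul_right_cancel₀ hdet ?_
    linear_combination a 1 * h4 - a 0 * h5

set_option maxHeartbeats 1000000 in
/-- Positivity on the pages can be moved along segments in a chart of the page. -/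
theorem TubeAdapted.move [T2Space M] {P : OpenBookManifold O M} {a c : ℝ} (ha : a < 1) (hc : c < 1)
    {β : OneForm M} (hβ : P.TubeAdapted a c β) {x₀ : W} {N : Set (EuclideanSpace ℝ (Fin 2))}
    {σ : ℝ} (hN : IsOpen N) (hNc : Convex ℝ N) (hσ : σ ≠ 0)
    (hNt : N ⊆ (extChartAt (𝓡∂ 2) x₀).target)
    (hchart : ∀ y ∈ N, ContMDiffAt 𝓘(ℝ, EuclideanSpace ℝ (Fin 2)) (𝓡∂ 2) ∞
          (extChartAt (𝓡∂ 2) x₀).symm y ∧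
        Function.Injective (mfderiv 𝓘(ℝ, EuclideanSpace ℝ (Fin 2)) (𝓡∂ 2)
          (extChartAt (𝓡∂ 2) x₀).symm y) ∧
        ∀ a b : EuclideanSpace ℝ (Fin 2), 0 < σ * (a 0 * b 1 - a 1 * b 0) →
          0 < O.area ((extChartAt (𝓡∂ 2) x₀).symm y)
            ![mfderiv 𝓘(ℝ, EuclideanSpace ℝ (Fin 2)) (𝓡∂ 2) (extChartAt (𝓡∂ 2) x₀).symm y a,
              mfderiv 𝓘(ℝ, EuclideanSpace ℝ (Fin 2)) (𝓡∂ 2) (extChartAt (𝓡∂ 2) x₀).symm y b])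
    {y y' : EuclideanSpace ℝ (Fin 2)} (hy : y ∈ N) (hy' : y' ∈ N) {τ : ℝ}
    (hpos : P.PagePos β (P.fiber ((extChartAt (𝓡∂ 2) x₀).symm y, τ))) :
    ∃ β' : OneForm M, P.TubeAdapted a c β' ∧
      P.PagePos β' (P.fiber ((extChartAt (𝓡∂ 2) x₀).symm y', τ)) := by
  rcases eq_or_ne y y' with rfl | hne
  · exact ⟨β, hβ, hpos⟩
  set A : EuclideanSpace ℝ (Fin 2) := y' - y with hA
  -- `A` points from `y` to `y'`; `D` is `A` turned by a right angle and scaled by `σ`, so that `(A,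
  -- D)` is positively oriented. In these coordinates the segment runs from `0` to `1`.
  set D : EuclideanSpace ℝ (Fin 2) := !₂[-(σ * A 1), σ * A 0] with hD
  have hD0 : D 0 = -(σ * A 1) := rfl
  have hD1 : D 1 = σ * A 0 := rfl
  have hAD : 0 < A 0 ^ 2 + A 1 ^ 2 := by
    by_contra h
    have e0 : A 0 = 0 := by nlinarith [sq_nonneg (A 0), sq_nonneg (A 1)]
    have e1 : A 1 = 0 := by nlinarith [sq_nonneg (A 0), sq_nonneg (A 1)]
    refine hne ((sub_eq_zero (a := y') (b := y)).1 ?_).symm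
    ext i
    fin_cases i
    · exact e0
    · exact e1
  have hdet : A 0 * D 1 - A 1 * D 0 ≠ 0 := by
    rw [hD0, hD1, show A 0 * (σ * A 0) - A 1 * -(σ * A 1) = σ * (A 0 ^ 2 + A 1 ^ 2) by ring]
    exact mul_ne_zero hσ hAD.ne'
  have hdet' : 0 < σ * (A 0 * D 1 - A 1 * D 0) := by
    rw [hD0, hD1, show σ * (A 0 * (σ * A 0) - A 1 * -(σ * A 1)) =
      σ ^ 2 * (A 0 ^ 2 + A 1 ^ 2) by ring]
    positivity
  set N' : Set ℂ := {z | y + z.re • A + z.im • D ∈ N} with hN'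
  have hN'o : IsOpen N' := hN.preimage (by fun_prop)
  have hN'c : Convex ℝ N' := by
    intro z hz z' hz' s t hs ht hst
    have := hNc hz hz' hs ht hst
    show y + (s • z + t • z').re • A + (s • z + t • z').im • D ∈ N
    convert this using 1
    rw [show t = 1 - s by linarith]
    simp only [Complex.add_re, Complex.add_im, Complex.smul_re, Complex.smul_im, smul_eq_mul]
    module
  have h0 : (0 : ℂ) ∈ N' := by simpa [hN'] using hy
  have h1 : (1 : ℂ) ∈ N' := by simpa [hN', hA] using hy'
  set Ψ := P.fiberChart x₀ y A D with hΨ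
  have hpage : ∀ x : ℝ × ℂ, x.2 ∈ N' → P.PageChart Ψ (fun _ => (0, 1)) (fun _ => (0, Complex.I)) x :=
    fun x hx => P.pageChart_fiberChart (hchart _ hx).1 (hchart _ hx).2.1 hdet
      ((hchart _ hx).2.2 A D hdet')
  have hΨ0 : Ψ (τ, 0) = P.fiber ((extChartAt (𝓡∂ 2) x₀).symm y, τ) := by
    simp [hΨ, fiberChart]
  have hΨ1 : Ψ (τ, 1) = P.fiber ((extChartAt (𝓡∂ 2) x₀).symm y', τ) := by
    simp [hΨ, fiberChart, hA]
  set h : ℝ × ℂ → ℝ := fun x => dAt (pullForm β Ψ) x (0, 1) (0, Complex.I) with hh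
  have hcont : ∀ x : ℝ × ℂ, x.2 ∈ N' → ContinuousAt h x := fun x hx =>
    continuousAt_dAt hβ.smooth (hpage x hx).immersive.smooth continuous_const continuous_const
  have hnn : ∀ x : ℝ × ℂ, x.2 ∈ N' → 0 ≤ h x := fun x hx =>
    ((hpage x hx).pageNonneg_iff hβ.smooth).1 (hβ.nonneg _ (P.fiber_not_mem_tube hc _))
  have hp0 : 0 < h (τ, 0) := ((hpage (τ, 0) h0).pagePos_iff hβ.smooth).1 (hΨ0 ▸ hpos)
  obtain ⟨κ₀, hκ₀, hbox⟩ := exists_box_subset hN'o hN'c h0 h1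
  obtain ⟨ε, hε, hball⟩ := Metric.eventually_nhds_iff.1
    ((hcont (τ, 0) h0).eventually (lt_mem_nhds hp0))
  -- Small enough that the box lies in the chart, that `dβ` stays positive on the sub-box around the
  -- starting point, and that the descent and the ascent of `v` are disjoint.
  set κ := min (min κ₀ (ε / 3)) (1 / 2) with hκdef
  have hκ : 0 < κ := by positivity
  have hκ1 : κ < 1 := (min_le_right _ _).trans_lt (by norm_num)
  have hκ2 : κ ≤ κ₀ := (min_le_left _ _).trans (min_le_left _ _)
  have hκ3 : κ ≤ ε / 3 := (min_le_left _ _).trans (min_le_right _ _)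
  have hboxN : ∀ x ∈ box τ κ, |x.1 - τ| < 1 ∧ x.2 ∈ N' := by
    intro x hx
    refine ⟨?_, hbox κ hκ hκ2 hx.2⟩
    have := hx.1
    rw [abs_lt]
    constructor <;> linarith [this.1, this.2]
  obtain ⟨v, hv, hv0, hv1, hv2⟩ := exists_valley hκ hκ1
  obtain ⟨u, hu, hu0, hu1, hu2⟩ := exists_bump 0 hκ
  obtain ⟨w, hw, hw0, hw1, hw2⟩ := exists_bump τ hκ
  rw [zero_sub, zero_add] at hu2
  set U : Set (ℝ × ℂ) := {x | |x.1 - τ| < 1 ∧ x.2 ∈ N'} with hU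
  have hUo : IsOpen U := (isOpen_lt (f := fun x : ℝ × ℂ => |x.1 - τ|) (by fun_prop) continuous_const).inter
    (hN'o.preimage continuous_snd)
  have hTc : IsClosed (⋃ _ : Unit, Ψ '' box τ κ) := by
    refine isClosed_iUnion_of_finite fun _ => ((isCompact_box τ κ).image_of_continuousOn ?_).isClosed
    exact fun x hx => (hpage x (hboxN x hx).2).immersive.smooth.continuousAt.continuousWithinAt
  obtain ⟨f, hf1, hf2, hf3⟩ := exists_form_of_pullForm (M := M) finrank_real_prod_complex
    (ι := Unit) (Ψ := fun _ => Ψ) (U := fun _ => U) (C := fun _ => box τ κ)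
    (ζ := fun _ => boxForm w v u) (fun _ => hUo) (fun _ x hx => (hpage x hx.2).immersive)
    (fun _ x _ => (contDiff_boxForm hw hv hu).contDiffAt)
    (fun _ x _ hxC => by
      have : w x.1 * v x.2.re * u x.2.im = 0 := by
        by_contra hne
        simp only [mul_eq_zero, not_or] at hne
        refine hxC ⟨?_, ?_, ?_⟩
        · by_contra hx; exact hne.1.1 (hw2 _ hx)
        · by_contra hx; exact hne.1.2 (hv0 _ hx)
        · by_contra hx; exact hne.2 (hu2 _ hx)
      rw [boxForm, this, zero_smul])
    hTc (fun _ x hx => hboxN x hx)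
    (by
      rintro - - x hx x' hx' hxx p q hpq
      obtain rfl := P.fiberChart_injective hdet (hNt hx.2) (hNt hx'.2)
        (abs_lt.2 ⟨by linarith [(abs_lt.1 hx.1).1, (abs_lt.1 hx'.1).2],
          by linarith [(abs_lt.1 hx.1).2, (abs_lt.1 hx'.1).1]⟩) hxx
      have h5 : p = q := (hpage x hx.2).immersive.injective hpq
      rw [h5])
  set g : ℝ × ℂ → ℝ := fun x => w x.1 * deriv v x.2.re * u x.2.im with hg
  have hgc : Continuous g := by
    have := (hv.continuous_deriv (by simp))
    exact ((hw.continuous.comp continuous_fst).mul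
      (this.comp (Complex.continuous_re.comp continuous_snd))).mul
        (hu.continuous.comp (Complex.continuous_im.comp continuous_snd))
  have hfg : ∀ x ∈ U, dAt (pullForm f Ψ) x (0, 1) (0, Complex.I) = g x := by
    intro x hx
    have h4 : pullForm f Ψ =ᶠ[𝓝 x] boxForm w v u := by
      filter_upwards [hUo.mem_nhds hx] with q hq using hf2 () q hq
    rw [dAt_congr h4, dAt_boxForm hw hv hu]
  -- The only place where `df` can be negative on the pages; there `dβ` has a positive lower bound
  -- relative to `|df|`.
  set K : Set (ℝ × ℂ) := Icc (τ - κ) (τ + κ) ×ˢ (Icc (-κ) κ ×ℂ Icc (-κ) κ) with hK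
  have hKU : K ⊆ U := fun x hx =>
    hboxN x ⟨hx.1, ⟨hx.2.1.1, hx.2.1.2.trans (by linarith)⟩, hx.2.2⟩
  have hKpos : ∀ x ∈ K, 0 < h x := by
    intro x hx
    refine hball ?_
    have e1 : |x.1 - τ| ≤ κ := abs_le.2 ⟨by linarith [hx.1.1], by linarith [hx.1.2]⟩
    have e2 := Complex.norm_le_abs_re_add_abs_im x.2
    have e3 : |x.2.re| ≤ κ := abs_le.2 hx.2.1
    have e4 : |x.2.im| ≤ κ := abs_le.2 hx.2.2
    rw [Prod.dist_eq, max_lt_iff, Real.dist_eq, dist_zero_right]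
    constructor <;> linarith
  obtain ⟨C, hC⟩ : ∃ C : ℝ, ∀ x ∈ K, |g x| / h x ≤ C := by
    have hKc : IsCompact K := isCompact_Icc.prod (isCompact_Icc.reProdIm isCompact_Icc)
    have hcon : ContinuousOn (fun x => |g x| / h x) K := fun x hx =>
      (hgc.abs.continuousAt.div (hcont x (hKU hx).2) (hKpos x hx).ne').continuousWithinAt
    obtain ⟨C, hC⟩ := hKc.bddAbove_image hcon
    exact ⟨C, fun x hx => hC ⟨x, hx, rfl⟩⟩
  -- `C'β` outweighs the negative part of `df` on `K`. It must be nonnegative so that it does no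
  -- harm where `dβ ≥ 0`.
  set C' := max C 0 with hC'
  have hC'0 : 0 ≤ C' := le_max_right _ _
  have hβ' : ∀ x ∈ U, dAt (pullForm (f + C' • β) Ψ) x (0, 1) (0, Complex.I) = g x + C' * h x := by
    intro x hx
    rw [dAt_pullForm_add_smul hf1 hβ.smooth C' (hpage x hx.2).immersive.smooth, hfg x hx]
  have hsm : IsSmoothForm (f + C' • β) := hf1.add_smul hβ.smooth C'
  have hge : ∀ x ∈ U, 0 ≤ g x + C' * h x := by
    intro x hx
    by_cases hxK : x ∈ K
    · have e1 := (div_le_iff₀ (hKpos x hxK)).1 ((hC x hxK).trans (le_max_left C 0))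
      linarith [neg_abs_le (g x)]
    · refine add_nonneg ?_ (mul_nonneg hC'0 (hnn x hx.2))
      by_cases e1 : x.1 ∈ Icc (τ - κ) (τ + κ)
      · by_cases e2 : x.2.im ∈ Icc (-κ) κ
        · have e3 : x.2.re ∉ Icc (-κ) κ := fun e => hxK ⟨e1, e, e2⟩
          exact mul_nonneg (mul_nonneg (hw0 _) (hv1 _ e3)) (hu0 _)
        · simp [hg, hu2 _ e2]
      · simp [hg, hw2 _ e1]
  refine ⟨f + C' • β, ⟨hsm, ?_, ?_⟩, ?_⟩
  · intro p hp
    have e1 : f p = 0 := by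
      refine hf3 p fun hmem => ?_
      obtain ⟨-, x, hx, rfl⟩ := mem_iUnion.1 hmem
      exact P.fiber_not_mem_tube ha _ hp
    have e2 := hβ.zero p hp
    show f p + C' • β p = 0
    rw [e1, e2, smul_zero, add_zero]
  · intro p hp
    by_cases hpC : p ∈ ⋃ _ : Unit, Ψ '' box τ κ
    · obtain ⟨-, x, hx, rfl⟩ := mem_iUnion.1 hpC
      have hxU : x ∈ U := hboxN x hx
      rw [(hpage x hxU.2).pageNonneg_iff hsm, hβ' x hxU]
      exact hge x hxU
    · intro p₁ p₂ hfr
      have e1 : ∀ᶠ q in 𝓝 p, f q = (0 : OneForm M) q := by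
        filter_upwards [hTc.isOpen_compl.mem_nhds hpC] with q hq using hf3 q hq
      rw [dForm_add_smul hf1 hβ.smooth, dForm_congr e1, dForm_zero, zero_add]
      exact mul_nonneg hC'0 (hβ.nonneg p hp p₁ p₂ hfr)
  · have h1U : ((τ, 1) : ℝ × ℂ) ∈ U := ⟨by simp, h1⟩
    rw [← hΨ1, (hpage _ h1).pagePos_iff hsm, hβ' _ h1U]
    -- At the end of the segment the new form gains positivity from the ascent of `v`.
    have e1 : 0 < g (τ, 1) := by
      simp only [hg, Complex.one_re, Complex.one_im]
      positivity
    have := mul_nonneg hC'0 (hnn (τ, 1) h1)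
    linarith

end OpenBookManifold

/-! ### Positivity on all pages by connectedness and compactness -/

namespace OpenBookManifold

variable {W : Type*} [TopologicalSpace W] [ChartedSpace (EuclideanHalfSpace 2) W]
  [IsManifold (𝓡∂ 2) ∞ W]
  {B : Type*} {O : AbstractOpenBook W B} {M : Type*} [TopologicalSpace M]
  [ChartedSpace (EuclideanSpace ℝ (Fin 3)) M] [IsManifold (𝓡 3) ∞ M]

theorem compactSpace [CompactSpace W] [Finite B] (P : OpenBookManifold O M) : CompactSpace M := by
  have h1 : IsCompact (P.fiber '' (univ ×ˢ Icc 0 (2 * Real.pi))) :=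
    (isCompact_univ.prod isCompact_Icc).image P.fiber_smooth.continuous
  have h2 : IsCompact (⋃ i, P.nbhd i '' (univ ×ˢ Metric.closedBall (0 : ℂ) 1)) :=
    isCompact_iUnion fun i => P.isCompact_nbhd_image i (isCompact_closedBall _ _) fun z hz => by
      have : ‖z‖ ≤ 1 := by simpa using hz
      linarith [O.width_pos]
  refine ⟨(h1.union h2).of_isClosed_subset isClosed_univ fun p _ => ?_⟩
  rcases P.cover p with ⟨⟨x, s⟩, rfl⟩ | ⟨i, θ, z, hz, rfl⟩
  · left
    have hp := Real.two_pi_pos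
    have h3 := toIcoMod_mem_Ico hp 0 s
    rw [zero_add] at h3
    refine ⟨((O.perm ^ (-toIcoDiv hp 0 s)) x, toIcoMod hp 0 s), ⟨mem_univ _, h3.1, h3.2.le⟩, ?_⟩
    have h4 := P.fiber_zpow (-toIcoDiv hp 0 s) x s
    rw [← h4]
    congr 2
    have := toIcoMod_add_toIcoDiv_zsmul hp 0 s
    rw [zsmul_eq_mul] at this
    push_cast
    linarith
  · right
    exact mem_iUnion.2 ⟨i, (θ, z), ⟨mem_univ _, Metric.ball_subset_closedBall hz⟩, rfl⟩

theorem isOpen_tube (P : OpenBookManifold O M) {ρ : ℝ} (hρ : ρ < 1) : IsOpen (P.tube ρ) := by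
  refine isOpen_iff_mem_nhds.2 ?_
  rintro _ ⟨i, θ, z, hz, rfl⟩
  have h1 : ‖z‖ < 1 + O.width := by linarith [O.width_pos]
  rw [← (P.immersiveAt_nbhd i (x := (θ, z)) h1).map_nhds finrank_real_prod_complex]
  rw [mem_map]
  filter_upwards [(isOpen_tubeDomain ρ).mem_nhds (show ((θ, z) : ℝ × ℂ) ∈ {x | ‖x.2‖ < ρ} from hz)]
    with x hx using ⟨i, x.1, x.2, hx, rfl⟩

variable [CompactSpace W] [T2Space M] [Finite B]

/-- At fixed `τ` the good points of `W` form a clopen set containing `∂W`: open because positivity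
is open, closed because within a chart around an interior limit point positivity can be moved from a
good point to the limit. Every component meets `∂W`. -/
theorem exists_tubeAdapted_fiber (P : OpenBookManifold O M) {a c : ℝ} (ha : 0 ≤ a) (hac : a < c)
    (hc : c < 1) (x : W) (τ : ℝ) :
    ∃ β : OneForm M, P.TubeAdapted a c β ∧ P.PagePos β (P.fiber (x, τ)) := by
  have ha1 : a < 1 := hac.trans hc
  set S : Set W := {x | ∃ β : OneForm M, P.TubeAdapted a c β ∧ P.PagePos β (P.fiber (x, τ))} with hS
  have hbd : ∀ x ∈ (𝓡∂ 2).boundary W, x ∈ S := by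
    intro x hx
    rw [← O.collar_boundary] at hx
    obtain ⟨i, θ, rfl⟩ := hx
    obtain ⟨β, h1, h2⟩ := P.exists_tubeAdapted_tube ha hac hc
    refine ⟨β, h1, ?_⟩
    rw [← P.nbhd_exp_eq_fiber]
    refine h2 i _ ?_ ?_
    · rw [Complex.norm_exp_ofReal_mul_I]; exact hc.le
    · rw [Complex.norm_exp_ofReal_mul_I]
  have hcont : Continuous fun x : W => P.fiber (x, τ) :=
    P.fiber_smooth.continuous.comp (by fun_prop)
  have hopen : IsOpen S := by
    refine isOpen_iff_mem_nhds.2 ?_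
    rintro x ⟨β, h1, h2⟩
    have h3 := h2.eventually h1.smooth (P.fiber_not_mem_bindingComponent _)
    filter_upwards [hcont.continuousAt.eventually h3] with y hy using ⟨β, h1, hy⟩
  have hclosed : IsClosed S := by
    refine isClosed_of_closure_subset fun x hx => ?_
    rcases (𝓡∂ 2).isInteriorPoint_or_isBoundaryPoint x with hint | hb
    swap
    · exact hbd x hb
    obtain ⟨N, σ, hN, hNc, hσ, hxN, hNt, hchart⟩ := exists_oriented_chart O hint
    have h1 : (extChartAt (𝓡∂ 2) x) ⁻¹' N ∩ (extChartAt (𝓡∂ 2) x).source ∈ 𝓝 x :=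
      inter_mem ((continuousAt_extChartAt x).preimage_mem_nhds (hN.mem_nhds hxN))
        (extChartAt_source_mem_nhds x)
    obtain ⟨y, ⟨hy1, hy2⟩, β, hβ, hpos⟩ := mem_closure_iff_nhds.1 hx _ h1
    have hpos' : P.PagePos β (P.fiber ((extChartAt (𝓡∂ 2) x).symm (extChartAt (𝓡∂ 2) x y), τ)) := by
      rwa [(extChartAt (𝓡∂ 2) x).left_inv hy2]
    obtain ⟨β', h2, h3⟩ := hβ.move ha1 hc hN hNc hσ hNt hchart hy1 hxN hpos'
    rw [(extChartAt (𝓡∂ 2) x).left_inv (mem_extChartAt_source x)] at h3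
    exact ⟨β', h2, h3⟩
  obtain ⟨y, hy1, hy2⟩ := O.component_meets_boundary x
  have h4 := IsClopen.connectedComponent_subset ⟨hclosed, hopen⟩ (hbd y hy2)
  rw [connectedComponent_eq_iff_mem.2 hy1] at h4
  exact h4 mem_connectedComponent

/-- Adapted forms add, and at each point one positive summand suffices since all the others are
nonnegative. The complement of the tube is compact, so finitely many forms are enough. -/
theorem exists_tubeAdapted_pagePos (P : OpenBookManifold O M) {a c : ℝ} (ha : 0 ≤ a) (hac : a < c)
    (hc : c < 1) :
    ∃ β : OneForm M, P.TubeAdapted a c β ∧ ∀ p, p ∉ P.tube c → P.PagePos β p := by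
  have hM := P.compactSpace
  have hK : IsCompact (P.tube c)ᶜ := (P.isOpen_tube hc).isClosed_compl.isCompact
  obtain ⟨β, h1, h2⟩ : ∃ β : OneForm M, P.TubeAdapted a c β ∧
      ∀ p ∈ (P.tube c)ᶜ, p ∉ P.tube c → P.PagePos β p := by
    refine hK.induction_on (p := fun s => ∃ β : OneForm M, P.TubeAdapted a c β ∧
      ∀ p ∈ s, p ∉ P.tube c → P.PagePos β p) ?_ ?_ ?_ ?_
    · obtain ⟨β, h1, -⟩ := P.exists_tubeAdapted_tube ha hac hc
      exact ⟨β, h1, fun p hp => hp.elim⟩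
    · rintro s t hst ⟨β, h1, h2⟩
      exact ⟨β, h1, fun p hp => h2 p (hst hp)⟩
    · rintro s t ⟨β, h1, h2⟩ ⟨β', h1', h2'⟩
      refine ⟨β + (1 : ℝ) • β', h1.add_smul h1' zero_le_one, fun p hp hpc u v huv => ?_⟩
      rw [dForm_add_smul h1.smooth h1'.smooth, one_mul]
      rcases hp with hp | hp
      · exact add_pos_of_pos_of_nonneg (h2 p hp hpc u v huv) (h1'.nonneg p hpc u v huv)
      · exact add_pos_of_nonneg_of_pos (h1.nonneg p hpc u v huv) (h2' p hp hpc u v huv)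
    · intro p hp
      obtain ⟨β, h1, h2⟩ : ∃ β : OneForm M, P.TubeAdapted a c β ∧ P.PagePos β p := by
        rcases P.cover p with ⟨⟨x, s⟩, rfl⟩ | ⟨i, θ, z, hz, rfl⟩
        · exact P.exists_tubeAdapted_fiber ha hac hc x s
        · obtain ⟨β, h1, h2⟩ := P.exists_tubeAdapted_tube ha hac hc
          have hz1 : ‖z‖ < 1 := by simpa using hz
          refine ⟨β, h1, h2 i _ ?_ hz1.le⟩
          by_contra h
          exact hp ⟨i, θ, z, not_le.1 h, rfl⟩
      have h3 : ∀ i, p ∉ P.bindingComponent i := by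
        rintro i ⟨θ, rfl⟩
        exact hp ⟨i, θ, 0, by simpa using ha.trans_lt hac, rfl⟩
      have h4 := h2.eventually h1.smooth h3
      exact ⟨_, mem_nhdsWithin_of_mem_nhds h4, β, h1, fun q hq _ => hq⟩
  exact ⟨β, h1, fun p hp => h2 p hp hp⟩

end OpenBookManifold

/-! ### Coefficients near the binding -/

/-- Properties of the coefficients of the form `Γ dθ + G Im(z̄ dz)` on the ball of radius `b`. -/
structure ModelBall (Γ G : ℂ → ℝ) (b : ℝ) : Prop where
  pos : 0 < b
  lt_one : b < 1
  smooth₁ : ∀ z, ‖z‖ < 1 → ContDiffAt ℝ ∞ Γ z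
  smooth₂ : ∀ z, ‖z‖ < 1 → ContDiffAt ℝ ∞ G z
  pos₁ : ∀ z, ‖z‖ ≤ b → 0 < Γ z
  deriv₁ : ∀ z, z ≠ 0 → ‖z‖ < 1 → fderiv ℝ Γ z z < 0
  pos₂ : ∀ z, ‖z‖ ≤ b → 0 < G z
  deriv₂ : ∀ z, ‖z‖ ≤ b → 0 < 2 * G z + fderiv ℝ G z z
  lt₂ : ∀ z, ‖z‖ ≤ b → ‖z‖ ^ 2 * G z < 1

/-- Apart from the sign of `γ₁'`, the inequalities hold at the centre and are open, and there are
finitely many components, so one radius `b` serves all. The bound `γ₂ < 1` is what lets `γ₂` be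
interpolated upwards to `1`. -/
theorem exists_modelBall {B : Type*} [Finite B] {γ₁ γ₂ : B → ℝ → ℝ}
    (hγ : ∀ i, IsLocalModel (γ₁ i) (γ₂ i)) :
    ∃ (G : B → ℂ → ℝ) (b : ℝ), 0 < b ∧ b < 1 ∧ (∀ i, ModelBall (fun z => γ₁ i ‖z‖) (G i) b) ∧
      (∀ i z, ‖z‖ < 1 → γ₂ i ‖z‖ = ‖z‖ ^ 2 * G i z) ∧
      ∀ i, 2 * G i 0 = iteratedDerivWithin 2 (γ₂ i) (Ici 0) 0 := by
  choose G hG1 hG2 hG3 hG4 using fun i => (hγ i).exists_coefficient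
  have hs : ∀ i (z : ℂ), ‖z‖ < 1 → ContDiffAt ℝ ∞ (fun z : ℂ => γ₁ i ‖z‖) z := fun i z hz =>
    (hγ i).disk₁.contDiffAt (Metric.isOpen_ball.mem_nhds (by simpa using hz))
  have hev : ∀ᶠ z : ℂ in 𝓝 0, ∀ i, 0 < γ₁ i ‖z‖ ∧ 0 < G i z ∧
      0 < 2 * G i z + fderiv ℝ (G i) z z ∧ ‖z‖ ^ 2 * G i z < 1 := by
    rw [eventually_all]
    intro i
    have h0 : ‖(0 : ℂ)‖ < 1 := by simp
    have h1 := (hs i 0 h0).continuousAt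
    have h2 := (hG1 i 0 h0).continuousAt
    have h3 : ContinuousAt (fun z => 2 * G i z + fderiv ℝ (G i) z z) 0 :=
      (continuousAt_const.mul h2).add ((((hG1 i 0 h0).fderiv_right (m := 0)
        (by simp)).continuousAt).clm_apply continuousAt_id)
    have h4 : ContinuousAt (fun z : ℂ => ‖z‖ ^ 2 * G i z) 0 := by fun_prop
    have h3' : 0 < 2 * G i 0 + fderiv ℝ (G i) 0 0 := by simpa using hG3 i
    filter_upwards [h1.eventually (lt_mem_nhds (show 0 < γ₁ i ‖(0 : ℂ)‖ by
      simpa using (hγ i).zero_pos)), h2.eventually (lt_mem_nhds (hG3 i)),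
      h3.eventually (lt_mem_nhds h3'), h4.eventually (gt_mem_nhds (show ‖(0 : ℂ)‖ ^ 2 * G i 0 < 1 by
        simp))] with z e1 e2 e3 e4 using ⟨e1, e2, e3, e4⟩
  obtain ⟨ε, hε, h⟩ := Metric.eventually_nhds_iff.1 hev
  have hb : ∀ z : ℂ, ‖z‖ ≤ min ε 1 / 2 → dist z 0 < ε := by
    intro z hz
    rw [dist_zero_right]
    have := min_le_left ε 1
    linarith
  have hb1 : min ε 1 / 2 < 1 := by
    have := min_le_right ε 1
    linarith
  refine ⟨G, min ε 1 / 2, by positivity, hb1, fun i => ⟨by positivity, hb1, hs i, hG1 i,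
    fun z hz => (h (hb z hz) i).1, ?_, fun z hz => (h (hb z hz) i).2.1,
    fun z hz => (h (hb z hz) i).2.2.1, fun z hz => (h (hb z hz) i).2.2.2⟩, hG2, hG4⟩
  intro z hz hz1
  rw [fderiv_norm_apply_self (hγ i).smooth₁ (hγ i).disk₁ hz hz1]
  have hz0 : 0 < ‖z‖ := norm_pos_iff.2 hz
  exact mul_neg_of_pos_of_neg hz0 ((hγ i).deriv_neg _ ⟨hz0, hz1⟩)

/-- A function equal to `G` near the centre and to `|z|⁻²` away from it. -/
def angularCoeff (a c : ℝ) (G : ℂ → ℝ) (z : ℂ) : ℝ :=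
  radialCut a c z * G z + (1 - radialCut a c z) * (‖z‖ ^ 2)⁻¹

/-! ### Monotonicity of the interpolating coefficients -/

section

variable {a c b : ℝ} {Γ G : ℂ → ℝ}

theorem angularCoeff_of_le (ha : 0 ≤ a) (hac : a < c) {z : ℂ} (hz : ‖z‖ ≤ a) :
    angularCoeff a c G z = G z := by
  rw [angularCoeff, radialCut_eq_one ha hac hz]; ring

theorem angularCoeff_of_ge (ha : 0 ≤ a) (hac : a < c) {z : ℂ} (hz : c ≤ ‖z‖) :
    angularCoeff a c G z = (‖z‖ ^ 2)⁻¹ := by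
  rw [angularCoeff, radialCut_eq_zero ha hac hz]; ring

theorem contDiffAt_radialCut_mul (ha : 0 ≤ a) (hac : a < c) (hc : c < 1)
    (h : ∀ z, ‖z‖ < 1 → ContDiffAt ℝ ∞ Γ z) (z : ℂ) :
    ContDiffAt ℝ ∞ (fun z => radialCut a c z * Γ z) z := by
  rcases lt_or_ge ‖z‖ 1 with hz | hz
  · exact (contDiff_radialCut a c).contDiffAt.mul (h z hz)
  · have h1 : (fun z => radialCut a c z * Γ z) =ᶠ[𝓝 z] fun _ => 0 := by
      filter_upwards [continuous_norm.continuousAt.eventually (lt_mem_nhds (hc.trans_le hz))]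
        with w hw
      rw [radialCut_eq_zero ha hac hw.le, zero_mul]
    exact contDiffAt_const.congr_of_eventuallyEq h1

theorem contDiffAt_angularCoeff (ha : 0 < a) (hac : a < c) (hc : c < 1)
    (h : ∀ z, ‖z‖ < 1 → ContDiffAt ℝ ∞ G z) (z : ℂ) : ContDiffAt ℝ ∞ (angularCoeff a c G) z := by
  refine (contDiffAt_radialCut_mul ha.le hac hc h z).add ?_
  rcases eq_or_ne z 0 with rfl | hz
  · have h1 : (fun z => (1 - radialCut a c z) * (‖z‖ ^ 2)⁻¹) =ᶠ[𝓝 0] fun _ => 0 := by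
      have : ‖(0 : ℂ)‖ < a := by simpa using ha
      filter_upwards [continuous_norm.continuousAt.eventually (gt_mem_nhds this)] with w hw
      rw [radialCut_eq_one ha.le hac hw.le, sub_self, zero_mul]
    exact contDiffAt_const.congr_of_eventuallyEq h1
  · refine (contDiff_const.sub (contDiff_radialCut a c)).contDiffAt.mul
      ((contDiff_norm_sq ℝ).contDiffAt.inv ?_)
    simpa using hz

namespace ModelBall

variable (h : ModelBall Γ G b)
include h

theorem angularCoeff_pos (ha : 0 < a) (hac : a < c) (hcb : c ≤ b) (z : ℂ) :
    0 < angularCoeff a c G z := by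
  rcases le_or_gt c ‖z‖ with hz | hz
  · rw [angularCoeff_of_ge ha.le hac hz]
    have : 0 < ‖z‖ := (ha.trans hac).trans_le hz
    positivity
  · rcases eq_or_ne z 0 with rfl | hz0
    · rw [angularCoeff_of_le ha.le hac (by simpa using ha.le)]
      exact h.pos₂ _ (by simpa using h.pos.le)
    · have h1 := h.pos₂ z (hz.le.trans hcb)
      have h2 : 0 < (‖z‖ ^ 2)⁻¹ := by
        have : 0 < ‖z‖ := norm_pos_iff.2 hz0
        positivity
      have h3 : 0 ≤ radialCut a c z := radialCut_nonneg z
      have h4 : radialCut a c z ≤ 1 := radialCut_le_one z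
      unfold angularCoeff
      rcases h3.eq_or_lt with h5 | h5
      · rw [← h5]; linarith
      · have := mul_pos h5 h1
        have := mul_nonneg (sub_nonneg.2 h4) h2.le
        linarith

/-- Multiplied by `r²` the coefficient is `χ (γ₂ - 1) + 1`. It increases because `γ₂` does, and
because `χ` decreases while `γ₂ < 1`. -/
theorem angularCoeff_deriv (ha : 0 < a) (hac : a < c) (hcb : c ≤ b) {z : ℂ} (hz : ‖z‖ ≤ b) :
    0 ≤ 2 * angularCoeff a c G z + fderiv ℝ (angularCoeff a c G) z z := by
  rcases eq_or_ne z 0 with rfl | hz0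
  · rw [map_zero, add_zero]
    have := h.angularCoeff_pos ha hac hcb 0
    positivity
  have hz1 : ‖z‖ < 1 := hz.trans_lt h.lt_one
  have hd : DifferentiableAt ℝ (angularCoeff a c G) z :=
    (contDiffAt_angularCoeff ha hac (hcb.trans_lt h.lt_one) h.smooth₂ z).differentiableAt (by simp)
  have hGd : DifferentiableAt ℝ G z := (h.smooth₂ z hz1).differentiableAt (by simp)
  have hχd : DifferentiableAt ℝ (radialCut a c) z :=
    (contDiff_radialCut a c).differentiable (by simp) z
  have hNd : DifferentiableAt ℝ (fun w : ℂ => ‖w‖ ^ 2 * G w) z :=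
    ((contDiff_norm_sq ℝ (n := 1)).differentiable (by simp) z).mul hGd
  have h1 := fderiv_apply_self_norm_sq_mul hd
  have h2 : (fun w => ‖w‖ ^ 2 * angularCoeff a c G w) =ᶠ[𝓝 z]
      fun w => radialCut a c w * (‖w‖ ^ 2 * G w - 1) + 1 := by
    filter_upwards [isOpen_ne.mem_nhds hz0] with w hw
    have : ‖w‖ ≠ 0 := norm_ne_zero_iff.2 hw
    unfold angularCoeff
    field_simp
    ring
  have h3 : fderiv ℝ (fun w => radialCut a c w * (‖w‖ ^ 2 * G w - 1) + 1) z z =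
      radialCut a c z * (‖z‖ ^ 2 * (2 * G z + fderiv ℝ G z z)) +
        (‖z‖ ^ 2 * G z - 1) * fderiv ℝ (radialCut a c) z z := by
    rw [fderiv_add_const, fderiv_fun_mul hχd (hNd.sub_const 1), fderiv_sub_const]
    simp only [add_apply, smul_apply, smul_eq_mul]
    rw [fderiv_apply_self_norm_sq_mul hGd]
  rw [h2.fderiv_eq, h3] at h1
  have hn : 0 < ‖z‖ ^ 2 := by
    have : 0 < ‖z‖ := norm_pos_iff.2 hz0
    positivity
  have h4 : 0 ≤ ‖z‖ ^ 2 * (2 * angularCoeff a c G z + fderiv ℝ (angularCoeff a c G) z z) := by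
    rw [← h1]
    have e1 := h.lt₂ z hz
    have e2 := fderiv_radialCut_nonpos ha.le hac z
    have e3 : 0 ≤ radialCut a c z := radialCut_nonneg z
    have e4 := (h.deriv₂ z hz).le
    have e5 := mul_nonneg_of_nonpos_of_nonpos (sub_nonpos.2 e1.le) e2
    have e6 := mul_nonneg e3 (mul_nonneg hn.le e4)
    linarith
  exact nonneg_of_mul_nonneg_right h4 hn

theorem fderiv_radialCut_mul_nonpos (ha : 0 ≤ a) (hac : a < c) {z : ℂ} (hz : ‖z‖ ≤ b) :
    fderiv ℝ (fun z => radialCut a c z * Γ z) z z ≤ radialCut a c z * fderiv ℝ Γ z z := by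
  have hΓd : DifferentiableAt ℝ Γ z :=
    (h.smooth₁ z (hz.trans_lt h.lt_one)).differentiableAt (by simp)
  have hχd : DifferentiableAt ℝ (radialCut a c) z :=
    (contDiff_radialCut a c).differentiable (by simp) z
  rw [fderiv_fun_mul hχd hΓd]
  simp only [add_apply, smul_apply, smul_eq_mul]
  have := mul_nonpos_of_nonneg_of_nonpos (h.pos₁ z hz).le (fderiv_radialCut_nonpos ha hac z)
  linarith

/-- The coefficient `(χ + k (1 - χ)) Γ` of the interpolated form has negative radial derivative. -/
theorem fderiv_interpolation (ha : 0 ≤ a) (hac : a < c) {k : ℝ} (hk : 0 ≤ k) (hk1 : k ≤ 1) {z : ℂ}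
    (hz : ‖z‖ ≤ b) :
    fderiv ℝ (fun z => (radialCut a c z + k * (1 - radialCut a c z)) * Γ z) z z ≤ 0 ∧
    (z ≠ 0 → 0 < k ∨ ‖z‖ ≤ a →
      fderiv ℝ (fun z => (radialCut a c z + k * (1 - radialCut a c z)) * Γ z) z z < 0) := by
  rcases eq_or_ne z 0 with rfl | hz0
  · simp
  have hΓd : DifferentiableAt ℝ Γ z :=
    (h.smooth₁ z (hz.trans_lt h.lt_one)).differentiableAt (by simp)
  have hχd : DifferentiableAt ℝ (radialCut a c) z :=
    (contDiff_radialCut a c).differentiable (by simp) z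
  have hsd : DifferentiableAt ℝ (fun z => radialCut a c z + k * (1 - radialCut a c z)) z :=
    hχd.add ((hχd.const_sub 1).const_mul k)
  have h1 : fderiv ℝ (fun z => (radialCut a c z + k * (1 - radialCut a c z)) * Γ z) z z =
      (radialCut a c z + k * (1 - radialCut a c z)) * fderiv ℝ Γ z z +
        Γ z * ((1 - k) * fderiv ℝ (radialCut a c) z z) := by
    have h2 : fderiv ℝ (fun z => radialCut a c z + k * (1 - radialCut a c z)) z =
        fderiv ℝ (radialCut a c) z + k • -fderiv ℝ (radialCut a c) z := by
      rw [fderiv_fun_add hχd ((hχd.const_sub 1).const_mul k), fderiv_const_mul (hχd.const_sub 1),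
        fderiv_const_sub]
    rw [fderiv_fun_mul hsd hΓd, h2]
    simp only [add_apply, smul_apply, smul_eq_mul, neg_apply]
    ring
  rw [h1]
  -- Both factors decrease: the derivative of `χ + k(1 - χ)` is `(1 - k)χ' ≤ 0`, and `Γ' < 0`.
  -- Strictness needs the first factor positive, that is `k > 0` or `χ = 1`.
  have e1 := h.deriv₁ z hz0 (hz.trans_lt h.lt_one)
  have e2 := mul_nonpos_of_nonneg_of_nonpos (h.pos₁ z hz).le
    (mul_nonpos_of_nonneg_of_nonpos (sub_nonneg.2 hk1) (fderiv_radialCut_nonpos ha hac z))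
  have e3 : 0 ≤ radialCut a c z := radialCut_nonneg z
  have e4 : 0 ≤ 1 - radialCut a c z := sub_nonneg.2 (radialCut_le_one z)
  have e5 := mul_nonneg hk e4
  constructor
  · have := mul_nonpos_of_nonneg_of_nonpos (add_nonneg e3 e5) e1.le
    linarith
  · intro _ hor
    have e6 : 0 < radialCut a c z + k * (1 - radialCut a c z) := by
      rcases hor with hk0 | hza
      · rcases e3.eq_or_lt with e7 | e7
        · rw [← e7]; linarith
        · linarith
      · rw [radialCut_eq_one ha hac hza]; linarith
    have := mul_neg_of_pos_of_neg e6 e1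
    linarith

/-- The interpolated form `(χ + k (1 - χ)) Γ dθ + Q Im(z̄ dz)` is a confoliation form, and a
contact form if `k > 0` or `|z| ≤ a`. -/
theorem wedge_interpolation (ha : 0 < a) (hac : a < c) (hcb : c ≤ b) {k : ℝ} (hk : 0 ≤ k)
    (hk1 : k ≤ 1) {z : ℂ} (hz : ‖z‖ ≤ b) {w : ℝ}
    (hw : w = (radialCut a c z + k * (1 - radialCut a c z)) * Γ z *
      (2 * angularCoeff a c G z + fderiv ℝ (angularCoeff a c G) z z) - angularCoeff a c G z *
      fderiv ℝ (fun z => (radialCut a c z + k * (1 - radialCut a c z)) * Γ z) z z) :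
    0 ≤ w ∧ (0 < k ∨ ‖z‖ ≤ a → 0 < w) := by
  have e1 := h.fderiv_interpolation ha.le hac hk hk1 hz
  have e2 := h.angularCoeff_pos ha hac hcb z
  have e3 := h.angularCoeff_deriv ha hac hcb hz
  have e4 : 0 ≤ radialCut a c z := radialCut_nonneg z
  have e5 : 0 ≤ k * (1 - radialCut a c z) := mul_nonneg hk (sub_nonneg.2 (radialCut_le_one z))
  have e6 := mul_nonneg (mul_nonneg (add_nonneg e4 e5) (h.pos₁ z hz).le) e3
  have e7 := mul_nonpos_of_nonneg_of_nonpos e2.le e1.1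
  refine ⟨by linarith, fun hor => ?_⟩
  -- At the centre the radial derivatives vanish and the density is `2 Γ(0) Q(0) > 0`; elsewhere the
  -- strict decrease of the first coefficient is used.
  rcases eq_or_ne z 0 with rfl | hz0
  · have h0 : ‖(0 : ℂ)‖ ≤ a := by simpa using ha.le
    rw [hw, map_zero, map_zero, radialCut_eq_one ha.le hac h0]
    have := h.pos₁ 0 hz
    simp only [add_zero, sub_self, mul_zero, sub_zero]
    positivity
  · have := mul_neg_of_pos_of_neg e2 (e1.2 hz0 hor)
    linarith

end ModelBall

end

/-! ### Small perturbations, jointly open in the parameter and the point -/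

namespace OpenBookManifold

variable {W : Type*} [TopologicalSpace W] [ChartedSpace (EuclideanHalfSpace 2) W]
  [IsManifold (𝓡∂ 2) ∞ W]
  {B : Type*} {O : AbstractOpenBook W B} {M : Type*} [TopologicalSpace M]
  [ChartedSpace (EuclideanSpace ℝ (Fin 3)) M] [IsManifold (𝓡 3) ∞ M]

theorem eventually_prod_of_chart {Ψ : ℝ × ℂ → M} {x : ℝ × ℂ} (h : ImmersiveAt Ψ x)
    {R : ℝ → M → Prop} {t : ℝ} (hR : ∀ᶠ y : ℝ × (ℝ × ℂ) in 𝓝 (t, x), R y.1 (Ψ y.2)) :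
    ∀ᶠ z : ℝ × M in 𝓝 (t, Ψ x), R z.1 z.2 := by
  rw [nhds_prod_eq, ← h.map_nhds finrank_real_prod_complex, prod_map_right, ← nhds_prod_eq]
  exact hR

theorem PagePos.eventually_add_smul {P : OpenBookManifold O M} {β β' : OneForm M}
    (h : IsSmoothForm β) (h' : IsSmoothForm β') {p : M} (hβ : P.PagePos β p)
    (hp : ∀ i, p ∉ P.bindingComponent i) :
    ∀ᶠ z : ℝ × M in 𝓝 (0, p), P.PagePos (β + z.1 • β') z.2 := by
  obtain ⟨Ψ, e₁, e₂, x, h₁, h₂, rfl, hx⟩ := P.exists_pageChart hp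
  have hx0 := hx.self_of_nhds
  refine eventually_prod_of_chart (R := fun c q => P.PagePos (β + c • β') q) hx0.immersive ?_
  have c1 := continuousAt_dAt h hx0.immersive.smooth h₁ h₂
  have c2 := continuousAt_dAt h' hx0.immersive.smooth h₁ h₂
  have hs : Tendsto (Prod.snd : ℝ × (ℝ × ℂ) → ℝ × ℂ) (𝓝 (0, x)) (𝓝 x) := continuous_snd.tendsto _
  have c3 : ContinuousAt (fun z : ℝ × (ℝ × ℂ) => dAt (pullForm β Ψ) z.2 (e₁ z.2) (e₂ z.2) +
      z.1 * dAt (pullForm β' Ψ) z.2 (e₁ z.2) (e₂ z.2)) (0, x) :=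
    (c1.comp_of_eq (f := Prod.snd) continuous_snd.continuousAt rfl).add
      (continuous_fst.continuousAt.mul (c2.comp_of_eq (f := Prod.snd) continuous_snd.continuousAt rfl))
  have c4 := c3.eventually (lt_mem_nhds (a := 0) (by
    simpa using (hx0.pagePos_iff h).1 hβ))
  filter_upwards [c4, hs.eventually hx] with z hz hz'
  rw [hz'.pagePos_iff (h.add_smul h' _), dAt_pullForm_add_smul h h' _ hz'.immersive.smooth]
  exact hz

/-- Perturbing a closed form defining the pages by a form that is exact-positive on the pages. -/
theorem PagePos.eventually_contact {P : OpenBookManifold O M} {lam β : OneForm M}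
    (h : IsSmoothForm lam) (h' : IsSmoothForm β) {p : M} (hβ : P.PagePos β p)
    (hp : ∀ i, p ∉ P.bindingComponent i) (h0 : lam p ≠ 0) :
    ∀ᶠ z : ℝ × M in 𝓝 (0, p), z.1 ≠ 0 →
      (∀ u v, P.PageFrame z.2 u v → lam z.2 u = 0 ∧ lam z.2 v = 0) →
      (∀ u v, dForm lam z.2 u v = 0) → ∀ u v w : EuclideanSpace ℝ (Fin 3),
        LinearIndependent ℝ ![u, v, w] → wedgeForm (lam + z.1 • β) z.2 u v w ≠ 0 := by
  obtain ⟨Ψ, e₁, e₂, x, h₁, h₂, rfl, hx⟩ := P.exists_pageChart hp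
  have hx0 := hx.self_of_nhds
  refine eventually_prod_of_chart (R := fun c q => c ≠ 0 →
    (∀ u v, P.PageFrame q u v → lam q u = 0 ∧ lam q v = 0) → (∀ u v, dForm lam q u v = 0) →
      ∀ u v w : EuclideanSpace ℝ (Fin 3), LinearIndependent ℝ ![u, v, w] →
        wedgeForm (lam + c • β) q u v w ≠ 0) hx0.immersive ?_
  obtain ⟨e₃, he₃⟩ : ∃ e₃ : ℝ × ℂ, pullForm lam Ψ x e₃ ≠ 0 := by
    by_contra hcon
    push Not at hcon
    refine h0 (ContinuousLinearMap.ext fun v => ?_)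
    obtain ⟨(w : ℝ × ℂ), rfl⟩ := hx0.immersive.surjective finrank_real_prod_complex v
    exact hcon w
  have cl : ∀ {lam : OneForm M}, IsSmoothForm lam → ∀ {e : ℝ × ℂ → ℝ × ℂ}, Continuous e →
      ContinuousAt (fun z : ℝ × (ℝ × ℂ) => pullForm lam Ψ z.2 (e z.2)) (0, x) := fun hl _ he =>
    ((hl.contDiffAt_pullForm hx0.immersive.smooth).continuousAt.clm_apply
      he.continuousAt).comp_of_eq (f := Prod.snd) continuous_snd.continuousAt rfl
  have cd : ∀ {e e' : ℝ × ℂ → ℝ × ℂ}, Continuous e → Continuous e' →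
      ContinuousAt (fun z : ℝ × (ℝ × ℂ) => dAt (pullForm β Ψ) z.2 (e z.2) (e' z.2)) (0, x) :=
    fun he he' => (continuousAt_dAt h' hx0.immersive.smooth he he').comp_of_eq (f := Prod.snd)
      continuous_snd.continuousAt rfl
  have h₃ : Continuous fun _ : ℝ × ℂ => e₃ := continuous_const
  -- When `lam` is closed at the point and vanishes on the page, `(lam + sβ) ∧ d(lam + sβ)` is `s`
  -- times this function. It is continuous in `(s, y)` and nonzero at `s = 0`. The two conditions on
  -- `lam` are imposed at the point only, because a neighbourhood of `p` may contain points where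
  -- they fail.
  have cF := ((cl h h₃).mul (cd h₁ h₂)).add (continuous_fst.continuousAt.mul
    ((((cl h' h₁).mul (cd h₂ h₃)).sub ((cl h' h₂).mul (cd h₁ h₃))).add
      ((cl h' h₃).mul (cd h₁ h₂))))
  have hd0 := (hx0.pagePos_iff h').1 hβ
  have hne := cF.eventually_ne (y := 0) (by simpa using ⟨he₃, hd0.ne'⟩)
  have hs : Tendsto (Prod.snd : ℝ × (ℝ × ℂ) → ℝ × ℂ) (𝓝 (0, x)) (𝓝 x) := continuous_snd.tendsto _
  filter_upwards [hne, hs.eventually hx] with ⟨c, y⟩ hz hy hc hker hclosed u v w huvw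
  obtain ⟨k1, k2⟩ := hker _ _ hy.frame
  refine wedgeForm_ne_zero (e₁ := mfderiv 𝓘(ℝ, ℝ × ℂ) (𝓡 3) Ψ y (e₁ y))
    (e₂ := mfderiv 𝓘(ℝ, ℝ × ℂ) (𝓡 3) Ψ y (e₂ y))
    (e₃ := mfderiv 𝓘(ℝ, ℝ × ℂ) (𝓡 3) Ψ y e₃) ?_ huvw
  have hdl : ∀ a b : ℝ × ℂ, dForm (lam + c • β) (Ψ y) (mfderiv 𝓘(ℝ, ℝ × ℂ) (𝓡 3) Ψ y a)
      (mfderiv 𝓘(ℝ, ℝ × ℂ) (𝓡 3) Ψ y b) = c * dAt (pullForm β Ψ) y a b := by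
    intro a b
    rw [dForm_add_smul h h', hclosed, zero_add, dForm_mfderiv h' hy.immersive.smooth]
  have hl : ∀ a : ℝ × ℂ, (lam + c • β) (Ψ y) (mfderiv 𝓘(ℝ, ℝ × ℂ) (𝓡 3) Ψ y a) =
      pullForm lam Ψ y a + c * pullForm β Ψ y a := fun a => rfl
  have k1' : pullForm lam Ψ y (e₁ y) = 0 := k1
  have k2' : pullForm lam Ψ y (e₂ y) = 0 := k2
  unfold wedgeForm
  rw [hdl, hdl, hdl, hl, hl, hl, k1', k2']
  intro hcon
  refine mul_ne_zero hc hz ?_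
  simp only [Pi.add_apply, Pi.mul_apply, Pi.sub_apply]
  linear_combination hcon

end OpenBookManifold

/-! ### The confoliation form and the direction of the deformation -/

namespace OpenBookManifold

variable {W : Type*} [TopologicalSpace W] [ChartedSpace (EuclideanHalfSpace 2) W]
  [IsManifold (𝓡∂ 2) ∞ W]
  {B : Type*} {O : AbstractOpenBook W B} {M : Type*} [TopologicalSpace M]
  [ChartedSpace (EuclideanSpace ℝ (Fin 3)) M] [IsManifold (𝓡 3) ∞ M] [T2Space M] [Finite B]

theorem eventually_ne_nbhd (P : OpenBookManifold O M) {ρ : ℝ} (hρ : ρ < 1 + O.width) {p : M}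
    (hp : ∀ i x, ‖x.2‖ ≤ ρ → P.nbhd i x ≠ p) :
    ∀ᶠ q in 𝓝 p, ∀ i x, ‖x.2‖ ≤ ρ → P.nbhd i x ≠ q := by
  have hK : IsClosed (⋃ i, P.nbhd i '' (univ ×ˢ Metric.closedBall (0 : ℂ) ρ)) :=
    isClosed_iUnion_of_finite fun i =>
      (P.isCompact_nbhd_image i (isCompact_closedBall _ _) fun z hz => by
        have : ‖z‖ ≤ ρ := by simpa using hz
        linarith).isClosed
  have h4 : p ∉ ⋃ i, P.nbhd i '' (univ ×ˢ Metric.closedBall (0 : ℂ) ρ) := by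
    intro h
    obtain ⟨i, x, hx, rfl⟩ := mem_iUnion.1 h
    exact hp i x (by simpa using hx.2) rfl
  filter_upwards [hK.isOpen_compl.mem_nhds h4] with q hq i x hx h
  exact hq (mem_iUnion.2 ⟨i, x, ⟨mem_univ _, by simpa using hx⟩, h⟩)

theorem nbhd_ne_of_not_mem_tube (P : OpenBookManifold O M) {ρ ρ' : ℝ} (h : ρ < ρ') {p : M}
    (hp : p ∉ P.tube ρ') (i : B) (x : ℝ × ℂ) (hx : ‖x.2‖ ≤ ρ) : P.nbhd i x ≠ p := by
  rintro rfl
  exact hp ⟨i, x.1, x.2, hx.trans_lt h, rfl⟩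

variable {Γ G : B → ℂ → ℝ} {a b c d : ℝ}

/-- The confoliation form of the family. -/
theorem exists_baseForm (P : OpenBookManifold O M) (hb : b < 1)
    (h : ∀ i, ModelBall (Γ i) (G i) b) (ha : 0 < a) (hac : a < c) (hcd : c < d) (hdb : d ≤ b) :
    ∃ lam : OneForm M, IsSmoothForm lam ∧
      (∀ i x, ‖x.2‖ < 1 + O.width → pullForm lam (P.nbhd i) x =
        polarForm (fun z => radialCut a c z * Γ i z) (angularCoeff a c (G i)) x) ∧
      (∀ p, p ∉ P.tube d → ∀ u v, P.PageFrame p u v → lam p u = 0 ∧ lam p v = 0) ∧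
      (∀ p, p ∉ P.tube d → ∀ u v, dForm lam p u v = 0) ∧ ∀ p, lam p ≠ 0 := by
  have hw := O.width_pos
  have hcb : c ≤ b := hcd.le.trans hdb
  have hc1 : c < 1 := hcb.trans_lt hb
  -- The form is `α + η`: `α` extends `dφ` over the binding with coefficient `Q`, and `η = χΓ dθ` is
  -- supported in the closed tube of radius `c`.
  obtain ⟨α, hα1, hα2, hα3, hα4⟩ := P.exists_angularForm (Q := fun i => angularCoeff a c (G i)) hc1
    (fun i z hz => angularCoeff_of_ge ha.le hac hz)
    (fun i z _ => (h i).angularCoeff_pos ha hac hcb z)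
    (fun i z _ => contDiffAt_angularCoeff ha hac hc1 (h i).smooth₂ z)
  obtain ⟨η, hη1, hη2, hη3⟩ := P.exists_tubeForm (Γ := fun i z => radialCut a c z * Γ i z)
    (c := c) (by linarith) (fun i z _ => contDiffAt_radialCut_mul ha.le hac hc1 (h i).smooth₁ z)
    (fun i z hz => by rw [radialCut_eq_zero ha.le hac hz.le, zero_mul])
  have hpull : ∀ i x, ‖x.2‖ < 1 + O.width → pullForm (α + (1 : ℝ) • η) (P.nbhd i) x =
      polarForm (fun z => radialCut a c z * Γ i z) (angularCoeff a c (G i)) x := by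
    intro i x hx
    rw [pullForm_add_smul]
    show pullForm α (P.nbhd i) x + (1 : ℝ) • pullForm η (P.nbhd i) x = _
    rw [hα2 i x hx, hη2 i x hx]
    refine ContinuousLinearMap.ext fun v => ?_
    show polarForm 0 _ x v + (1 : ℝ) • polarForm _ 0 x v = _
    simp only [polarForm_apply, Pi.zero_apply, smul_eq_mul]
    ring
  have hη0 : ∀ p, p ∉ P.tube d → η p = 0 := fun p hp => hη3 p (P.nbhd_ne_of_not_mem_tube hcd hp)
  have hoff : ∀ p, p ∉ P.tube d → (α + (1 : ℝ) • η) p = α p := by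
    intro p hp
    have h1 := hη0 p hp
    show α p + (1 : ℝ) • η p = α p
    rw [h1, smul_zero, add_zero]
  have hd1 : d < 1 := hdb.trans_lt hb
  refine ⟨α + (1 : ℝ) • η, hα1.add_smul hη1 1, hpull, ?_, ?_, ?_⟩
  · intro p hp u v huv
    rcases P.pageFrame_cases huv with ⟨x, s, e, f, rfl, -, rfl, rfl⟩ | ⟨i, θ, z, rfl, hz, hz1, rfl, rfl⟩
    · rw [hoff _ hp]
      exact ⟨hα3 x s (e, 0), hα3 x s (f, 0)⟩
    · have hzw : ‖z‖ < 1 + O.width := by linarith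
      have hzd : d ≤ ‖z‖ := by
        by_contra hcon
        exact hp ⟨i, θ, z, not_le.1 hcon, rfl⟩
      have h1 := hpull i (θ, z) hzw
      have h2 := congrArg (fun L : ℝ × ℂ →L[ℝ] ℝ => L (1, 0)) h1
      have h3 := congrArg (fun L : ℝ × ℂ →L[ℝ] ℝ => L (0, z)) h1
      refine ⟨h2.trans ?_, h3.trans ?_⟩
      · rw [polarForm_apply, radialCut_eq_zero ha.le hac (hcd.le.trans hzd)]
        simp
      · rw [polarForm_apply, angular_apply]
        simp only
        ring
  · intro p hp u v
    -- The margin between `c` and `d` makes `η` vanish near `p` and not merely at `p`, so its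
    -- differential vanishes too.
    have h1 : ∀ᶠ q in 𝓝 p, η q = (0 : OneForm M) q := by
      filter_upwards [P.eventually_ne_nbhd (by linarith) (P.nbhd_ne_of_not_mem_tube hcd hp)]
        with q hq using hη3 q hq
    rw [dForm_add_smul hα1 hη1, hα4 p (P.nbhd_ne_of_not_mem_tube hcd hp), dForm_congr h1, dForm_zero]
    ring
  · intro p hp
    rcases P.cover p with ⟨⟨x, s⟩, rfl⟩ | ⟨i, θ, z, hz, rfl⟩
    · rw [hoff _ (P.fiber_not_mem_tube hd1 _)] at hp
      have h1 := hα3 x s (0, 1)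
      rw [hp] at h1
      exact one_ne_zero h1.symm
    · have hz1 : ‖z‖ < 1 := by simpa using hz
      have h1 := hpull i (θ, z) (show ‖z‖ < 1 + O.width by linarith)
      have h0 : pullForm (α + (1 : ℝ) • η) (P.nbhd i) (θ, z) = 0 := by
        refine ContinuousLinearMap.ext fun v => ?_
        rw [pullForm_apply, hp]
        rfl
      rw [h0] at h1
      rcases eq_or_ne z 0 with rfl | hz0
      · have h2 := congrArg (fun L : ℝ × ℂ →L[ℝ] ℝ => L (1, 0)) h1
        have h3 := (h i).pos₁ 0 (by simpa using (h i).pos.le)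
        simp only [polarForm_apply] at h2
        rw [radialCut_eq_one ha.le hac (by simpa using ha.le)] at h2
        simp at h2
        exact h3.ne h2
      -- Off the binding the form is tested on `∂φ`, where it takes the value `Qr² > 0`; on the
      -- binding it was tested on `∂θ`.
      · have h2 := congrArg (fun L : ℝ × ℂ →L[ℝ] ℝ => L (0, Complex.I * z)) h1
        have h3 := (h i).angularCoeff_pos ha hac hcb z
        have h4 : angular z (Complex.I * z) = ‖z‖ ^ 2 := by
          rw [angular_apply, ← Complex.normSq_eq_norm_sq, Complex.normSq_apply]
          simp
        simp only [polarForm_apply, h4] at h2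
        have h5 : 0 < ‖z‖ := norm_pos_iff.2 hz0
        simp at h2
        rcases h2 with h2 | h2
        · exact h3.ne' h2
        · exact hz0 h2

variable [CompactSpace W]

/-- The direction in which the confoliation form is deformed. -/
theorem exists_perturbation (P : OpenBookManifold O M) (hb : b < 1)
    (h : ∀ i, ModelBall (Γ i) (G i) b) {e f g : ℝ} (ha : 0 < a) (hac : a < c) (hcd : c < d)
    (hde : d < e) (hef : e < f) (hfg : f < g) (hgb : g ≤ b) :
    ∃ β : OneForm M, IsSmoothForm β ∧
      (∀ i x, ‖x.2‖ < d → pullForm β (P.nbhd i) x =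
        polarForm (fun z => (1 - radialCut a c z) * Γ i z) 0 x) ∧
      ∀ p, p ∉ P.tube d → P.PagePos β p := by
  have hw := O.width_pos
  have hf0 : 0 ≤ f := by linarith
  have hc1 : c < 1 := by linarith
  have hg1 : g < 1 := by linarith
  have he1 : e < 1 := by linarith
  have hd0 : 0 < d := by linarith
  -- Up to radius `f` this is the prescribed `(1 - χ)Γ`. From radius `d` on the first cutoff is
  -- over, so `V` is a nonincreasing cutoff times `Γ`, and it strictly decreases up to `e`.
  set V : B → ℂ → ℝ := fun i z => radialCut f g z * ((1 - radialCut a c z) * Γ i z) with hV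
  have hVs : ∀ i z, ContDiffAt ℝ ∞ (V i) z := fun i z =>
    contDiffAt_radialCut_mul hf0 hfg hg1 (fun z hz =>
      (contDiff_const.sub (contDiff_radialCut a c)).contDiffAt.mul ((h i).smooth₁ z hz)) z
  obtain ⟨η, hη1, hη2, hη3⟩ := P.exists_tubeForm (Γ := V) (c := g) (by linarith)
    (fun i z _ => hVs i z) (fun i z hz => by
      simp only [hV]
      rw [radialCut_eq_zero hf0 hfg hz.le, zero_mul])
  have hd : ∀ i x, ‖x.2‖ < 1 + O.width →
      dAt (pullForm η (P.nbhd i)) x (1, 0) (0, x.2) = -fderiv ℝ (V i) x.2 x.2 := by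
    intro i x hx
    have h4 : pullForm η (P.nbhd i) =ᶠ[𝓝 x] polarForm (V i) 0 := by
      filter_upwards [(isOpen_tubeDomain _).mem_nhds hx] with y hy using hη2 i y hy
    rw [dAt_congr h4, dAt_polarForm_page (Q := 0) ((hVs i _).differentiableAt (by simp))
      (differentiableAt_const 0)]
  have hVloc : ∀ i (z : ℂ), d ≤ ‖z‖ → V i =ᶠ[𝓝 z] fun z => radialCut f g z * Γ i z := by
    intro i z hz
    filter_upwards [continuous_norm.continuousAt.eventually (lt_mem_nhds (hcd.trans_le hz))]
      with w hw
    simp only [hV]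
    rw [radialCut_eq_zero ha.le hac hw.le, sub_zero, one_mul]
  have hne : ∀ x : ℝ × ℂ, d ≤ ‖x.2‖ → x.2 ≠ 0 := by
    intro x hx h0
    rw [h0, norm_zero] at hx
    linarith
  have hnn : ∀ p, p ∉ P.tube d → P.PageNonneg η p := by
    intro p hp
    by_cases hpn : ∃ i x, ‖x.2‖ < 1 + O.width ∧ P.nbhd i x = p
    · obtain ⟨i, x, hx, rfl⟩ := hpn
      rw [P.nbhd_mem_tube_iff (by linarith) hx, not_lt] at hp
      rw [(P.pageChart_nbhd i (hne x hp) hx).pageNonneg_iff hη1, hd i x hx]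
      refine neg_nonneg.2 ?_
      rcases le_or_gt ‖x.2‖ b with hxb | hxb
      · rw [(hVloc i x.2 hp).fderiv_eq]
        refine ((h i).fderiv_radialCut_mul_nonpos hf0 hfg hxb).trans ?_
        exact mul_nonpos_of_nonneg_of_nonpos (radialCut_nonneg _)
          ((h i).deriv₁ _ (hne x hp) (hxb.trans_lt hb)).le
      · have h1 : V i =ᶠ[𝓝 x.2] fun _ => 0 := by
          filter_upwards [continuous_norm.continuousAt.eventually
            (lt_mem_nhds (hgb.trans_lt hxb))] with w hw
          simp only [hV]
          rw [radialCut_eq_zero hf0 hfg hw.le, zero_mul]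
        rw [h1.fderiv_eq]
        simp
    · intro u v _
      have h5 : ∀ᶠ q in 𝓝 p, η q = (0 : OneForm M) q := by
        filter_upwards [P.eventually_ne_nbhd (ρ := g) (p := p) (by linarith) fun i x hx hxp =>
          hpn ⟨i, x, by linarith, hxp⟩] with q hq using hη3 q hq
      rw [dForm_congr h5, dForm_zero]
  have hpos : ∀ i x, d ≤ ‖x.2‖ → ‖x.2‖ ≤ e → P.PagePos η (P.nbhd i x) := by
    intro i x hx hxe
    rw [(P.pageChart_nbhd i (hne x hx) (by linarith)).pagePos_iff hη1, hd i x (by linarith),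
      (hVloc i x.2 hx).fderiv_eq]
    refine neg_pos.2 (((h i).fderiv_radialCut_mul_nonpos hf0 hfg (by linarith)).trans_lt ?_)
    rw [radialCut_eq_one hf0 hfg (by linarith), one_mul]
    exact (h i).deriv₁ _ (hne x hx) (by linarith)
  -- `β₀` is zero in the tube of radius `d` and positive off that of radius `e`, but has no sign in
  -- between. There `dη` is positive on a compact set, so a small multiple of `β₀` may be added.
  obtain ⟨β₀, hβ, hβ'⟩ := P.exists_tubeAdapted_pagePos hd0.le hde he1
  have hK : IsCompact (⋃ i, P.nbhd i '' (univ ×ˢ (Metric.closedBall (0 : ℂ) e \ Metric.ball 0 d))) :=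
    isCompact_iUnion fun i => P.isCompact_nbhd_image i
      ((isCompact_closedBall _ _).diff Metric.isOpen_ball) fun z hz => by
        have : ‖z‖ ≤ e := by simpa using hz.1
        linarith
  have hev := hK.eventually_forall_of_forall_eventually (x₀ := (0 : ℝ))
    (P := fun c p => P.PagePos (η + c • β₀) p) (fun p hp => by
      obtain ⟨i, x, hx, rfl⟩ := mem_iUnion.1 hp
      have h1 : ‖x.2‖ ≤ e := by simpa using hx.2.1
      have h2 : d ≤ ‖x.2‖ := by simpa using hx.2.2
      refine (hpos i x h2 h1).eventually_add_smul hη1 hβ.smooth ?_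
      rintro j ⟨θ, hθ⟩
      have h3 := (P.nbhd_eq_nbhd (θ' := x.1) (z' := x.2) (by simp; linarith) (by linarith) hθ).2.1
      exact hne x h2 h3.symm)
  obtain ⟨ε, hε, hε0⟩ := ((hev.filter_mono nhdsWithin_le_nhds).and
    (self_mem_nhdsWithin (s := Ioi (0 : ℝ)))).exists
  refine ⟨η + ε • β₀, hη1.add_smul hβ.smooth ε, ?_, ?_⟩
  · intro i x hx
    have h1 : pullForm β₀ (P.nbhd i) x = 0 := by
      refine ContinuousLinearMap.ext fun v => ?_
      rw [pullForm_apply, hβ.zero _ ⟨i, x.1, x.2, hx, rfl⟩]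
      rfl
    rw [pullForm_add_smul]
    show pullForm η (P.nbhd i) x + ε • pullForm β₀ (P.nbhd i) x = _
    rw [h1, smul_zero, add_zero, hη2 i x (by linarith)]
    refine ContinuousLinearMap.ext fun v => ?_
    simp only [polarForm_apply, hV]
    rw [radialCut_eq_one hf0 hfg (by linarith), one_mul]
  · intro p hp
    by_cases hpe : p ∈ P.tube e
    · obtain ⟨i, θ, z, hz, rfl⟩ := hpe
      refine hε _ (mem_iUnion.2 ⟨i, (θ, z), ⟨mem_univ _, ?_, ?_⟩, rfl⟩)
      · simpa using hz.le
      · intro hzd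
        exact hp ⟨i, θ, z, by simpa using hzd, rfl⟩
    · intro u v huv
      rw [dForm_add_smul hη1 hβ.smooth]
      exact add_pos_of_nonneg_of_pos (hnn p hp u v huv) (mul_pos hε0 (hβ' p hpe u v huv))

end OpenBookManifold

/-! ### The Reeb flow near the binding -/

/-- Used for the radial coefficients at the centre, where it gives vanishing first derivatives. -/
theorem fderiv_eq_zero_of_even {f : ℂ → ℝ} (hd : DifferentiableAt ℝ f 0)
    (he : ∀ᶠ z in 𝓝 0, f (-z) = f z) : fderiv ℝ f 0 = 0 := by
  have h1 : HasFDerivAt (fun z => f (-z)) (-fderiv ℝ f 0) 0 := by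
    have h2 : HasFDerivAt f (fderiv ℝ f 0) (-(0 : ℂ)) := by simpa using hd.hasFDerivAt
    have h3 := h2.comp (0 : ℂ) (hasFDerivAt_id (𝕜 := ℝ) (0 : ℂ)).neg
    simpa [Function.comp_def] using h3
  have h5 := ((EventuallyEq.hasFDerivAt_iff he).1 h1).unique hd.hasFDerivAt
  refine ContinuousLinearMap.ext fun v => ?_
  have h6 := congrArg (fun L : ℂ →L[ℝ] ℝ => L v) h5
  simp only [neg_apply] at h6
  simp only [zero_apply]
  linarith

/-- Radial coefficients `Γ`, `G`; `k` is the limit of `Γ'(r) / r` at the centre. -/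
structure ReebModel (Γ G : ℂ → ℝ) (b k : ℝ) : Prop extends ModelBall Γ G b where
  radial₁ : ∀ z w : ℂ, ‖z‖ = ‖w‖ → ‖w‖ < 1 → Γ z = Γ w
  radial₂ : ∀ z w : ℂ, ‖z‖ = ‖w‖ → ‖w‖ < 1 → G z = G w
  tendsto : Tendsto (fun z => fderiv ℝ Γ z z / ‖z‖ ^ 2) (𝓝[≠] 0) (𝓝 k)

/-- The density of `λ ∧ dλ` for `λ = Γ dθ + G Im(z̄ dz)`. -/
def reebDen (Γ G : ℂ → ℝ) (z : ℂ) : ℝ :=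
  Γ z * (2 * G z + fderiv ℝ G z z) - G z * fderiv ℝ Γ z z

/-- The `∂/∂θ`-component of the Reeb vector field. -/
def reebLong (Γ G : ℂ → ℝ) (z : ℂ) : ℝ := (2 * G z + fderiv ℝ G z z) / reebDen Γ G z

open Classical in
/-- The `∂/∂φ`-component of the Reeb vector field. -/
def reebRot (Γ G : ℂ → ℝ) (k : ℝ) (z : ℂ) : ℝ :=
  -(if z = 0 then k else fderiv ℝ Γ z z / ‖z‖ ^ 2) / reebDen Γ G z

/-- The Reeb vector field of `Γ dθ + G Im(z̄ dz)`. -/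
def reebField (Γ G : ℂ → ℝ) (k : ℝ) (z : ℂ) : ℝ × ℂ :=
  (reebLong Γ G z, reebRot Γ G k z • (Complex.I * z))

/-- The Reeb flow of `Γ dθ + G Im(z̄ dz)`. -/
def reebFlow (Γ G : ℂ → ℝ) (k t : ℝ) (x : ℝ × ℂ) : ℝ × ℂ :=
  (x.1 + t * reebLong Γ G x.2, Complex.exp ((reebRot Γ G k x.2 * t : ℝ) * Complex.I) * x.2)

/-! ### The explicit Reeb flow of a radial model -/

namespace ReebModel

variable {Γ G : ℂ → ℝ} {b k : ℝ} (h : ReebModel Γ G b k)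
include h

theorem reebDen_pos {z : ℂ} (hz : ‖z‖ ≤ b) : 0 < reebDen Γ G z := by
  have e1 := mul_pos (h.pos₁ z hz) (h.deriv₂ z hz)
  have e2 : G z * fderiv ℝ Γ z z ≤ 0 := by
    rcases eq_or_ne z 0 with rfl | hz0
    · simp
    · exact (mul_neg_of_pos_of_neg (h.pos₂ z hz) (h.deriv₁ z hz0 (hz.trans_lt h.lt_one))).le
  unfold reebDen
  linarith

theorem fderiv_zero : fderiv ℝ Γ 0 = 0 :=
  fderiv_eq_zero_of_even ((h.smooth₁ 0 (by simp)).differentiableAt (by simp)) (by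
    filter_upwards [Metric.ball_mem_nhds (0 : ℂ) one_pos] with z hz
    exact h.radial₁ _ _ (norm_neg z) (by simpa using hz))

theorem polarForm_reebField {x : ℝ × ℂ} (hx : ‖x.2‖ ≤ b) :
    polarForm Γ G x (reebField Γ G k x.2) = 1 := by
  have hden := (h.reebDen_pos hx).ne'
  obtain ⟨θ, z⟩ := x
  simp only at hx hden ⊢
  rw [polarForm_apply]
  simp only [reebField, reebLong, reebRot]
  have h1 : angular z (Complex.I * z) = ‖z‖ ^ 2 := by
    rw [angular_apply, ← Complex.normSq_eq_norm_sq, Complex.normSq_apply]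
    simp
  rw [map_smul, h1, smul_eq_mul]
  rcases eq_or_ne z 0 with rfl | hz0
  · unfold reebDen at hden ⊢
    simp at hden ⊢
    field_simp [hden]
  · rw [if_neg hz0]
    have hz1 : ‖z‖ ≠ 0 := norm_ne_zero_iff.2 hz0
    field_simp
    unfold reebDen
    ring

/-- At the centre `dΓ` and the rotation field vanish. Elsewhere the derivatives of `Γ` and `G` along
`iz` vanish, and the terms along `z` cancel by the choice of the ratio of the two components. -/
theorem dAt_reebField {x : ℝ × ℂ} (hx : ‖x.2‖ ≤ b) (v : ℝ × ℂ) :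
    dAt (polarForm Γ G) x (reebField Γ G k x.2) v = 0 := by
  have hden := (h.reebDen_pos hx).ne'
  have hx1 := hx.trans_lt h.lt_one
  have hΓd : DifferentiableAt ℝ Γ x.2 := (h.smooth₁ x.2 hx1).differentiableAt (by simp)
  have hGd : DifferentiableAt ℝ G x.2 := (h.smooth₂ x.2 hx1).differentiableAt (by simp)
  rw [dAt_polarForm hΓd hGd]
  obtain ⟨θ, z⟩ := x
  obtain ⟨s, w⟩ := v
  simp only at hx hx1 hden hΓd hGd ⊢
  simp only [reebField]
  rcases eq_or_ne z 0 with rfl | hz0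
  · rw [h.fderiv_zero]
    simp
  · have hz1 : ‖z‖ ≠ 0 := norm_ne_zero_iff.2 hz0
    have r1 := fderiv_radial hΓd (fun w hw => h.radial₁ w z hw hx1)
    have r2 := fderiv_radial hGd (fun w hw => h.radial₂ w z hw hx1)
    have h1 : angular z (Complex.I * z) = ‖z‖ ^ 2 := by
      rw [angular_apply, ← Complex.normSq_eq_norm_sq, Complex.normSq_apply]
      simp
    have h2 : angular (Complex.I * z) w = -(z.re * w.re + z.im * w.im) := by
      rw [angular_apply]; simp; ring
    have h3 : fderiv ℝ Γ z (Complex.I * z) = 0 := by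
      have := r1 (Complex.I * z)
      simp only [Complex.mul_re, Complex.mul_im, Complex.I_re, Complex.I_im] at this
      refine (mul_eq_zero.1 (this.trans (by ring))).resolve_left (by positivity)
    have h4 : fderiv ℝ G z (Complex.I * z) = 0 := by
      have := r2 (Complex.I * z)
      simp only [Complex.mul_re, Complex.mul_im, Complex.I_re, Complex.I_im] at this
      refine (mul_eq_zero.1 (this.trans (by ring))).resolve_left (by positivity)
    have h5 : fderiv ℝ Γ z w = (z.re * w.re + z.im * w.im) * fderiv ℝ Γ z z / ‖z‖ ^ 2 := by
      rw [eq_div_iff (by positivity), ← r1 w]; ring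
    have h6 : fderiv ℝ G z w = (z.re * w.re + z.im * w.im) * fderiv ℝ G z z / ‖z‖ ^ 2 := by
      rw [eq_div_iff (by positivity), ← r2 w]; ring
    rw [map_smul, map_smul, map_smul, map_smul, smul_apply, h1, h2, h3, h4, h5, h6]
    simp only [reebLong, reebRot, smul_eq_mul]
    rw [if_neg hz0]
    field_simp
    ring

/-- Both components are radial, hence constant along the flow; this is why the flow is given by a
closed formula. -/
theorem reeb_rotate {z u : ℂ} (hz : ‖z‖ < 1) (hu : ‖u‖ = 1) :
    reebLong Γ G (u * z) = reebLong Γ G z ∧ reebRot Γ G k (u * z) = reebRot Γ G k z := by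
  have hn : ‖u * z‖ = ‖z‖ := by rw [norm_mul, hu, one_mul]
  have hu0 : u ≠ 0 := norm_ne_zero_iff.1 (by rw [hu]; exact one_ne_zero)
  have hd1 : fderiv ℝ Γ (u * z) (u * z) = fderiv ℝ Γ z z :=
    fderiv_apply_self_rotate ((h.smooth₁ _ (hn.trans_lt hz)).differentiableAt (by simp)) (by
      filter_upwards [continuous_norm.continuousAt.eventually (gt_mem_nhds hz)] with w hw
      exact h.radial₁ _ _ (by rw [norm_mul, hu, one_mul]) hw)
  have hd2 : fderiv ℝ G (u * z) (u * z) = fderiv ℝ G z z :=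
    fderiv_apply_self_rotate ((h.smooth₂ _ (hn.trans_lt hz)).differentiableAt (by simp)) (by
      filter_upwards [continuous_norm.continuousAt.eventually (gt_mem_nhds hz)] with w hw
      exact h.radial₂ _ _ (by rw [norm_mul, hu, one_mul]) hw)
  have e1 := h.radial₁ _ _ hn hz
  have e2 := h.radial₂ _ _ hn hz
  have hden : reebDen Γ G (u * z) = reebDen Γ G z := by
    unfold reebDen; rw [hd1, hd2, e1, e2]
  have hz0 : u * z = 0 ↔ z = 0 := by simp [hu0]
  refine ⟨?_, ?_⟩
  · unfold reebLong; rw [hden, hd2, e2]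
  · unfold reebRot
    rw [hden, hd1, hn]
    simp only [hz0]

theorem norm_reebFlow (t : ℝ) (x : ℝ × ℂ) : ‖(reebFlow Γ G k t x).2‖ = ‖x.2‖ := by
  simp only [reebFlow]
  rw [norm_mul, Complex.norm_exp_ofReal_mul_I, one_mul]

theorem hasDerivAt_reebFlow {x : ℝ × ℂ} (hx : ‖x.2‖ < 1) (t : ℝ) :
    HasDerivAt (fun t => reebFlow Γ G k t x) (reebField Γ G k (reebFlow Γ G k t x).2) t := by
  obtain ⟨e1, e2⟩ := h.reeb_rotate (u := Complex.exp ((reebRot Γ G k x.2 * t : ℝ) * Complex.I)) hx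
    (Complex.norm_exp_ofReal_mul_I _)
  have h1 : HasDerivAt (fun t : ℝ => x.1 + t * reebLong Γ G x.2) (reebLong Γ G x.2) t := by
    simpa using ((hasDerivAt_id t).mul_const (reebLong Γ G x.2)).const_add x.1
  have h2 : HasDerivAt (fun t : ℝ => Complex.exp ((reebRot Γ G k x.2 * t : ℝ) * Complex.I) * x.2)
      (reebRot Γ G k x.2 • (Complex.I *
        (Complex.exp ((reebRot Γ G k x.2 * t : ℝ) * Complex.I) * x.2))) t := by
    have h3 : HasDerivAt (fun s : ℂ => Complex.exp (reebRot Γ G k x.2 * s * Complex.I) * x.2)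
        (Complex.exp (reebRot Γ G k x.2 * t * Complex.I) * (reebRot Γ G k x.2 * Complex.I) * x.2)
        (t : ℂ) := by
      have := ((((hasDerivAt_id (t : ℂ)).const_mul (reebRot Γ G k x.2 : ℂ)).mul_const
        Complex.I).cexp).mul_const x.2
      simpa using this
    have h4 := h3.comp_ofReal
    convert h4 using 1
    · ext s; push_cast; rfl
    · rw [Complex.real_smul]; push_cast; ring
  have h5 := h1.prodMk h2
  unfold reebField
  simp only [reebFlow]
  rw [e1, e2]
  exact h5

theorem reebLong_zero : reebLong Γ G 0 = (Γ 0)⁻¹ := by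
  have h0 : ‖(0 : ℂ)‖ ≤ b := by simpa using h.pos.le
  have e1 := (h.pos₁ 0 h0).ne'
  have e2 := (h.pos₂ 0 h0).ne'
  unfold reebLong reebDen
  simp
  field_simp

/-- For a local model `k = γ₁''(0)` and `2G(0) = γ₂''(0)`, so over the period `2πΓ(0)` the rotation
angle is `-2πκ`. -/
theorem reebRot_zero : reebRot Γ G k 0 = -(k / (2 * G 0)) * (Γ 0)⁻¹ := by
  have h0 : ‖(0 : ℂ)‖ ≤ b := by simpa using h.pos.le
  have e1 := (h.pos₁ 0 h0).ne'
  have e2 := (h.pos₂ 0 h0).ne'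
  unfold reebRot reebDen
  simp
  field_simp

theorem contDiffAt_reeb : ContDiffAt ℝ 1 (reebDen Γ G) 0 ∧ ContDiffAt ℝ 1 (reebLong Γ G) 0 := by
  have h0 : ‖(0 : ℂ)‖ ≤ b := by simpa using h.pos.le
  have h1 := h.smooth₁ 0 (by simp)
  have h2 := h.smooth₂ 0 (by simp)
  have d1 : ContDiffAt ℝ 1 (fun z => fderiv ℝ Γ z z) 0 :=
    (h1.fderiv_right (m := 1) (by norm_cast)).clm_apply contDiffAt_id
  have d2 : ContDiffAt ℝ 1 (fun z => fderiv ℝ G z z) 0 :=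
    (h2.fderiv_right (m := 1) (by norm_cast)).clm_apply contDiffAt_id
  have h1' : ContDiffAt ℝ 1 Γ 0 := h1.of_le (by exact_mod_cast le_top)
  have h2' : ContDiffAt ℝ 1 G 0 := h2.of_le (by exact_mod_cast le_top)
  have d3 : ContDiffAt ℝ 1 (fun z => 2 * G z + fderiv ℝ G z z) 0 := (contDiffAt_const.mul h2').add d2
  have d4 : ContDiffAt ℝ 1 (reebDen Γ G) 0 := (h1'.mul d3).sub (h2'.mul d1)
  exact ⟨d4, d3.div d4 (h.reebDen_pos h0).ne'⟩

/-- The value at the centre is set to the limit `k`. Continuity is all that the linearization of the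
flow requires. -/
theorem continuousAt_reebRot : ContinuousAt (reebRot Γ G k) 0 := by
  have h0 : ‖(0 : ℂ)‖ ≤ b := by simpa using h.pos.le
  have h1 : ContinuousAt (Function.update (fun z => fderiv ℝ Γ z z / ‖z‖ ^ 2) 0 k) 0 :=
    continuousAt_update_same.2 h.tendsto
  have h2 := h1.neg.div h.contDiffAt_reeb.1.continuousAt (h.reebDen_pos h0).ne'
  refine h2.congr (Eventually.of_forall fun z => ?_)
  simp only [Pi.neg_apply, Pi.div_apply, reebRot, Function.update_apply]

/-- The linearization of the flow along the core circle. -/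
theorem hasFDerivAt_reebFlow (t : ℝ) :
    HasFDerivAt (reebFlow Γ G k t) ((ContinuousLinearMap.fst ℝ ℝ ℂ).prod
        (Complex.exp ((reebRot Γ G k 0 * t : ℝ) * Complex.I) • ContinuousLinearMap.snd ℝ ℝ ℂ))
      (0, 0) := by
  have hd : DifferentiableAt ℝ (reebLong Γ G) 0 := h.contDiffAt_reeb.2.differentiableAt (by simp)
  -- The longitudinal speed is even, so to first order the time-`t` map shears nothing into the `θ`
  -- direction.
  have h0 : fderiv ℝ (reebLong Γ G) 0 = 0 := fderiv_eq_zero_of_even hd (by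
    filter_upwards [Metric.ball_mem_nhds (0 : ℂ) one_pos] with z hz
    have := (h.reeb_rotate (z := z) (u := -1) (by simpa using hz) (by simp)).1
    rwa [neg_one_mul] at this)
  have h1 : HasFDerivAt (reebLong Γ G) (0 : ℂ →L[ℝ] ℝ) ((0, 0) : ℝ × ℂ).2 := h0 ▸ hd.hasFDerivAt
  refine HasFDerivAt.prodMk ?_ ?_
  · have h2 := (h1.comp ((0, 0) : ℝ × ℂ) hasFDerivAt_snd).const_mul t
    have h3 := (hasFDerivAt_fst (𝕜 := ℝ) (p := ((0, 0) : ℝ × ℂ))).add h2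
    rw [ContinuousLinearMap.zero_comp, smul_zero, add_zero] at h3
    exact h3
  · set f : ℂ → ℂ := fun z => Complex.exp ((reebRot Γ G k z * t : ℝ) * Complex.I) with hf
    have hfc : ContinuousAt f 0 := by
      have h3 := h.continuousAt_reebRot
      have h4 : ContinuousAt (fun z => ((reebRot Γ G k z * t : ℝ) : ℂ)) 0 :=
        Complex.continuous_ofReal.continuousAt.comp (h3.mul continuousAt_const)
      exact (h4.mul continuousAt_const).cexp
    -- The product of a merely continuous `f` with `z` is differentiable at `0`, because `(f z - f
    -- 0) z = o(z)`.
    have h5 : HasFDerivAt (fun z => f z * z) (f 0 • ContinuousLinearMap.id ℝ ℂ)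
        ((0, 0) : ℝ × ℂ).2 := by
      rw [hasFDerivAt_iff_isLittleO_nhds_zero]
      simp only [zero_add, mul_zero, sub_zero]
      have h6 : (fun z => f z - f 0) =o[𝓝 0] (fun _ => (1 : ℂ)) := by
        rw [Asymptotics.isLittleO_one_iff]
        simpa using hfc.tendsto.sub_const (f 0)
      have h7 := h6.mul_isBigO (Asymptotics.isBigO_refl (fun z : ℂ => z) (𝓝 0))
      refine (h7.congr (fun z => ?_) (fun z => one_mul z))
      simp
      ring
    exact h5.comp ((0, 0) : ℝ × ℂ) hasFDerivAt_snd

end ReebModel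

/-- The characteristic polynomial is `(X - 1)(X - u)(X - ū)`. -/
theorem norm_eq_one_of_isRoot_charpoly {u : ℂ} (hu : ‖u‖ = 1) {μ : ℂ}
    (h : ((LinearMap.prodMap (LinearMap.id : ℝ →ₗ[ℝ] ℝ) (LinearMap.mulLeft ℝ u)).charpoly.map
      (algebraMap ℝ ℂ)).IsRoot μ) : ‖μ‖ = 1 := by
  have h1 : (LinearMap.mulLeft ℝ u).charpoly =
      Polynomial.X ^ 2 - Polynomial.C (2 * u.re) * Polynomial.X + Polynomial.C 1 := by
    rw [← LinearMap.charpoly_toMatrix _ Complex.basisOneI]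
    have h2 : LinearMap.toMatrix Complex.basisOneI Complex.basisOneI (LinearMap.mulLeft ℝ u) =
        !![u.re, -u.im; u.im, u.re] := by
      ext i j
      fin_cases i <;> fin_cases j <;> simp [LinearMap.toMatrix_apply]
    rw [h2, Matrix.charpoly_fin_two, Matrix.trace_fin_two, Matrix.det_fin_two]
    have h3 : u.re * u.re - -u.im * u.im = 1 := by
      have := Complex.normSq_eq_norm_sq u
      rw [Complex.normSq_apply, hu] at this
      linarith
    simp only [Matrix.of_apply, Matrix.cons_val', Matrix.cons_val_zero, Matrix.cons_val_one,
      Matrix.cons_val_fin_one, h3]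
    rw [two_mul]
  have h2 : (LinearMap.id : ℝ →ₗ[ℝ] ℝ).charpoly = Polynomial.X - Polynomial.C 1 := by
    rw [← LinearMap.charpoly_toMatrix _ (Module.Basis.singleton Unit ℝ), LinearMap.toMatrix_id,
      Matrix.charpoly_one]
    simp
  rw [LinearMap.charpoly_prodMap, h1, h2, Polynomial.IsRoot.def] at h
  simp at h
  have hcu : u * (starRingEnd ℂ) u = 1 := by
    rw [Complex.mul_conj, Complex.normSq_eq_norm_sq, hu]; simp
  have hsum : u + (starRingEnd ℂ) u = 2 * (u.re : ℂ) := by rw [Complex.add_conj]; push_cast; ring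
  rcases h with h | h
  · rw [sub_eq_zero.1 h]; simp
  · have h3 : (μ - u) * (μ - (starRingEnd ℂ) u) = 0 := by
      linear_combination h - μ * hsum + hcu
    rcases mul_eq_zero.1 h3 with h4 | h4
    · rw [sub_eq_zero.1 h4, hu]
    · rw [sub_eq_zero.1 h4, Complex.norm_conj, hu]

theorem ImmersiveAt.mfderiv_linearEquiv {M : Type*} [TopologicalSpace M]
    [ChartedSpace (EuclideanSpace ℝ (Fin 3)) M] {Ψ : ℝ × ℂ → M} {x : ℝ × ℂ} (h : ImmersiveAt Ψ x) :
    ∃ e : (ℝ × ℂ) ≃ₗ[ℝ] EuclideanSpace ℝ (Fin 3), ∀ v,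
      e v = mfderiv 𝓘(ℝ, ℝ × ℂ) (𝓡 3) Ψ x v := by
  let D : ℝ × ℂ →L[ℝ] EuclideanSpace ℝ (Fin 3) := mfderiv 𝓘(ℝ, ℝ × ℂ) (𝓡 3) Ψ x
  have hD : Function.Injective D := h.injective
  exact ⟨LinearEquiv.ofInjectiveOfFinrankEq D.toLinearMap hD
    (by rw [finrank_real_prod_complex, finrank_euclideanSpace_fin]), fun v => rfl⟩

/-! ### The components of the binding as Reeb orbits -/

namespace OpenBookManifold

variable {W : Type*} [TopologicalSpace W] [ChartedSpace (EuclideanHalfSpace 2) W]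
  [IsManifold (𝓡∂ 2) ∞ W]
  {B : Type*} {O : AbstractOpenBook W B} {M : Type*} [TopologicalSpace M]
  [ChartedSpace (EuclideanSpace ℝ (Fin 3)) M] [IsManifold (𝓡 3) ∞ M]
  {Γ G : ℂ → ℝ} {b k a : ℝ} {lam : OneForm M} {i : B}

theorem wedgeForm_nbhd {P : OpenBookManifold O M} (hl : IsSmoothForm lam) {x : ℝ × ℂ}
    (hx : ‖x.2‖ < 1 + O.width) (hpull : pullForm lam (P.nbhd i) =ᶠ[𝓝 x] polarForm Γ G)
    (hΓ : DifferentiableAt ℝ Γ x.2) (hG : DifferentiableAt ℝ G x.2) :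
    wedgeForm lam (P.nbhd i x) (mfderiv 𝓘(ℝ, ℝ × ℂ) (𝓡 3) (P.nbhd i) x ((1, 0) : ℝ × ℂ))
      (mfderiv 𝓘(ℝ, ℝ × ℂ) (𝓡 3) (P.nbhd i) x ((0, 1) : ℝ × ℂ))
      (mfderiv 𝓘(ℝ, ℝ × ℂ) (𝓡 3) (P.nbhd i) x ((0, Complex.I) : ℝ × ℂ)) =
      Γ x.2 * (2 * G x.2 + fderiv ℝ G x.2 x.2) - G x.2 * fderiv ℝ Γ x.2 x.2 := by
  have hs := (P.immersiveAt_nbhd i hx).smooth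
  have h1 : ∀ v : ℝ × ℂ, lam (P.nbhd i x) (mfderiv 𝓘(ℝ, ℝ × ℂ) (𝓡 3) (P.nbhd i) x v) =
      polarForm Γ G x v := fun v =>
    congrArg (fun L : ℝ × ℂ →L[ℝ] ℝ => L v) hpull.self_of_nhds
  unfold wedgeForm
  rw [dForm_mfderiv hl hs, dForm_mfderiv hl hs, dForm_mfderiv hl hs, dAt_congr hpull,
    dAt_congr hpull, dAt_congr hpull, h1, h1, h1, wedge_polarForm hΓ hG]

/-- The Reeb vector field of a form that is a local model near the binding. -/
theorem reeb_nbhd {P : OpenBookManifold O M} (h : ReebModel Γ G b k) (hl : IsSmoothForm lam)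
    (hab : a ≤ b) (hpull : ∀ x, ‖x.2‖ < a → pullForm lam (P.nbhd i) x = polarForm Γ G x)
    {U : Set M} (hU : IsContactOn lam U) {X : ∀ p : M, TangentSpace (𝓡 3) p}
    (hX : IsReebOn lam X U) {x : ℝ × ℂ} (hx : ‖x.2‖ < a) (hxU : P.nbhd i x ∈ U) :
    X (P.nbhd i x) = mfderiv 𝓘(ℝ, ℝ × ℂ) (𝓡 3) (P.nbhd i) x (reebField Γ G k x.2) := by
  have hxw : ‖x.2‖ < 1 + O.width := by linarith [O.width_pos, h.lt_one]
  have hi := P.immersiveAt_nbhd i hxw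
  have hev : pullForm lam (P.nbhd i) =ᶠ[𝓝 x] polarForm Γ G := by
    filter_upwards [(isOpen_tubeDomain a).mem_nhds hx] with y hy using hpull y hy
  refine hX.unique hU hxU ?_ fun v => ?_
  · have h1 := congrArg (fun L : ℝ × ℂ →L[ℝ] ℝ => L (reebField Γ G k x.2)) (hpull x hx)
    exact h1.trans (h.polarForm_reebField (hx.le.trans hab))
  · obtain ⟨(w : ℝ × ℂ), rfl⟩ := hi.surjective finrank_real_prod_complex v
    refine (dForm_mfderiv hl hi.smooth _ w).trans ?_
    rw [dAt_congr hev]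
    exact h.dAt_reebField (hx.le.trans hab) w

/-- The model flow preserves `|z|`, so it stays in the tube where the form is the local model, and
`nbhd` carries it to integral curves of `X` for all times. -/
theorem hasMFDerivAt_reebFlow {P : OpenBookManifold O M} (h : ReebModel Γ G b k)
    (hl : IsSmoothForm lam) (hab : a ≤ b)
    (hpull : ∀ x, ‖x.2‖ < a → pullForm lam (P.nbhd i) x = polarForm Γ G x)
    {U : Set M} (hU : IsContactOn lam U) {X : ∀ p : M, TangentSpace (𝓡 3) p}
    (hX : IsReebOn lam X U) (haU : ∀ x : ℝ × ℂ, ‖x.2‖ < a → P.nbhd i x ∈ U) {x : ℝ × ℂ}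
    (hx : ‖x.2‖ < a) (t : ℝ) :
    HasMFDerivAt 𝓘(ℝ, ℝ) (𝓡 3) (fun t => P.nbhd i (reebFlow Γ G k t x)) t
      ((1 : ℝ →L[ℝ] ℝ).smulRight (X (P.nbhd i (reebFlow Γ G k t x)))) := by
  have hn := h.norm_reebFlow t x
  have hxw : ‖x.2‖ < 1 + O.width := by linarith [O.width_pos, h.lt_one]
  have hx1 : ‖x.2‖ < 1 := by linarith [h.lt_one]
  have h1 := (P.immersiveAt_nbhd i (hn ▸ hxw)).mdifferentiableAt.hasMFDerivAt
  have h2 := (h.hasDerivAt_reebFlow hx1 t).hasFDerivAt.hasMFDerivAt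
  have h3 := HasMFDerivAt.comp t h1 h2
  have h4 := reeb_nbhd h hl hab hpull hU hX (hn ▸ hx) (haU _ (hn ▸ hx))
  let D : ℝ × ℂ →L[ℝ] EuclideanSpace ℝ (Fin 3) :=
    mfderiv 𝓘(ℝ, ℝ × ℂ) (𝓡 3) (P.nbhd i) (reebFlow Γ G k t x)
  have h5 : ∀ s : ℝ, s • (X (P.nbhd i (reebFlow Γ G k t x)) : EuclideanSpace ℝ (Fin 3)) =
      D (s • reebField Γ G k (reebFlow Γ G k t x).2) := fun s =>
    ((map_smul D s _).trans (congrArg (fun v : EuclideanSpace ℝ (Fin 3) => s • v) h4.symm)).symm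
  have h6 : (1 : ℝ →L[ℝ] ℝ).smulRight
      (X (P.nbhd i (reebFlow Γ G k t x)) : EuclideanSpace ℝ (Fin 3)) =
      D.comp (ContinuousLinearMap.toSpanSingleton ℝ (reebField Γ G k (reebFlow Γ G k t x).2)) :=
    ContinuousLinearMap.ext h5
  have h7 : ∀ A : ℝ →L[ℝ] EuclideanSpace ℝ (Fin 3),
      A = D.comp (ContinuousLinearMap.toSpanSingleton ℝ (reebField Γ G k (reebFlow Γ G k t x).2)) →
      HasMFDerivAt 𝓘(ℝ, ℝ) (𝓡 3) (fun t => P.nbhd i (reebFlow Γ G k t x)) t A := by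
    rintro _ rfl
    exact h3
  exact h7 _ h6

theorem reebFlow_zero_right (t θ : ℝ) :
    reebFlow Γ G k t (θ, 0) = (θ + t * reebLong Γ G 0, 0) := by
  simp [reebFlow]

theorem isPeriodicOrbit_bindingComponent {P : OpenBookManifold O M} (h : ReebModel Γ G b k)
    (hl : IsSmoothForm lam) (ha : 0 < a) (hab : a ≤ b)
    (hpull : ∀ x, ‖x.2‖ < a → pullForm lam (P.nbhd i) x = polarForm Γ G x)
    (hU : IsContactOn lam univ) {X : ∀ p : M, TangentSpace (𝓡 3) p} (hX : IsReebOn lam X univ) :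
    IsPeriodicOrbit X (P.bindingComponent i) := by
  have h0 : 0 < Γ 0 := h.pos₁ 0 (by simpa using h.pos.le)
  have hflow : ∀ t, reebFlow Γ G k t (0, 0) = (t * (Γ 0)⁻¹, 0) := by
    intro t
    rw [reebFlow_zero_right, h.reebLong_zero, zero_add]
  have hz : ‖(0 : ℂ)‖ < 1 + O.width := by
    rw [norm_zero]; linarith [O.width_pos]
  -- On the core circle `θ` moves with speed `1 / Γ(0)`, so one turn takes the time `2πΓ(0)`.
  refine ⟨fun t => P.nbhd i (reebFlow Γ G k t (0, 0)), 2 * Real.pi * Γ 0, by positivity,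
    fun t => hasMFDerivAt_reebFlow h hl hab hpull hU hX (fun _ _ => mem_univ _) (by simpa using ha) t,
    fun t => ?_, ?_⟩
  · simp only [hflow]
    have h1 := P.nbhd_add_zmul i 1 (t * (Γ 0)⁻¹) hz
    rw [← h1]
    congr 2
    field_simp
    push_cast
    ring
  · ext p
    constructor
    · rintro ⟨t, rfl⟩
      exact ⟨t * (Γ 0)⁻¹, by simp only [hflow]⟩
    · rintro ⟨θ, rfl⟩
      refine ⟨θ * Γ 0, ?_⟩
      simp only [hflow]
      rw [mul_inv_cancel_right₀ h0.ne']

theorem isNondegenerateEllipticOrbit_bindingComponent {P : OpenBookManifold O M}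
    (h : ReebModel Γ G b k) (hk : ∀ n : ℤ, k / (2 * G 0) ≠ n) (hl : IsSmoothForm lam) (ha : 0 < a)
    (hab : a ≤ b) (hpull : ∀ x, ‖x.2‖ < a → pullForm lam (P.nbhd i) x = polarForm Γ G x) :
    IsNondegenerateEllipticOrbit lam (P.bindingComponent i) := by
  have h0 : 0 < Γ 0 := h.pos₁ 0 (by simpa using h.pos.le)
  have hw := O.width_pos
  have ha1 : a < 1 := hab.trans_lt h.lt_one
  have hlt : ∀ x : ℝ × ℂ, ‖x.2‖ < a → ‖x.2‖ < 1 + O.width := fun x hx => by linarith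
  set U : Set M := P.nbhd i '' {x | ‖x.2‖ < a} with hU
  have hUo : IsOpen U := by
    refine isOpen_iff_mem_nhds.2 ?_
    rintro _ ⟨x, hx, rfl⟩
    rw [← (P.immersiveAt_nbhd i (hlt x hx)).map_nhds finrank_real_prod_complex]
    exact image_mem_map ((isOpen_tubeDomain a).mem_nhds hx)
  have hUc : IsContactOn lam U := by
    rintro _ ⟨x, hx, rfl⟩ u v w huvw
    have hx1 : ‖x.2‖ < 1 := lt_trans hx ha1
    have h1 := wedgeForm_nbhd (i := i) (P := P) hl (hlt x hx)
      (by filter_upwards [(isOpen_tubeDomain a).mem_nhds hx] with y hy using hpull y hy)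
      ((h.smooth₁ x.2 hx1).differentiableAt (by simp))
      ((h.smooth₂ x.2 hx1).differentiableAt (by simp))
    refine wedgeForm_ne_zero
      (e₁ := mfderiv 𝓘(ℝ, ℝ × ℂ) (𝓡 3) (P.nbhd i) x ((1, 0) : ℝ × ℂ))
      (e₂ := mfderiv 𝓘(ℝ, ℝ × ℂ) (𝓡 3) (P.nbhd i) x ((0, 1) : ℝ × ℂ))
      (e₃ := mfderiv 𝓘(ℝ, ℝ × ℂ) (𝓡 3) (P.nbhd i) x ((0, Complex.I) : ℝ × ℂ)) (fun hcon => ?_) huvw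
    have := h.reebDen_pos ((show ‖x.2‖ < a from hx).le.trans hab)
    rw [reebDen, ← h1] at this
    exact this.ne' hcon
  obtain ⟨X, hX⟩ := hUc.exists_reeb
  have haU : ∀ x : ℝ × ℂ, ‖x.2‖ < a → P.nbhd i x ∈ U := fun x hx => ⟨x, hx, rfl⟩
  -- The model flow commutes with translations of `θ` by `2π`, so it descends to the tube in `M`;
  -- outside the tube the value is irrelevant.
  have hex : ∀ (t : ℝ) (p : M), ∃ q : M, ∀ x : ℝ × ℂ, ‖x.2‖ < a → P.nbhd i x = p →
      q = P.nbhd i (reebFlow Γ G k t x) := by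
    intro t p
    by_cases hp : p ∈ U
    · obtain ⟨x, hx, rfl⟩ := hp
      refine ⟨P.nbhd i (reebFlow Γ G k t x), fun y hy hxy => ?_⟩
      obtain ⟨θ, z⟩ := x
      obtain ⟨θ', z'⟩ := y
      obtain ⟨-, rfl, n, rfl⟩ := P.nbhd_eq_nbhd (hlt _ hy) (hlt _ hx) hxy
      have h1 := P.nbhd_add_zmul i n (reebFlow Γ G k t (θ', z')).1
        (z := (reebFlow Γ G k t (θ', z')).2) (by
          rw [h.norm_reebFlow]; exact hlt _ hy)
      refine Eq.trans ?_ h1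
      congr 1
      simp only [reebFlow]
      rw [add_right_comm]
    · exact ⟨p, fun x hx hxp => absurd ⟨x, hx, hxp⟩ hp⟩
  choose Φ hΦ using hex
  have hΦn : ∀ t (x : ℝ × ℂ), ‖x.2‖ < a → Φ t (P.nbhd i x) = P.nbhd i (reebFlow Γ G k t x) :=
    fun t x hx => hΦ t _ x hx rfl
  have hz : ‖((0, 0) : ℝ × ℂ).2‖ < a := by simpa using ha
  have hflow : ∀ t, reebFlow Γ G k t (0, 0) = (t * (Γ 0)⁻¹, 0) := by
    intro t
    rw [reebFlow_zero_right, h.reebLong_zero, zero_add]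
  set T := 2 * Real.pi * Γ 0 with hT
  have hTpos : 0 < T := by positivity
  have hTflow : reebFlow Γ G k T (0, 0) = ((0 : ℝ) + (1 : ℤ) * (2 * Real.pi), 0) := by
    rw [hflow, hT]
    congr 1
    push_cast
    field_simp
    ring
  have hTp : P.nbhd i (reebFlow Γ G k T (0, 0)) = P.nbhd i (0, 0) := by
    rw [hTflow]; exact P.nbhd_add_zmul i 1 0 (hlt _ hz)
  have him := P.immersiveAt_nbhd i (hlt _ hz)
  have hcomp : Φ T ∘ P.nbhd i =ᶠ[𝓝 (0, 0)] P.nbhd i ∘ reebFlow Γ G k T := by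
    filter_upwards [(isOpen_tubeDomain a).mem_nhds hz] with x hx using hΦn T x hx
  have hfl := h.hasFDerivAt_reebFlow T
  have him' := P.immersiveAt_nbhd i (x := reebFlow Γ G k T (0, 0))
    (by rw [h.norm_reebFlow]; exact hlt _ hz)
  have hmd : MDifferentiableAt (𝓡 3) (𝓡 3) (Φ T) (P.nbhd i (0, 0)) := by
    refine him.mdifferentiableAt_of_comp finrank_real_prod_complex ?_
    exact (MDifferentiableAt.comp ((0, 0) : ℝ × ℂ) him'.mdifferentiableAt
      hfl.differentiableAt.mdifferentiableAt).congr_of_eventuallyEq hcomp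
  set u : ℂ := Complex.exp ((reebRot Γ G k 0 * T : ℝ) * Complex.I) with hu
  have hun : ‖u‖ = 1 := Complex.norm_exp_ofReal_mul_I _
  -- `u = exp(-2πiκ')` with `κ' = k / (2G(0))`, so `u = 1` would make `κ'` an integer.
  have hu1 : u ≠ 1 := by
    intro hcon
    rw [hu, Complex.exp_eq_one_iff] at hcon
    obtain ⟨n, hn⟩ := hcon
    have h1 : reebRot Γ G k 0 * T = n * (2 * Real.pi) := by
      have h2 : ((reebRot Γ G k 0 * T : ℝ) : ℂ) = ((n * (2 * Real.pi) : ℝ) : ℂ) := by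
        refine mul_right_cancel₀ Complex.I_ne_zero (hn.trans ?_)
        push_cast
        ring
      exact_mod_cast h2
    rw [h.reebRot_zero, hT] at h1
    refine hk (-n) ?_
    have hpi := Real.pi_pos.ne'
    have h3 : -(k / (2 * G 0)) * (2 * Real.pi) = n * (2 * Real.pi) := by
      rw [← h1]
      field_simp
    have h4 := mul_right_cancel₀ (mul_ne_zero two_ne_zero hpi) h3
    push_cast
    linarith
  obtain ⟨e, he⟩ := him.mfderiv_linearEquiv
  set L : EuclideanSpace ℝ (Fin 3) →L[ℝ] EuclideanSpace ℝ (Fin 3) :=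
    mfderiv (𝓡 3) (𝓡 3) (Φ T) (P.nbhd i (0, 0)) with hL
  -- The return map is conjugate to `(s, w) ↦ (s, uw)` by the derivative of `nbhd` at `(0, 0)`.
  -- After one turn the base point is `(2π, 0)`, where periodicity gives the same derivative.
  have hLe : ∀ v : ℝ × ℂ, L (e v) = e (v.1, u * v.2) := by
    intro v
    have h1 := mfderiv_comp ((0, 0) : ℝ × ℂ) hmd him.mdifferentiableAt
    have h2 := mfderiv_eq_comp_fderiv hcomp him'.mdifferentiableAt hfl.differentiableAt v
    rw [hfl.fderiv] at h2
    have h3 : (mfderiv 𝓘(ℝ, ℝ × ℂ) (𝓡 3) (Φ T ∘ P.nbhd i) (0, 0) v : EuclideanSpace ℝ (Fin 3)) =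
        L (mfderiv 𝓘(ℝ, ℝ × ℂ) (𝓡 3) (P.nbhd i) (0, 0) v) :=
      congrArg (fun K : ℝ × ℂ →L[ℝ] EuclideanSpace ℝ (Fin 3) => K v) h1
    have h4 := P.mfderiv_nbhd_add_zmul i 1 0 (z := 0) (hlt _ hz) (v.1, u * v.2)
    rw [he, he]
    refine h3.symm.trans (h2.trans ?_)
    rw [hTflow]
    exact h4
  have hconj : (L : EuclideanSpace ℝ (Fin 3) →ₗ[ℝ] EuclideanSpace ℝ (Fin 3)) =
      e.conj (LinearMap.prodMap LinearMap.id (LinearMap.mulLeft ℝ u)) := by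
    refine LinearMap.ext fun y => ?_
    rw [LinearEquiv.conj_apply_apply]
    have := hLe (e.symm y)
    rw [LinearEquiv.apply_symm_apply] at this
    exact this
  refine ⟨U, U, X, Φ, P.nbhd i (0, 0), T, hUo, ?_, hUc, hX, hUo, haU _ hz, hTpos, ?_, ?_, ?_, ?_,
    hmd, L, hL, ?_, ?_⟩
  · rintro _ ⟨θ, rfl⟩
    exact haU _ hz
  · rintro _ ⟨x, hx, rfl⟩
    refine ⟨?_, fun t _ => ?_, fun t _ => ?_⟩
    · rw [hΦn 0 x hx]
      simp [reebFlow]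
    · have h1 := (hasMFDerivAt_reebFlow h hl hab hpull hUc hX haU hx t).hasMFDerivWithinAt
        (s := Icc 0 T)
      have h2 : (fun t => Φ t (P.nbhd i x)) = fun t => P.nbhd i (reebFlow Γ G k t x) :=
        funext fun t => hΦn t x hx
      rw [h2]
      exact h1
    · rw [hΦn t x hx]
      exact haU _ (by rw [h.norm_reebFlow]; exact hx)
  · rw [hΦn T _ hz, hTp]
  -- Minimality of `T`: a return at time `t` forces `t = nT` with an integer `n` strictly between
  -- `0` and `1`.
  · intro t ht hcon
    rw [hΦn t _ hz, hflow] at hcon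
    obtain ⟨-, -, n, hn⟩ := P.nbhd_eq_nbhd (hlt _ hz) (hlt _ hz) hcon.symm
    rw [zero_add] at hn
    have h1 : t = n * T := by
      rw [hT, ← mul_assoc, ← hn, inv_mul_cancel_right₀ h0.ne']
    have h2 : 0 < (n : ℝ) := by
      by_contra hc
      nlinarith [ht.1]
    have h3 : (n : ℝ) < 1 := by
      by_contra hc
      nlinarith [ht.2]
    have h4 : 0 < n := by exact_mod_cast h2
    have h5 : n < 1 := by exact_mod_cast h3
    omega
  · ext p
    constructor
    · rintro ⟨t, -, rfl⟩
      refine ⟨t * (Γ 0)⁻¹, ?_⟩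
      simp only
      rw [hΦn t _ hz, hflow]
    · rintro ⟨θ, rfl⟩
      obtain ⟨θ', ⟨h1, h2⟩, h3⟩ := P.exists_mem_Icc_nbhd_eq i θ (hlt _ hz)
      refine ⟨θ' * Γ 0, ⟨by positivity, ?_⟩, ?_⟩
      · rw [hT]; gcongr
      · simp only
        rw [hΦn _ _ hz, hflow, mul_inv_cancel_right₀ h0.ne']
        exact h3.symm
  · intro v hv hLv
    obtain ⟨⟨s, w⟩, rfl⟩ := e.surjective v
    -- At the binding the kernel of the form is the disk direction `s = 0`, and on it the return map
    -- is multiplication by `u ≠ 1`.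
    have h1 : Γ 0 * s = 0 := by
      have h2 := congrArg (fun K : ℝ × ℂ →L[ℝ] ℝ => K (s, w)) (hpull (0, 0) hz)
      have h3 : lam (P.nbhd i (0, 0)) (e (s, w)) = polarForm Γ G (0, 0) (s, w) := by
        rw [he]; exact h2
      rw [h3, polarForm_apply] at hv
      simpa using hv
    have hs : s = 0 := (mul_eq_zero.1 h1).resolve_left h0.ne'
    rw [hLe] at hLv
    have h4 := congrArg Prod.snd (e.injective hLv)
    simp only at h4
    have h5 : w = 0 := by
      have h6 : (u - 1) * w = 0 := by linear_combination h4
      exact (mul_eq_zero.1 h6).resolve_left (sub_ne_zero.2 hu1)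
    rw [hs, h5]
    exact map_zero e
  · intro μ hμ
    rw [hconj, LinearEquiv.charpoly_conj] at hμ
    exact norm_eq_one_of_isRoot_charpoly hun hμ

end OpenBookManifold

theorem IsLocalModel.reebModel {γ₁ γ₂ : ℝ → ℝ} (h : IsLocalModel γ₁ γ₂) {G : ℂ → ℝ} {b : ℝ}
    (hb : ModelBall (fun z => γ₁ ‖z‖) G b) (hG : ∀ z, ‖z‖ < 1 → γ₂ ‖z‖ = ‖z‖ ^ 2 * G z) :
    ReebModel (fun z => γ₁ ‖z‖) G b (iteratedDerivWithin 2 γ₁ (Ici 0) 0) where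
  toModelBall := hb
  radial₁ z w hzw _ := by simp only [hzw]
  radial₂ z w hzw hw := by
    rcases eq_or_ne w 0 with rfl | hw0
    · rw [norm_zero, norm_eq_zero] at hzw
      rw [hzw]
    · have h1 := hG z (hzw ▸ hw)
      rw [hzw, hG w hw] at h1
      exact (mul_left_cancel₀ (pow_ne_zero 2 (norm_ne_zero_iff.2 hw0)) h1).symm
  tendsto := tendsto_fderiv_norm_div one_pos h.smooth₁ h.disk₁

/-! ### Pages, kernels and Reeb vectors at a point -/

section

variable {M : Type*} [TopologicalSpace M] [ChartedSpace (EuclideanSpace ℝ (Fin 3)) M]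

theorem linearIndependent_of_dForm_ne_zero {lam : OneForm M} {p : M}
    {u v : EuclideanSpace ℝ (Fin 3)} (h : dForm lam p u v ≠ 0) :
    LinearIndependent ℝ (![u, v] : Fin 2 → EuclideanSpace ℝ (Fin 3)) := by
  rw [LinearIndependent.pair_iff]
  intro s t hst
  have h1 := dForm_combination lam p u v s t 1 0
  have h2 := dForm_combination lam p u v s t 0 1
  rw [hst] at h1 h2
  have h0 : ∀ w : EuclideanSpace ℝ (Fin 3), dForm lam p (0 : EuclideanSpace ℝ (Fin 3)) w = 0 := by
    intro w
    rw [dForm_eq_dBilin]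
    simp
  rw [h0] at h1 h2
  constructor
  · have := (mul_eq_zero.1 h2.symm).resolve_right h
    linarith
  · have := (mul_eq_zero.1 h1.symm).resolve_right h
    linarith

/-- The auxiliary `dβ` only certifies that `u` and `v` are independent; then the kernel of a nonzero
linear form on a 3-dimensional space is exactly their span. -/
theorem ker_eq_span {lam β : OneForm M} {p : M} {u v : EuclideanSpace ℝ (Fin 3)}
    (h : dForm β p u v ≠ 0) (h0 : lam p ≠ 0) (hu : lam p u = 0) (hv : lam p v = 0)
    (w : EuclideanSpace ℝ (Fin 3)) :
    lam p w = 0 ↔ w ∈ Submodule.span ℝ ({u, v} : Set (EuclideanSpace ℝ (Fin 3))) := by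
  let l : EuclideanSpace ℝ (Fin 3) →L[ℝ] ℝ := lam p
  have hl0 : l ≠ 0 := h0
  have hlu : l u = 0 := hu
  have hlv : l v = 0 := hv
  show l w = 0 ↔ _
  constructor
  · intro hw
    by_contra hcon
    have h1 : LinearIndependent ℝ (![w, u, v] : Fin 3 → EuclideanSpace ℝ (Fin 3)) := by
      refine linearIndependent_finCons.2 ⟨linearIndependent_of_dForm_ne_zero h, ?_⟩
      simpa [Matrix.range_cons, Matrix.range_empty, Set.insert_union, Set.pair_comm] using hcon
    refine hl0 (ContinuousLinearMap.ext fun x => ?_)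
    obtain ⟨a, b, c, rfl⟩ := exists_coords_of_linearIndependent (by simp) h1 x
    simp [hw, hlu, hlv]
  · intro hw
    obtain ⟨a, b, rfl⟩ := Submodule.mem_span_pair.1 hw
    simp [hlu, hlv]

/-- `dλ` is nondegenerate on the span of `u` and `v`, so a vector of the span annihilating it is
zero, contrary to `λ(X) = 1`. -/
theorem not_mem_span_of_reeb {lam : OneForm M} {p : M} {u v X : EuclideanSpace ℝ (Fin 3)}
    (h : dForm lam p u v ≠ 0) (hX : lam p X = 1) (hd : ∀ w, dForm lam p X w = 0) :
    X ∉ Submodule.span ℝ ({u, v} : Set (EuclideanSpace ℝ (Fin 3))) := by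
  intro hcon
  obtain ⟨s, t, rfl⟩ := Submodule.mem_span_pair.1 hcon
  have h1 := dForm_combination lam p u v s t 1 0
  have h2 := dForm_combination lam p u v s t 0 1
  have hs : s = 0 := by
    have := (mul_eq_zero.1 (h2.symm.trans (hd _))).resolve_right h
    linarith
  have ht : t = 0 := by
    have := (mul_eq_zero.1 (h1.symm.trans (hd _))).resolve_right h
    linarith
  let l : EuclideanSpace ℝ (Fin 3) →L[ℝ] ℝ := lam p
  have h3 : l (s • u + t • v) = 1 := hX
  rw [hs, ht] at h3
  simp at h3

theorem wedgeForm_eq_zero {lam : OneForm M} {p : M} (h : ∀ u v, dForm lam p u v = 0)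
    (u v w : TangentSpace (𝓡 3) p) : wedgeForm lam p u v w = 0 := by
  unfold wedgeForm
  rw [h, h, h]
  ring

end

/-! ### Giroux forms from positivity on the pages -/

namespace OpenBookManifold

variable {W : Type*} [TopologicalSpace W] [ChartedSpace (EuclideanHalfSpace 2) W]
  [IsManifold (𝓡∂ 2) ∞ W]
  {B : Type*} {O : AbstractOpenBook W B} {M : Type*} [TopologicalSpace M]
  [ChartedSpace (EuclideanSpace ℝ (Fin 3)) M] [IsManifold (𝓡 3) ∞ M]

theorem PageFrame.not_mem_bindingComponent {P : OpenBookManifold O M} {p : M}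
    {u v : EuclideanSpace ℝ (Fin 3)} (h : P.PageFrame p u v) (i : B) :
    p ∉ P.bindingComponent i := by
  rintro ⟨θ, hθ⟩
  rcases P.pageFrame_cases h with ⟨x, s, -, -, hp, -⟩ | ⟨j, θ', z, hp, hz, hz1, -⟩
  · exact P.nbhd_ne_fiber i θ 0 (by simp) _ (hθ.trans hp.symm)
  · have h1 := P.nbhd_eq_nbhd (z := 0) (z' := z) (by simp; linarith [O.width_pos])
      (by linarith [O.width_pos]) (hθ.trans hp.symm)
    rw [← h1.2.1, norm_zero] at hz
    exact hz.false

/-- A contact form, exact-positive on the pages, which is a local model near the binding, is a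
Giroux form. -/
theorem isGirouxForm_of_pagePos {P : OpenBookManifold O M} {lam : OneForm M}
    (hlam : IsContactForm lam) (hpos : ∀ p u v, P.PageFrame p u v → 0 < dForm lam p u v)
    {Γ G : B → ℂ → ℝ} {a b : ℝ} {k : B → ℝ} (h : ∀ i, ReebModel (Γ i) (G i) b (k i)) (ha : 0 < a)
    (hab : a ≤ b) (hpull : ∀ i x, ‖x.2‖ < a →
      pullForm lam (P.nbhd i) x = polarForm (Γ i) (G i) x) :
    P.IsGirouxForm lam ∧ ∃ X, IsReebOn lam X univ ∧ P.TransverseToPages X ∧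
      ∀ i, IsPeriodicOrbit X (P.bindingComponent i) := by
  obtain ⟨X, hX⟩ := hlam.2.exists_reeb
  have hper : ∀ i, IsPeriodicOrbit X (P.bindingComponent i) := fun i =>
    isPeriodicOrbit_bindingComponent (h i) hlam.1 ha hab (hpull i) hlam.2 hX
  refine ⟨⟨hlam, fun p u v huv => (hpos p u v huv).ne', ⟨X, hX, hper⟩, ?_⟩, X, hX, ?_, hper⟩
  · intro i θ θ' z hz hz1
    refine mul_pos ?_ ?_
    · have h1 := congrArg (fun L : ℝ × ℂ →L[ℝ] ℝ => L (1, 0)) (hpull i (θ, 0) (by simpa using ha))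
      have h2 : polarForm (Γ i) (G i) (θ, 0) (1, 0) = Γ i 0 := by
        rw [polarForm_apply]; simp
      refine lt_of_lt_of_eq ((h i).pos₁ 0 (by simpa using (h i).pos.le)) (h1.trans h2).symm
    · have hs := (P.immersiveAt_nbhd i (x := (θ', z))
        (show ‖z‖ < 1 + O.width by linarith [O.width_pos])).smooth
      have h1 := hpos _ _ _ (PageFrame.disk (P := P) i θ' z hz hz1)
      rw [dForm_mfderiv hlam.1 hs] at h1 ⊢
      have h2 : ((0, -z) : ℝ × ℂ) = -(0, z) := by simp
      rw [h2]
      unfold dAt at h1 ⊢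
      rw [map_neg, map_neg, neg_apply]
      linarith
  · intro p u v huv
    exact not_mem_span_of_reeb (hpos p u v huv).ne' (hX p (mem_univ p)).1 (hX p (mem_univ p)).2

end OpenBookManifold

end

/-! ### Assembly of the family -/

theorem mainTheorem5
    {W : Type*} [TopologicalSpace W] [ChartedSpace (EuclideanHalfSpace 2) W]
    [IsManifold (𝓡∂ 2) ∞ W] [CompactSpace W] [T2Space W]
    {B : Type*} [Finite B]
    {M : Type*} [TopologicalSpace M] [ChartedSpace (EuclideanSpace ℝ (Fin 3)) M]
    [IsManifold (𝓡 3) ∞ M] [T2Space M]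
    (O : AbstractOpenBook W B) (P : OpenBookManifold O M)
    (γ₁ γ₂ : B → ℝ → ℝ) (hγ : ∀ i, IsLocalModel (γ₁ i) (γ₂ i)) :
    ∃ lam : ℝ → OneForm M, IsSmoothFamily lam (Ico 0 1) ∧
      (P.IsConfoliationForm (lam 0) ∧
        ∃ ρ ∈ Ioo (0 : ℝ) 1, ∀ p ∉ P.tube ρ, ∀ u v, P.PageFrame p u v →
          ∀ w : TangentSpace (𝓡 3) p, lam 0 p w = 0 ↔ w ∈ Submodule.span ℝ {u, v}) ∧
      (∀ δ ∈ Ioo (0 : ℝ) 1, IsContactForm (lam δ) ∧ P.Supports (lam δ) ∧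
        ∃ X, IsReebOn (lam δ) X univ ∧ P.TransverseToPages X ∧
          ∀ i, IsPeriodicOrbit X (P.bindingComponent i)) ∧
      (∃ ρ ∈ Ioo (0 : ℝ) 1, ∀ δ ∈ Ico (0 : ℝ) 1, ∀ i θ, ∀ z : ℂ, ‖z‖ < ρ → ∀ v : ℝ × ℂ,
        lam δ (P.nbhd i (θ, z)) (mfderiv 𝓘(ℝ, ℝ × ℂ) (𝓡 3) (P.nbhd i) (θ, z) v) =
          localModelForm (γ₁ i) (γ₂ i) (θ, z) v) ∧
      ∀ δ ∈ Ico (0 : ℝ) 1, ∀ i, IsNondegenerateEllipticOrbit (lam δ) (P.bindingComponent i) := by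
  obtain ⟨G, b, hb0, hb1, hball, hG, hG0⟩ := exists_modelBall hγ
  set Γ : B → ℂ → ℝ := fun i z => γ₁ i ‖z‖ with hΓ
  have hreeb : ∀ i, ReebModel (Γ i) (G i) b (iteratedDerivWithin 2 (γ₁ i) (Ici 0) 0) := fun i =>
    (hγ i).reebModel (hball i) (hG i)
  have hw := O.width_pos
  -- For `r < a` the form is the local model; the interpolation to `dφ` takes place between `a` and
  -- `c`; `d` separates the explicit region from the global one; `e`, `f`, `g` are used to build
  -- `β`.
  obtain ⟨a, c, d, e, f, g, ha, hac, hcd, hde, hef, hfg, hgb⟩ : ∃ a c d e f g : ℝ, 0 < a ∧ a < c ∧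
      c < d ∧ d < e ∧ e < f ∧ f < g ∧ g ≤ b :=
    ⟨b / 6, b * 2 / 6, b * 3 / 6, b * 4 / 6, b * 5 / 6, b, by linarith, by linarith, by linarith,
      by linarith, by linarith, by linarith, le_rfl⟩
  have hcb : c ≤ b := by linarith
  have hdb : d ≤ b := by linarith
  have hab : a ≤ b := by linarith
  have hd1 : d < 1 := by linarith
  have ha1 : a < 1 := by linarith
  obtain ⟨lam₀, hs₀, hp₀, hker₀, hcl₀, hne₀⟩ := P.exists_baseForm hb1 hball ha hac hcd hdb
  obtain ⟨β, hsβ, hpβ, hposβ⟩ := P.exists_perturbation hb1 hball ha hac hcd hde hef hfg hgb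
  have hcM := P.compactSpace
  have hK : IsCompact (P.tube d)ᶜ := (P.isOpen_tube hd1).isClosed_compl.isCompact
  have hbind : ∀ p ∈ (P.tube d)ᶜ, ∀ i, p ∉ P.bindingComponent i := by
    rintro p hp i ⟨θ, rfl⟩
    exact hp ⟨i, θ, 0, by rw [norm_zero]; linarith, rfl⟩
  -- Compactness makes the admissible range of `s` uniform over the complement of the tube.
  have hev := hK.eventually_forall_of_forall_eventually (x₀ := (0 : ℝ))
    (P := fun s q => s ≠ 0 →
      (∀ u v, P.PageFrame q u v → lam₀ q u = 0 ∧ lam₀ q v = 0) →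
      (∀ u v, dForm lam₀ q u v = 0) → ∀ u v w : EuclideanSpace ℝ (Fin 3),
        LinearIndependent ℝ ![u, v, w] → wedgeForm (lam₀ + s • β) q u v w ≠ 0)
    (fun p hp => (hposβ p hp).eventually_contact hs₀ hsβ (hbind p hp) (hne₀ p))
  obtain ⟨ε₀, hε₀, hball₀⟩ := Metric.eventually_nhds_iff.1 hev
  -- `ε < ε₀` is for the contact condition off the tube, `ε ≤ 1` for the interpolation inequalities
  -- inside it.
  obtain ⟨ε, hε, hε1, hεε₀⟩ : ∃ ε : ℝ, 0 < ε ∧ ε ≤ 1 ∧ ε < ε₀ :=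
    ⟨min (ε₀ / 2) 1, by positivity, min_le_right _ _, (min_le_left _ _).trans_lt (by linarith)⟩
  have hsm : ∀ s : ℝ, IsSmoothForm (lam₀ + s • β) := fun s => hs₀.add_smul hsβ s
  have hpull : ∀ (s : ℝ) i x, ‖x.2‖ < d → pullForm (lam₀ + s • β) (P.nbhd i) x =
      polarForm (fun z => (radialCut a c z + s * (1 - radialCut a c z)) * Γ i z)
        (angularCoeff a c (G i)) x := by
    intro s i x hx
    rw [pullForm_add_smul]
    show pullForm lam₀ (P.nbhd i) x + s • pullForm β (P.nbhd i) x = _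
    rw [hp₀ i x (by linarith), hpβ i x hx]
    refine ContinuousLinearMap.ext fun v => ?_
    show polarForm _ _ x v + s • polarForm _ 0 x v = _
    simp only [polarForm_apply, Pi.zero_apply, smul_eq_mul]
    ring
  have hpull_ev : ∀ (s : ℝ) i x, ‖x.2‖ < d → pullForm (lam₀ + s • β) (P.nbhd i) =ᶠ[𝓝 x]
      polarForm (fun z => (radialCut a c z + s * (1 - radialCut a c z)) * Γ i z)
        (angularCoeff a c (G i)) := by
    intro s i x hx
    filter_upwards [(OpenBookManifold.isOpen_tubeDomain d).mem_nhds hx] with y hy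
      using hpull s i y hy
  have hlocal : ∀ (s : ℝ) i x, ‖x.2‖ < a → pullForm (lam₀ + s • β) (P.nbhd i) x =
      polarForm (Γ i) (G i) x := by
    intro s i x hx
    rw [hpull s i x (by linarith)]
    refine ContinuousLinearMap.ext fun v => ?_
    simp only [polarForm_apply]
    rw [radialCut_eq_one ha.le hac hx.le, angularCoeff_of_le ha.le hac hx.le]
    ring
  have hΓd : ∀ (s : ℝ) i z, ‖z‖ < d → DifferentiableAt ℝ
      (fun z => (radialCut a c z + s * (1 - radialCut a c z)) * Γ i z) z := by
    intro s i z hz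
    have h1 : DifferentiableAt ℝ (radialCut a c) z :=
      (contDiff_radialCut a c).differentiable (by simp) z
    exact (h1.add ((h1.const_sub 1).const_mul s)).mul
      (((hball i).smooth₁ z (by linarith)).differentiableAt (by simp))
  have hQd : ∀ i z, DifferentiableAt ℝ (angularCoeff a c (G i)) z := fun i z =>
    (contDiffAt_angularCoeff ha hac (by linarith) (hball i).smooth₂ z).differentiableAt (by simp)
  have hwedge : ∀ s : ℝ, 0 ≤ s → s ≤ 1 → ∀ i x, ‖x.2‖ < d → ∀ w, w = wedgeForm (lam₀ + s • β)
      (P.nbhd i x) (mfderiv 𝓘(ℝ, ℝ × ℂ) (𝓡 3) (P.nbhd i) x ((1, 0) : ℝ × ℂ))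
      (mfderiv 𝓘(ℝ, ℝ × ℂ) (𝓡 3) (P.nbhd i) x ((0, 1) : ℝ × ℂ))
      (mfderiv 𝓘(ℝ, ℝ × ℂ) (𝓡 3) (P.nbhd i) x ((0, Complex.I) : ℝ × ℂ)) →
      0 ≤ w ∧ (0 < s → 0 < w) := by
    intro s hs hs1 i x hx w hww
    have h1 := (hball i).wedge_interpolation ha hac hcb hs hs1 (hx.le.trans hdb)
      (hww.trans (OpenBookManifold.wedgeForm_nbhd (hsm s) (by linarith) (hpull_ev s i x hx)
        (hΓd s i x.2 hx) (hQd i x.2)))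
    exact ⟨h1.1, fun h => h1.2 (Or.inl h)⟩
  -- Inside the tube this is the strict decrease of the interpolated coefficient; outside, `λ₀` is
  -- closed and `dβ` alone contributes.
  have hpage : ∀ s : ℝ, 0 < s → s ≤ 1 → ∀ p u v, P.PageFrame p u v →
      0 < dForm (lam₀ + s • β) p u v := by
    intro s hs hs1 p u v huv
    by_cases hp : p ∈ P.tube d
    · obtain ⟨i, θ, z, hz, rfl⟩ := hp
      have hz0 : z ≠ 0 := by
        rintro rfl
        exact OpenBookManifold.PageFrame.not_mem_bindingComponent huv i ⟨θ, rfl⟩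
      have hzw : ‖((θ, z) : ℝ × ℂ).2‖ < 1 + O.width := show ‖z‖ < _ by linarith
      refine ((P.pageChart_nbhd i (x := (θ, z)) hz0 hzw).pagePos_iff (hsm s)).2 ?_ u v huv
      rw [dAt_congr (hpull_ev s i (θ, z) hz), dAt_polarForm_page (hΓd s i z hz) (hQd i z)]
      exact neg_pos.2 (((hball i).fderiv_interpolation ha.le hac hs.le hs1
        (hz.le.trans hdb)).2 hz0 (Or.inl hs))
    · rw [dForm_add_smul hs₀ hsβ, hcl₀ p hp, zero_add]
      exact mul_pos hs (hposβ p hp u v huv)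
  have hcontact : ∀ s : ℝ, 0 < s → s ≤ ε → IsContactForm (lam₀ + s • β) := by
    refine fun s hs hsε => ⟨hsm s, fun p _ u v w huvw => ?_⟩
    by_cases hp : p ∈ P.tube d
    · obtain ⟨i, θ, z, hz, rfl⟩ := hp
      exact wedgeForm_ne_zero ((hwedge s hs.le (hsε.trans hε1) i (θ, z) hz _ rfl).2 hs).ne' huvw
    · refine hball₀ (y := s) ?_ p hp hs.ne' (hker₀ p hp) (hcl₀ p hp) u v w huvw
      rw [Real.dist_eq, sub_zero, abs_of_pos hs]
      linarith
  have hzero : lam₀ + (0 * ε) • β = lam₀ := by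
    rw [zero_mul, zero_smul, add_zero]
  -- Rescaling by `ε` maps the parameters `[0, 1)` into the range `[0, ε)` where the contact
  -- condition holds.
  refine ⟨fun δ => lam₀ + (δ * ε) • β, ?_, ⟨?_, d, ⟨by linarith, hd1⟩, ?_⟩, ?_,
    ⟨a, ⟨ha, ha1⟩, ?_⟩, ?_⟩
  · have h1 := hs₀.isSmoothFamily (isSmoothForm_zero.add_smul hsβ ε) (Ico 0 1)
    have h2 : (fun δ : ℝ => lam₀ + (δ * ε) • β) = fun δ => lam₀ + δ • (0 + ε • β) := by
      funext δ
      rw [zero_add, smul_smul]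
    rw [h2]
    exact h1
  · simp only [hzero]
    refine ⟨hs₀, hne₀, fun p u v w h => ?_⟩
    cases h with
    | fiber x α u v huv =>
      exact (wedgeForm_eq_zero (hcl₀ _ (P.fiber_not_mem_tube hd1 _)) _ _ _).ge
    | disk i θ z hz =>
      by_cases hzd : ‖z‖ < d
      · have h1 := (hwedge 0 le_rfl zero_le_one i (θ, z) hzd _ rfl).1
        rw [zero_smul, add_zero] at h1
        exact h1
      · refine (wedgeForm_eq_zero (hcl₀ _ fun hmem => hzd ?_) _ _ _).ge
        exact (P.nbhd_mem_tube_iff hd1 (x := (θ, z)) (show ‖z‖ < _ by linarith)).1 hmem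
  · intro p hp u v huv w
    simp only [hzero]
    exact ker_eq_span (hposβ p hp u v huv).ne' (hne₀ p) (hker₀ p hp u v huv).1
      (hker₀ p hp u v huv).2 w
  · rintro δ ⟨hδ0, hδ1⟩
    have hs : 0 < δ * ε := mul_pos hδ0 hε
    have hsε : δ * ε ≤ ε := by nlinarith
    have h1 := hcontact _ hs hsε
    have h2 := OpenBookManifold.isGirouxForm_of_pagePos h1 (hpage _ hs (hsε.trans hε1)) hreeb ha hab
      (hlocal (δ * ε))
    -- The form supporting the open book is `λ_δ` itself, so the kernels agree trivially.
    exact ⟨h1, ⟨_, h2.1, fun _ _ => Iff.rfl⟩, h2.2⟩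
  · intro δ _ i θ z hz v
    have h1 := congrArg (fun L : ℝ × ℂ →L[ℝ] ℝ => L v) (hlocal (δ * ε) i (θ, z) hz)
    refine h1.trans ?_
    have h2 := hG i z (by linarith)
    rw [polarForm_apply, localModelForm, angular_eq_im]
    simp only [hΓ]
    rw [h2]
    rcases eq_or_ne z 0 with rfl | hz0
    · simp
    · rw [mul_div_cancel_left₀ _ (pow_ne_zero 2 (norm_ne_zero_iff.2 hz0))]
  · intro δ _ i
    refine OpenBookManifold.isNondegenerateEllipticOrbit_bindingComponent (hreeb i) ?_ (hsm _) ha hab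
      (hlocal (δ * ε) i)
    rw [hG0 i]
    exact (hγ i).kappa_not_int
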